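/- Let $p\in\{2,3\}$, $n\ge p$, $N+1=\binom{n+p}{n}$, and give $\bigwedge^n\mathbb{C}^{n+p}\cong\mathbb{C}^{N+1}$ the Hermitian metric for which the vectors $e_{i_1}\wedge\dots\wedge e_{i_n}$, $i_1<\dots<i_n$, are a unitary basis. Let $M_{n,p}\subset\mathbb{C}P^N=P(\bigwedge^n\mathbb{C}^{n+p})$ be the image of the Plücker embedding $L\mapsto[\bigwedge^n L]$ of the Grassmannian $Gr(n,\mathbb{C}^{n+p})$ of $n$-dimensional subspaces, and let $\hat M_{n,p}\subset S^{2N+1}$ be its inverse image under the Hopf map $S^{2N+1}\to\mathbb{C}P^N$. Then $\hat M_{n,p}$ is a Bochner rigid CR submanifold of $S^{2N+1}$, of CR dimension $np$. Here the following terminology is used. *CR submanifold.* Put $k=np$. A smooth submanifold $M\subset S^{2m+1}\subset\mathbb{C}^{m+1}$ of dimension $2k+1$ is a CR submanifold of CR dimension $k$ if for each $q\in M$ the intersection of $T_qM$ with the contact hyperplane $\mathcal{H}_q=q^\perp$ (the complex orthogonal complement) is a complex subspace of complex dimension $k$. *Constant type.* Let $\mathbb{C}^{m+1,1}=\mathbb{C}^{m+1}\oplus\mathbb{C}$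 with the Hermitian form $\langle (v,a),\overline{(w,b)}\rangle=\langle v,\bar w\rangle-a\bar b$, and lift the sphere to null vectors by $f(q)=(q,1)$. For $l\ge0$ let $O_l(q)\subset\mathbb{C}^{m+1,1}$ be the span of $f(q)$ and of all derivatives at $q$ of $f$ of order at most $l$ along $(1,0)$ vector fields of $M$. $M$ is of constant type, with height $\tau$, if $\dim O_l(q)=\nu_l+1$ for all $q\in M$ and $0\le l\le\tau$, with constants $0=\nu_0<k=\nu_1<\nu_2<\dots<\nu_\tau=m$. *Fundamental forms.* An adapted frame is a smooth local field over $M$ of bases $Z=(Z_0,Z_1,\dots,Z_m,Z_{m+1})$ of $\mathbb{C}^{m+1,1}$ in $SU(m+1,1)$, that is, unimodular with $\langle Z_A,\bar Z_B\rangle=\delta_{AB}$ for $1\le A,B\le m$, $\langle Z_0,\bar Z_{m+1}\rangle=i=-\langle Z_{m+1},\bar Z_0\rangle$ and all other products zero, such that $O_l=\langle Z_0,\dots,Z_{\nu_l}\rangle$ for $0\le l\le\tau$. Write $dZ_a=\sum_b Z_b\,\pi^b_a$, $\pi^j=\pi^j_0$ for $1\le j\le k$, $\theta=\pi^{m+1}_0$,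 and $\pi^b_a\equiv\sum_{j=1}^k h^b_{aj}\,\pi^j \bmod \theta,\bar\pi^1,\dots,\bar\pi^k$ along $M$. For $2\le l\le\tau$ the $l$-th fundamental form is $$F^l=\sum h^{i_l}_{i_{l-1}j_l}\,h^{i_{l-1}}_{i_{l-2}j_{l-1}}\cdots h^{i_2}_{j_1j_2}\;\pi^{j_l}\pi^{j_{l-1}}\cdots\pi^{j_2}\pi^{j_1}\otimes Z_{i_l},$$ where $\nu_{r-1}<i_r\le\nu_r$ for $2\le r\le l$ and $1\le j_1,\dots,j_l\le k$. It is regarded at each point as a homogeneous polynomial of degree $l$ in the unitary coframe $x^j=\pi^j$ with values in the space with unitary basis $(Z_{i_l})$. *Bochner rigidity.* Let $S^{r,s}$ be the space of complex polynomials homogeneous of degree $r$ in variables $x^1,\dots,x^d$ and of degree $s$ in $\bar x^1,\dots,\bar x^d$. A tuple $H=(H^a)$ of polynomials $H^a\in S^{l,0}$, $l\ge1$, is Bochner rigid if for every tuple $P=(P^a)$ with $P^a\in S^{l,0}$ the following holds: if $\sum_a(H^a\bar P^a+P^a\bar H^a)=\big(\sum_i x^i\bar x^i\big)f$ for some $f\in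 S^{l-1,l-1}$, then $\sum_a(H^a\bar P^a+P^a\bar H^a)=0$. A CR submanifold of $S^{2m+1}$ is a *Bochner rigid submanifold* if it is of constant type, adapted frames exist around each of its points, and for every adapted frame all the fundamental forms $F^2,\dots,F^\tau$ are Bochner rigid at every point. -/

import Mathlib

open scoped ContDiff Topology ComplexConjugate LinearAlgebra.Projectivization
open Module

noncomputable section

namespace BochnerCR

/-! ### Bochner rigid vector valued polynomials -/

section Algebra

variable {σ ι : Type*} [Fintype σ] [Fintype ι]

/-- The space `S^{k,l}` of polynomials in the variables `x^i` (the variables `inl i`) and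
`x̄^i` (the variables `inr i`) that are homogeneous of degree `k` in `x` and of degree `l`
in `x̄`. -/
def bihomogeneous (σ : Type*) (k l : ℕ) : Set (MvPolynomial (σ ⊕ σ) ℂ) :=
  {f | f.IsWeightedHomogeneous (Sum.elim (fun _ => 1) (fun _ => 0) : σ ⊕ σ → ℕ) k ∧
    f.IsWeightedHomogeneous (Sum.elim (fun _ => 0) (fun _ => 1) : σ ⊕ σ → ℕ) l}

/-- A holomorphic polynomial, regarded as a polynomial in `x` and `x̄`. -/
def hol (f : MvPolynomial σ ℂ) : MvPolynomial (σ ⊕ σ) ℂ :=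
  MvPolynomial.rename Sum.inl f

/-- The complex conjugate of a holomorphic polynomial, a polynomial in `x̄`. -/
def antihol (f : MvPolynomial σ ℂ) : MvPolynomial (σ ⊕ σ) ℂ :=
  MvPolynomial.rename Sum.inr (MvPolynomial.map (starRingEnd ℂ) f)

/-- `⟨H, P̄⟩ = ∑ₐ Hᵃ P̄ᵃ`. -/
def pairing (H P : ι → MvPolynomial σ ℂ) : MvPolynomial (σ ⊕ σ) ℂ :=
  ∑ a, hol (H a) * antihol (P a)

/-- `γ(H, P) = ⟨H, P̄⟩ + ⟨P, H̄⟩`. -/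
def gamma (H P : ι → MvPolynomial σ ℂ) : MvPolynomial (σ ⊕ σ) ℂ :=
  pairing H P + pairing P H

/-- The Hermitian metric `∑ᵢ xⁱ x̄ⁱ`. -/
def metricPoly (σ : Type*) [Fintype σ] : MvPolynomial (σ ⊕ σ) ℂ :=
  ∑ i, MvPolynomial.X (Sum.inl i) * MvPolynomial.X (Sum.inr i)

/-- An element `H = Hᵃ ⊗ eₐ` of `S^{k,0}(V*) ⊗ W`, `k ≥ 1`, given by its components in a unitary
basis `eₐ` of `W`, as polynomials in a unitary basis `xⁱ` of `V*`, is *Bochner rigid* if for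
every `P ∈ S^{k,0}(V*) ⊗ W` such that `γ(H, P) = (∑ xⁱ x̄ⁱ) f` with `f ∈ S^{k-1,k-1}` one has
`γ(H, P) = 0`. -/
def IsBochnerRigidForm (k : ℕ) (H : ι → MvPolynomial σ ℂ) : Prop :=
  ∀ P : ι → MvPolynomial σ ℂ, (∀ a, (P a).IsHomogeneous k) →
    (∃ f ∈ bihomogeneous σ (k - 1) (k - 1), gamma H P = metricPoly σ * f) →
    gamma H P = 0

end Algebra

/-! ### CR submanifolds of the unit sphere -/

section Geometry

variable {E : Type*} [NormedAddCommGroup E] [InnerProductSpace ℂ E]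

/-- `M` is a smooth embedded `d`-dimensional submanifold of `E`: each of its points has a
neighbourhood in `M` that is diffeomorphic to an open subset of `ℝᵈ`. -/
def IsSubmanifold (d : ℕ) (M : Set E) : Prop :=
  ∀ q ∈ M, ∃ (O : Set E) (U : Set (EuclideanSpace ℝ (Fin d)))
    (φ : EuclideanSpace ℝ (Fin d) → E) (ψ : E → EuclideanSpace ℝ (Fin d)),
    IsOpen O ∧ q ∈ O ∧ IsOpen U ∧ ContDiffOn ℝ ∞ φ U ∧ ContDiffOn ℝ ∞ ψ O ∧
    Set.MapsTo φ U (M ∩ O) ∧ Set.MapsTo ψ (M ∩ O) U ∧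
    Set.LeftInvOn ψ φ U ∧ Set.LeftInvOn φ ψ (M ∩ O)

/-- The tangent space `T_q M`: velocities at `q` of smooth curves in `M`. -/
def tangentSet (M : Set E) (q : E) : Set E :=
  {X | ∃ γ : ℝ → E, ContDiffAt ℝ ∞ γ 0 ∧ γ 0 = q ∧ (∀ᶠ t in 𝓝 (0 : ℝ), γ t ∈ M) ∧
    deriv γ 0 = X}

/-- `T_q M ∩ ℋ_q`, where `ℋ_q` is the contact hyperplane of the unit sphere at `q`, that is,
the complex orthogonal complement of `q`. -/
def holTangent (M : Set E) (q : E) : Set E :=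
  {X | X ∈ tangentSet M q ∧ inner ℂ q X = 0}

/-- `M` is a CR submanifold, of CR dimension `n`, of the unit sphere of `E`. -/
structure IsCRSubmanifold (n : ℕ) (M : Set E) : Prop where
  subset_sphere : M ⊆ Metric.sphere (0 : E) 1
  submanifold : IsSubmanifold (2 * n + 1) M
  complex : ∀ q ∈ M, ∃ V : Submodule ℂ E, finrank ℂ V = n ∧ (V : Set E) = holTangent M q

/-- A smooth local section, near the point `q` of `M`, of the bundle `T M ∩ ℋ`. The real vector
`X` of this bundle stands for the (1,0) vector `(X - i JX) / 2`. -/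
def IsHolField (M : Set E) (q : E) (X : E → E) : Prop :=
  ∃ O : Set E, IsOpen O ∧ q ∈ O ∧ ContDiffOn ℝ ∞ X O ∧ ∀ y ∈ M ∩ O, X y ∈ holTangent M y

/-- The derivative of `G` along the (1,0) vector field `(X - i JX) / 2`. If `X` is tangent
to `M` as above, its values on `M` only depend on `G` along `M`. -/
def delHol (X : E → E) (G : E → E × ℂ) : E → E × ℂ := fun y =>
  (1 / 2 : ℂ) • (fderiv ℝ G y (X y) - Complex.I • fderiv ℝ G y (Complex.I • X y))

/-- The lift of the unit sphere to the cone of null vectors of the Hermitian form `herm`. -/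
def lift (y : E) : E × ℂ := (y, 1)

/-- The Hermitian form `⟨z, w̄⟩` of signature `(m+1, 1)` on `E × ℂ`, `dim E = m + 1`. The map
`y ↦ [lift y]` identifies the unit sphere of `E` with the set of its null lines. -/
def herm (z w : E × ℂ) : ℂ := inner ℂ w.1 z.1 - z.2 * conj w.2

/-- The span at `q ∈ M` of the lift and its (1,0) derivatives along `M` of order at most `l`.
This is `V₀` for `l = 0`, `V₀ + V₁` for `l = 1`, and `(V₀ + V₁) ⊕ W₂ ⊕ ⋯ ⊕ W_l` for `l ≥ 2`. -/
def osc (M : Set E) (l : ℕ) (q : E) : Submodule ℂ (E × ℂ) :=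
  Submodule.span ℂ {v | ∃ Xs : List (E → E), Xs.length ≤ l ∧ (∀ X ∈ Xs, IsHolField M q X) ∧
    v = Xs.foldr delHol lift q}

/-- A CR submanifold `M`, of CR dimension `n`, of the unit sphere of `E`, `dim E = m + 1`, is of
constant type with height `τ` and type numbers `r_l = ν l - ν (l - 1)`, `2 ≤ l ≤ τ`; thus
`ν l = n + r₂ + ⋯ + r_l`, and `ν τ = m`. -/
structure HasConstantType (m n : ℕ) (M : Set E) (τ : ℕ) (ν : ℕ → ℕ) : Prop where
  one_le : 1 ≤ τ
  zero : ν 0 = 0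
  one : ν 1 = n
  top : ν τ = m
  strictMono : ∀ l < τ, ν l < ν (l + 1)
  finrank_osc : ∀ q ∈ M, ∀ l ≤ τ, finrank ℂ (osc M l q) = ν l + 1

/-- The scalar products of the vectors `Z₀, Z₁, …, Z_m, Z_{m+1}` of a frame:
`⟨Z_A, Z̄_B⟩ = δ_{AB}`, `⟨Z₀, Z̄_{m+1}⟩ = i = -⟨Z_{m+1}, Z̄₀⟩`, all others are zero. -/
def gram (m : ℕ) (a b : Fin (m + 2)) : ℂ :=
  if a = 0 then (if b = Fin.last (m + 1) then Complex.I else 0)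
  else if a = Fin.last (m + 1) then (if b = 0 then -Complex.I else 0)
  else if a = b then 1 else 0

/-- The basis `Z₀, …, Z_{m+1}` of `E × ℂ` has the scalar products listed in `gram`. -/
def IsUnitaryFrame {m : ℕ} (Z : Basis (Fin (m + 2)) ℂ (E × ℂ)) : Prop :=
  ∀ a b, herm (Z a) (Z b) = gram m a b

/-- A local section over `M ∩ O` of the adapted bundle of `SU(m+1,1)` frames. The reference
frame `e` identifies `E × ℂ` with the standard space `ℂ^{m+1,1}`. -/
structure IsAdaptedFrame {m : ℕ} (M : Set E) (τ : ℕ) (ν : ℕ → ℕ)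
    (e : Basis (Fin (m + 2)) ℂ (E × ℂ)) (O : Set E)
    (Z : E → Basis (Fin (m + 2)) ℂ (E × ℂ)) : Prop where
  isOpen : IsOpen O
  smooth : ∀ a, ContDiffOn ℝ ∞ (fun y => Z y a) O
  unitary : ∀ y ∈ M ∩ O, IsUnitaryFrame (Z y)
  det : ∀ y ∈ M ∩ O, e.det (Z y) = 1
  adapted : ∀ y ∈ M ∩ O, ∀ l ≤ τ,
    osc M l y = Submodule.span ℂ (Z y '' {a | (a : ℕ) ≤ ν l})

/-- The Maurer-Cartan form of a frame field: `dZ_a(X) = ∑_b π^b_a(X) Z_b`. -/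
def maurerCartan {m : ℕ} (Z : E → Basis (Fin (m + 2)) ℂ (E × ℂ)) (q : E)
    (b a : Fin (m + 2)) (X : E) : ℂ :=
  (Z q).repr (fderiv ℝ (fun y => Z y a) q X) b

/-- The set of the indices `a` with `ν l < a ≤ ν (l + 1)`. The vectors `Z_a` with these indices
are `Z₁, …, Z_n` for `l = 0`, and they are the basis of `W_{l+1}` for `l ≥ 1`. -/
abbrev Level (m : ℕ) (ν : ℕ → ℕ) (l : ℕ) : Type :=
  {a : Fin (m + 2) // ν l < (a : ℕ) ∧ (a : ℕ) ≤ ν (l + 1)}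

/-- The numbers `h b a j` are the coefficients `h^b_{a j}` in
`π^b_a ≡ ∑_j h^b_{a j} π^j mod θ, π^{0,1}` on `T_q M`, where `π^j = π^j_0` for `1 ≤ j ≤ n`,
`θ = π^{m+1}_0`, and `π^{0,1}` stands for the conjugates of the `π^j`. -/
def IsHolCoeff {m : ℕ} (M : Set E) (ν : ℕ → ℕ) (Z : E → Basis (Fin (m + 2)) ℂ (E × ℂ)) (q : E)
    (h : Fin (m + 2) → Fin (m + 2) → Level m ν 0 → ℂ) : Prop :=
  ∀ b a, ∃ (c : ℂ) (d : Level m ν 0 → ℂ), ∀ X ∈ tangentSet M q,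
    maurerCartan Z q b a X =
      ∑ j : Level m ν 0, h b a j * maurerCartan Z q j 0 X
      + c * maurerCartan Z q (Fin.last (m + 1)) 0 X
      + ∑ j : Level m ν 0, d j * conj (maurerCartan Z q j 0 X)

/-- `fundForm ν h l` is the `(l+1)`-st fundamental form `F^{l+1}`, given by its components
`F^b = ∑ h^b_{i_l i} h^{i_l}_{i_{l-1} j} ⋯ h^{i_2}_{k s} xⁱ xʲ ⋯ xᵏ xˢ` in the basis `Z_b` of
`W_{l+1}`, as polynomials in the unitary coframe `xʲ = πʲ`. (The value at `l = 0` is the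
tautological form `π^b ⊗ Z_b` that starts the recursion.) -/
def fundForm {m : ℕ} (ν : ℕ → ℕ) (h : Fin (m + 2) → Fin (m + 2) → Level m ν 0 → ℂ) :
    (l : ℕ) → Level m ν l → MvPolynomial (Level m ν 0) ℂ
  | 0, b => MvPolynomial.X b
  | l + 1, b => ∑ a : Level m ν l,
      (∑ j : Level m ν 0, MvPolynomial.C (h b a j) * MvPolynomial.X j) * fundForm ν h l a

/-- `M` is a Bochner rigid CR submanifold, of CR dimension `n`, of the unit sphere of `E`,
`dim E = m + 1`: it is a CR submanifold of constant type, and its fundamental forms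
`F², …, F^τ`, computed in adapted frames, are Bochner rigid at every point. Adapted frames are
required to exist around every point. -/
def IsBochnerRigidSubmanifold (m n : ℕ) (M : Set E) : Prop :=
  IsCRSubmanifold n M ∧ ∃ (τ : ℕ) (ν : ℕ → ℕ), HasConstantType m n M τ ν ∧
    ∀ e : Basis (Fin (m + 2)) ℂ (E × ℂ), IsUnitaryFrame e → ∀ q ∈ M,
      (∃ O Z, q ∈ O ∧ IsAdaptedFrame M τ ν e O Z) ∧
      ∀ O Z, q ∈ O → IsAdaptedFrame M τ ν e O Z →
        ∃ h, IsHolCoeff M ν Z q h ∧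
          ∀ l, 1 ≤ l → l + 1 ≤ τ → IsBochnerRigidForm (l + 1) (fundForm ν h l)

/-- The projection of the unit sphere to the projective space. -/
def hopf (y : Metric.sphere (0 : E) 1) : ℙ ℂ E :=
  Projectivization.mk ℂ (y : E) (ne_zero_of_mem_unit_sphere y)

/-- The canonical `S¹`-bundle over a subset of the projective space: its inverse image in the
unit sphere. -/
def circleBundle (S : Set (ℙ ℂ E)) : Set E := Subtype.val '' (hopf ⁻¹' S)

end Geometry

/-! ### The Plücker embedding -/

/-- The space `⋀ⁿ ℂᵏ` with the Hermitian metric for which the products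
`e_{i₁} ∧ ⋯ ∧ e_{iₙ}`, `i₁ < ⋯ < iₙ`, are a unitary basis. -/
abbrev Wedge (k n : ℕ) : Type := EuclideanSpace ℂ (Set.powersetCard (Fin k) n)

/-- The identification of the exterior power with its coordinate space. -/
def wedgeEquiv (k n : ℕ) : (⋀[ℂ]^n (Fin k → ℂ)) ≃ₗ[ℂ] Wedge k n :=
  ((Pi.basisFun ℂ (Fin k)).exteriorPower n).equivFun.trans (WithLp.linearEquiv 2 ℂ _).symm

/-- The Grassmannian of `n`-dimensional subspaces of `ℂᵏ`. -/
abbrev Gr (n k : ℕ) : Type := {L : Submodule ℂ (Fin k → ℂ) // finrank ℂ L = n}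

/-- The line `⋀ⁿ L` in `⋀ⁿ ℂᵏ`. -/
def pluckerLine {n k : ℕ} (L : Gr n k) : Submodule ℂ (Wedge k n) :=
  (LinearMap.range (exteriorPower.map n L.1.subtype)).map (wedgeEquiv k n).toLinearMap

theorem finrank_pluckerLine {n k : ℕ} (L : Gr n k) : finrank ℂ (pluckerLine L) = 1 := by
  have h1 : Function.Injective (exteriorPower.map n L.1.subtype) :=
    exteriorPower.map_injective_field (Submodule.subtype_injective _)
  rw [pluckerLine, LinearEquiv.finrank_map_eq, LinearMap.finrank_range_of_inj h1,
    exteriorPower.finrank_eq, L.2, Nat.choose_self]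

/-- The Plücker embedding `L ↦ [⋀ⁿ L]`. -/
def plucker {n k : ℕ} (L : Gr n k) : ℙ ℂ (Wedge k n) :=
  Projectivization.mk'' (pluckerLine L) (finrank_pluckerLine L)

end BochnerCR

end

/-! The manifold is the link (intersection with the unit sphere) of the cone `C` of nonzero
decomposable `n`-vectors. Near `q = e₁ ∧ ⋯ ∧ eₙ` the cone consists of the multiples of `U(η) q`,
where `η` runs over the `p × n` matrices and `U(η) = ⋀ⁿ(1 + η)` is an abelian unipotent group.
`GL(n+p)` acts transitively on `C`, so every point of the link is the centre of such a chart
(`nonempty_coneChart`). Let `N(η)` be the derivative of `U` at the origin, a family of commuting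
operators. Modulo lower order, a (1,0) derivative of a section of an osculating space acts as `N`
(`ConeChart.delAt_sub_N_mem`). Hence the osculating space of order `l` at `q` is the lift of the
span of the `N(η)ʲ q`, `j ≤ l`, which is the span of the basis products with at most `l` of the last
`p` indices (`osc_q`). The `l`-th fundamental form at `x` is, up to a common nonzero factor, the
class of `N(η(x))ˡ q` modulo order `l - 1` (`eval_fundForm`).

If `η` has rank one, `N(η)² = 0`. Therefore the components `Hᵃ` of the `l`-th form are affine along
rank-one directions and vanish on sums of fewer than `l` rank-one matrices. They are also linearly
independent, because the powers `N(η)ˡ q` fill the quotient. Finally, the rank-one matrices outside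
the kernel of a nonzero linear form still span (`span_unipDeriv_sq_ne`).

These facts alone give rigidity (`isBochnerRigidForm_of_affineAlong`). Polarize the hypothesis to
`∑ₐ (Hᵃ(x) P̄ᵃ(y) + Pᵃ(x) H̄ᵃ(y)) = ⟨x, y⟩ f(x, ȳ)`. If, for fixed `y ≠ 0`, the left side is affine
in `x` along rank-one directions, then `f` must be constant in `x`, so the left side is linear in
`x`; being homogeneous of degree `l ≥ 2`, it is zero. This applies first to `y` a sum of fewer than
`l` rank-one matrices: there `H(y) = 0`, and independence gives `P(y) = 0`. So `P` vanishes where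
`H` was seen to vanish. A finite difference argument (`HasDegreeLE.eq_zero`) shows that `P` is then
itself affine along rank-one directions, and the same division argument now applies to every `y`. -/

noncomputable section

namespace BochnerCR

/-! ### Functions of bounded degree and finite differences -/

section FiniteDifferences

variable {V : Type*} [AddCommGroup V]

/-- `f` is a polynomial function of degree at most `d`, in the sense of finite differences. -/
def HasDegreeLE : ℕ → (V → ℂ) → Prop
  | 0, f => ∀ b y, f (y + b) = f y
  | d + 1, f => ∀ b, HasDegreeLE d fun y => f (y + b) - f y

theorem HasDegreeLE.shift {d : ℕ} {f : V → ℂ} (hf : HasDegreeLE d f) (c : V) :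
    HasDegreeLE d fun y => f (y + c) := by
  induction d generalizing f with
  | zero => intro b y; simp only [add_right_comm y b c]; exact hf b _
  | succ d ih =>
    intro b
    have := ih (hf b)
    refine (congrArg (HasDegreeLE d) ?_).mp this
    funext y
    rw [show y + c + b = y + b + c by abel]

theorem HasDegreeLE.const (d : ℕ) (c : ℂ) : HasDegreeLE d fun _ : V => c := by
  induction d generalizing c with
  | zero => intro _ _; rfl
  | succ d ih => intro b; simpa using ih 0

theorem HasDegreeLE.add {d : ℕ} {f g : V → ℂ} (hf : HasDegreeLE d f) (hg : HasDegreeLE d g) :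
    HasDegreeLE d fun y => f y + g y := by
  induction d generalizing f g with
  | zero => intro b y; simp only [hf b y, hg b y]
  | succ d ih =>
    intro b
    refine (congrArg (HasDegreeLE d) ?_).mp (ih (hf b) (hg b))
    funext y
    ring

/-- Leibniz rule for differences, `Δ(fg) = Δf · g(· + c) + f · Δg`, with induction on the total
degree `a + b`. -/
theorem HasDegreeLE.mul {a b : ℕ} {f g : V → ℂ} (hf : HasDegreeLE a f) (hg : HasDegreeLE b g) :
    HasDegreeLE (a + b) fun y => f y * g y := by
  obtain ⟨n, hn⟩ : ∃ n, a + b = n := ⟨_, rfl⟩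
  rw [hn]
  induction n generalizing a b f g with
  | zero =>
    obtain ⟨rfl, rfl⟩ : a = 0 ∧ b = 0 := by omega
    intro c y
    simp only [hf c y, hg c y]
  | succ n ih =>
    intro c
    have h1 : HasDegreeLE n fun y => (f (y + c) - f y) * g (y + c) := by
      cases a with
      | zero =>
        simp only [hf c, sub_self, zero_mul]
        exact .const _ _
      | succ a => exact ih (hf c) (hg.shift c) (by omega)
    have h2 : HasDegreeLE n fun y => f y * (g (y + c) - g y) := by
      cases b with
      | zero =>
        simp only [hg c, sub_self, mul_zero]
        exact .const _ _
      | succ b => exact ih hf (hg c) (by omega)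
    refine (congrArg (HasDegreeLE n) ?_).mp (h1.add h2)
    funext y
    ring

theorem HasDegreeLE.pow {a : ℕ} {f : V → ℂ} (hf : HasDegreeLE a f) (k : ℕ) :
    HasDegreeLE (k * a) fun y => f y ^ k := by
  induction k with
  | zero => simpa using HasDegreeLE.const 0 1
  | succ k ih =>
    simp only [pow_succ, Nat.succ_mul]
    exact ih.mul hf

theorem HasDegreeLE.prod {ι : Type*} (s : Finset ι) {a : ι → ℕ} {f : ι → V → ℂ}
    (hf : ∀ i ∈ s, HasDegreeLE (a i) (f i)) :
    HasDegreeLE (∑ i ∈ s, a i) fun y => ∏ i ∈ s, f i y := by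
  classical
  induction s using Finset.induction_on with
  | empty => simpa using HasDegreeLE.const 0 1
  | insert i s hi ih =>
    simp only [Finset.sum_insert hi, Finset.prod_insert hi]
    exact (hf i (by simp)).mul (ih fun j hj => hf j (by simp [hj]))

theorem HasDegreeLE.sum {ι : Type*} (s : Finset ι) {d : ℕ} {f : ι → V → ℂ}
    (hf : ∀ i ∈ s, HasDegreeLE d (f i)) : HasDegreeLE d fun y => ∑ i ∈ s, f i y := by
  classical
  induction s using Finset.induction_on with
  | empty => simpa using HasDegreeLE.const d 0
  | insert i s hi ih =>
    simp only [Finset.sum_insert hi]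
    exact (hf i (by simp)).add (ih fun j hj => hf j (by simp [hj]))

theorem hasDegreeLE_eval {σ : Type*} {d : ℕ} {P : MvPolynomial σ ℂ} (hP : P.IsHomogeneous d) :
    HasDegreeLE d fun y : σ → ℂ => MvPolynomial.eval y P := by
  simp only [MvPolynomial.eval_eq]
  refine .sum _ fun m hm => ?_
  have hdeg : ∑ i ∈ m.support, m i * 1 = d := by
    have := hP (MvPolynomial.mem_support_iff.mp hm)
    rw [← this, Finsupp.weight_apply, Finsupp.sum]
    simp
  have h1 : HasDegreeLE (0 + ∑ i ∈ m.support, m i * 1)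
      fun y : σ → ℂ => P.coeff m * ∏ i ∈ m.support, y i ^ m i := by
    refine (HasDegreeLE.const 0 _).mul (.prod _ fun i _ => .pow ?_ _)
    intro b c y
    simp
  rwa [zero_add, hdeg] at h1

variable [Module ℂ V]

/-- A function of degree at most `d` that vanishes on the sums of at most `d` elements of a
spanning cone is zero. -/
theorem HasDegreeLE.eq_zero {D : Set V} (hcone : ∀ A ∈ D, ∀ t : ℂ, t • A ∈ D)
    (hD : Submodule.span ℂ D = ⊤) {d : ℕ} {f : V → ℂ} (hf : HasDegreeLE d f)
    (h0 : ∀ L : List V, (∀ A ∈ L, A ∈ D) → L.length ≤ d → f L.sum = 0) (y : V) : f y = 0 := by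
  -- Invariance under the cone makes `f` constant, since the cone spans; its value is `f 0`, the
  -- case of the empty list. This statement depends on `f`, so the induction generalizes it too and
  -- demands it again for the difference function.
  have key : (∀ A ∈ D, ∀ y, f (y + A) = f y) → ∀ y, f y = 0 := by
    intro hinv y
    have h2 : ∀ z ∈ Submodule.span ℂ D, ∀ y, f (y + z) = f y := by
      intro z hz
      induction hz using Submodule.closure_induction with
      | zero => simp
      | add x z _ _ hx hz => intro y; rw [← add_assoc, hz, hx]
      | smul_mem t x hx => exact hinv _ (hcone x hx t)
    have h3 := h2 y (hD ▸ Submodule.mem_top) 0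
    rw [zero_add] at h3
    rw [h3]
    exact h0 [] (by simp) (by simp)
  induction d generalizing f y with
  | zero => exact key (fun A _ y => hf A y) y
  | succ d ih =>
    refine key (fun A hA y => sub_eq_zero.mp ?_) y
    -- The difference `f(· + A) - f` vanishes on sums of at most `d` elements, because adjoining `A`
    -- gives a sum of at most `d + 1`.
    refine ih (hf A) (fun L hL hLl => ?_) y ?_
    · have h1 := h0 (L ++ [A]) (by simpa using fun B hB => hB.elim (hL B) (fun h => h ▸ hA))
        (by simpa using hLl)
      rw [List.sum_append, List.sum_singleton] at h1
      rw [h1, h0 L hL (by omega), sub_zero]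
    · intro hinv y
      have h2 : ∀ z ∈ Submodule.span ℂ D, ∀ y, f (y + z + A) - f (y + z) = f (y + A) - f y := by
        intro z hz
        induction hz using Submodule.closure_induction with
        | zero => simp
        | add x z _ _ hx hz => intro y; rw [← add_assoc, hz, hx]
        | smul_mem t x hx => exact fun y => hinv _ (hcone x hx t) y
      have h3 := h2 y (hD ▸ Submodule.mem_top) 0
      rw [zero_add] at h3
      rw [h3]
      have h4 := h0 [A] (by simpa using hA) (by simp)
      have h5 := h0 [] (by simp) (by simp)
      simp only [List.sum_cons, List.sum_nil, add_zero] at h4 h5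
      rw [zero_add, h4, h5, sub_zero]

/-- `f` is affine on the lines with direction `A`. -/
def AffineAlong (A : V) (f : V → ℂ) : Prop :=
  ∀ y (s t : ℂ), f (y + s • A + t • A) - f (y + s • A) - f (y + t • A) + f y = 0

theorem AffineAlong.sum {ι : Type*} (s : Finset ι) {A : V} {f : ι → V → ℂ}
    (hf : ∀ i, AffineAlong A (f i)) (c : ι → ℂ) : AffineAlong A fun y => ∑ i ∈ s, c i * f i y := by
  intro y u t
  rw [← Finset.sum_sub_distrib, ← Finset.sum_sub_distrib, ← Finset.sum_add_distrib]
  refine Finset.sum_eq_zero fun i _ => ?_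
  linear_combination c i * hf i y u t

theorem AffineAlong.add {A : V} {f g : V → ℂ} (hf : AffineAlong A f) (hg : AffineAlong A g) :
    AffineAlong A fun y => f y + g y := by
  intro y u t
  linear_combination hf y u t + hg y u t

end FiniteDifferences

/-! ### The algebraic criterion for Bochner rigidity. -/

section Rigidity

variable {V : Type*} [AddCommGroup V] [Module ℂ V]

/-- The hypothesis says that translating `f` changes it by a constant, so `f'` is invariant under
translation, hence constant. -/
theorem natDegree_le_one_of_additive (f : Polynomial ℂ)
    (h : ∀ s t, f.eval (s + t) - f.eval s - f.eval t + f.eval 0 = 0) : f.natDegree ≤ 1 := by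
  have h1 : ∀ s, f.comp (Polynomial.X + Polynomial.C s) = f + Polynomial.C (f.eval s - f.eval 0) := by
    intro s
    refine Polynomial.funext fun t => ?_
    simp only [Polynomial.eval_comp, Polynomial.eval_add, Polynomial.eval_X, Polynomial.eval_C]
    linear_combination h t s
  have h2 : ∀ s, f.derivative.eval s = f.derivative.eval 0 := by
    intro s
    have := congrArg (fun p => (Polynomial.derivative p).eval 0) (h1 s)
    simpa [Polynomial.derivative_comp] using this
  have h3 : f.derivative = Polynomial.C (f.derivative.eval 0) :=
    Polynomial.funext fun s => by simp [h2 s]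
  have h4 : (f - Polynomial.C (f.derivative.eval 0) * Polynomial.X).derivative = 0 := by
    rw [Polynomial.derivative_sub, Polynomial.derivative_C_mul_X, ← h3, sub_self]
  have h5 := Polynomial.derivative_eq_zero.mp h4
  have h6 : f = (f - Polynomial.C (f.derivative.eval 0) * Polynomial.X)
      + Polynomial.C (f.derivative.eval 0) * Polynomial.X := by ring
  rw [h6]
  refine (Polynomial.natDegree_add_le _ _).trans (max_le (by omega) ?_)
  exact Polynomial.natDegree_le_of_degree_le (Polynomial.degree_C_mul_X_le _)

/-- A product of a nonzero linear form and a polynomial function that is affine along the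
directions of a sufficiently large set is a linear form. -/
theorem exists_eq_mul_of_affineAlong {D : Set V} {lam : V →ₗ[ℂ] ℂ}
    (hspan : Submodule.span ℂ {A | A ∈ D ∧ lam A ≠ 0} = ⊤) {φ g : V → ℂ}
    (hφ : ∀ y, φ y = lam y * g y) (haff : ∀ A ∈ D, AffineAlong A φ)
    (hg : ∀ y A, ∃ p : Polynomial ℂ, ∀ t : ℂ, g (y + t • A) = p.eval t) (y : V) :
    φ y = lam y * g 0 := by
  have h1 : ∀ A ∈ {A | A ∈ D ∧ lam A ≠ 0}, ∀ t : ℂ, ∀ y, g (y + t • A) = g y := by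
    rintro A ⟨hA, hlam⟩ t y
    obtain ⟨p, hp⟩ := hg y A
    have h2 : ∀ t, φ (y + t • A)
        = ((Polynomial.C (lam A) * Polynomial.X + Polynomial.C (lam y)) * p).eval t := by
      intro t
      simp only [hφ, hp, map_add, map_smul, smul_eq_mul, Polynomial.eval_mul, Polynomial.eval_add,
        Polynomial.eval_C, Polynomial.eval_X]
      ring
    -- On the line through `y` with direction `A`, `φ` has degree at most one, while the factor
    -- `lam` already has degree one because `lam A ≠ 0`. This leaves a constant for `g`.
    have h3 := natDegree_le_one_of_additive
      ((Polynomial.C (lam A) * Polynomial.X + Polynomial.C (lam y)) * p) (by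
        intro s t
        have h5 := haff A hA y s t
        have h6 := h2 0
        rw [zero_smul, add_zero] at h6
        rwa [add_assoc y, ← add_smul, h2, h2, h2, h6] at h5)
    have h4 : p.natDegree = 0 := by
      by_contra hp0
      have hpne : p ≠ 0 := fun h => hp0 (by simp [h])
      rw [Polynomial.natDegree_mul (fun h => by
        have := Polynomial.natDegree_linear (b := lam y) hlam
        rw [h] at this; simp at this) hpne, Polynomial.natDegree_linear hlam] at h3
      omega
    rw [Polynomial.natDegree_eq_zero] at h4
    obtain ⟨c, rfl⟩ := h4
    have h7 := hp 0
    rw [zero_smul, add_zero] at h7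
    rw [hp, h7]
    simp
  have h2 : ∀ z ∈ Submodule.span ℂ {A | A ∈ D ∧ lam A ≠ 0}, ∀ y, g (y + z) = g y := by
    intro z hz
    induction hz using Submodule.closure_induction with
    | zero => simp
    | add x z _ _ hx hz => intro y; rw [← add_assoc, hz, hx]
    | smul_mem t x hx => exact h1 x hx t
  rw [hφ]
  have h3 := h2 y (hspan ▸ Submodule.mem_top) 0
  rw [zero_add] at h3
  rw [h3]

/-- The variables `x` and `x̄` are independent in the polynomial ring, so they may be evaluated at
unrelated points: this is the polarization on which the rigidity argument works. -/
theorem eval_gamma {σ ι : Type*} [Fintype ι] (H P : ι → MvPolynomial σ ℂ) (x y : σ → ℂ) :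
    MvPolynomial.eval (Sum.elim x fun i => conj (y i)) (gamma H P)
      = ∑ a, (MvPolynomial.eval x (H a) * conj (MvPolynomial.eval y (P a))
        + MvPolynomial.eval x (P a) * conj (MvPolynomial.eval y (H a))) := by
  have h1 : ∀ f : MvPolynomial σ ℂ,
      MvPolynomial.eval (Sum.elim x fun i => conj (y i)) (hol f) = MvPolynomial.eval x f := by
    intro f
    rw [hol, MvPolynomial.eval_rename]
    rfl
  have h2 : ∀ f : MvPolynomial σ ℂ, MvPolynomial.eval (Sum.elim x fun i => conj (y i)) (antihol f)
      = conj (MvPolynomial.eval y f) := by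
    intro f
    rw [antihol, MvPolynomial.eval_rename]
    rw [MvPolynomial.eval_map, MvPolynomial.eval, MvPolynomial.coe_eval₂Hom,
      MvPolynomial.eval₂_comp_left]
    rfl
  simp only [gamma, pairing, map_add, map_sum, map_mul, h1, h2, Finset.sum_add_distrib]

variable {σ ι : Type*} [Fintype σ] [Fintype ι]

theorem exists_polynomial_eval_line {τ : Type*} (f : MvPolynomial τ ℂ) (u v : τ → ℂ) :
    ∃ p : Polynomial ℂ, ∀ t : ℂ, MvPolynomial.eval (u + t • v) f = p.eval t := by
  refine ⟨MvPolynomial.aeval (fun i => Polynomial.C (u i) + Polynomial.C (v i) * Polynomial.X) f,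
    fun t => ?_⟩
  rw [MvPolynomial.aeval_def, ← Polynomial.coe_evalRingHom, MvPolynomial.eval₂_comp_left,
    MvPolynomial.eval, MvPolynomial.coe_eval₂Hom]
  congr 1
  · exact RingHom.ext fun c => by
      simp only [RingHom.id_apply, RingHom.comp_apply, Polynomial.coe_evalRingHom,
        Polynomial.algebraMap_apply, Polynomial.eval_C, Algebra.algebraMap_self]
  · funext i
    simp only [Function.comp_apply, Pi.add_apply, Pi.smul_apply, smul_eq_mul,
      Polynomial.coe_evalRingHom, Polynomial.eval_add, Polynomial.eval_mul, Polynomial.eval_C,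
      Polynomial.eval_X]
    ring

theorem eval_smul_of_isHomogeneous {l : ℕ} {Q : MvPolynomial σ ℂ} (hQ : Q.IsHomogeneous l) (t : ℂ)
    (y : σ → ℂ) : MvPolynomial.eval (t • y) Q = t ^ l * MvPolynomial.eval y Q := by
  rw [MvPolynomial.eval_eq', MvPolynomial.eval_eq', Finset.mul_sum]
  refine Finset.sum_congr rfl fun m hm => ?_
  have hdeg : ∑ i, m i = l := by
    have := hQ (MvPolynomial.mem_support_iff.mp hm)
    rw [← this, Finsupp.weight_apply, Finsupp.sum_fintype _ _ (by simp)]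
    simp
  simp only [Pi.smul_apply, smul_eq_mul, mul_pow, Finset.prod_mul_distrib, Finset.prod_pow_eq_pow_sum,
    hdeg]
  ring

/-- A family of forms that are affine along the directions of a large cone `D`, and that vanish on
the sums of few elements of `D`, is Bochner rigid. -/
theorem isBochnerRigidForm_of_affineAlong {l : ℕ} (hl : 2 ≤ l) {H : ι → MvPolynomial σ ℂ}
    {D : Set (σ → ℂ)} (hcone : ∀ A ∈ D, ∀ t : ℂ, t • A ∈ D) (hD : Submodule.span ℂ D = ⊤)
    (hspan : ∀ lam : (σ → ℂ) →ₗ[ℂ] ℂ, lam ≠ 0 →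
      Submodule.span ℂ {A | A ∈ D ∧ lam A ≠ 0} = ⊤)
    (hhom : ∀ a, (H a).IsHomogeneous l)
    (haff : ∀ a, ∀ A ∈ D, AffineAlong A fun y => MvPolynomial.eval y (H a))
    (hvan : ∀ a, ∀ L : List (σ → ℂ), (∀ A ∈ L, A ∈ D) → L.length < l →
      MvPolynomial.eval L.sum (H a) = 0)
    (hind : ∀ c : ι → ℂ, (∀ x, ∑ a, c a * MvPolynomial.eval x (H a) = 0) → c = 0) :
    IsBochnerRigidForm l H := by
  rintro P hP ⟨f, -, hf⟩
  have hγ : ∀ x y, ∑ a, (MvPolynomial.eval x (H a) * conj (MvPolynomial.eval y (P a))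
        + MvPolynomial.eval x (P a) * conj (MvPolynomial.eval y (H a)))
      = (∑ i, x i * conj (y i)) * MvPolynomial.eval (Sum.elim x fun i => conj (y i)) f := by
    intro x y
    rw [← eval_gamma, hf, map_mul]
    simp [metricPoly]
  set lam : (σ → ℂ) → (σ → ℂ) →ₗ[ℂ] ℂ := fun x =>
    ∑ i, conj (x i) • LinearMap.proj i with hlam
  have hlam_apply : ∀ x y, lam x y = ∑ i, y i * conj (x i) := by
    intro x y
    simp [hlam, mul_comm]
  have hlam_ne : ∀ x, x ≠ 0 → lam x ≠ 0 := by
    intro x hx h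
    obtain ⟨i, hi⟩ := Function.ne_iff.mp hx
    classical
    have h1 := congrArg (fun m => m (Pi.single i 1)) h
    simp only [hlam_apply, LinearMap.zero_apply] at h1
    rw [Finset.sum_eq_single i (by intro j _ hj; simp [hj]) (by simp)] at h1
    simp at h1
    exact hi h1
  have hscale : ∀ (Q : MvPolynomial σ ℂ), Q.IsHomogeneous l → ∀ (t : ℂ) y,
      MvPolynomial.eval (t • y) Q = t ^ l * MvPolynomial.eval y Q := by
    intro Q hQ t y
    exact eval_smul_of_isHomogeneous hQ t y
  have hzero : ∀ (Q : MvPolynomial σ ℂ), Q.IsHomogeneous l → MvPolynomial.eval 0 Q = 0 := by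
    intro Q hQ
    have := hscale Q hQ 0 0
    rwa [zero_smul, zero_pow (by omega), zero_mul] at this
  -- For fixed `x ≠ 0` the expression is divisible by the nonzero linear form `lam x`. If it is
  -- affine along `D` it is therefore linear in `y`, and comparison of `y` with `2y` kills it, since
  -- `2ˡ ≠ 2` for `l ≥ 2`.
  have key : ∀ x, x ≠ 0 → (∀ A ∈ D, AffineAlong A fun y =>
      ∑ a, (MvPolynomial.eval y (H a) * conj (MvPolynomial.eval x (P a))
        + MvPolynomial.eval y (P a) * conj (MvPolynomial.eval x (H a)))) → ∀ y,
      ∑ a, (MvPolynomial.eval y (H a) * conj (MvPolynomial.eval x (P a))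
        + MvPolynomial.eval y (P a) * conj (MvPolynomial.eval x (H a))) = 0 := by
    intro x hx haffx y
    have h1 := exists_eq_mul_of_affineAlong (hspan _ (hlam_ne x hx))
      (g := fun y => MvPolynomial.eval (Sum.elim y fun i => conj (x i)) f)
      (fun y => by rw [hlam_apply]; exact hγ y x) haffx (by
        intro u v
        obtain ⟨p, hp⟩ := exists_polynomial_eval_line f (Sum.elim u fun i => conj (x i))
          (Sum.elim v 0)
        refine ⟨p, fun t => ?_⟩
        rw [← hp]
        congr 2
        funext i
        cases i <;> simp)
    have h2 := h1 ((2 : ℂ) • y)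
    simp only [hscale _ (hhom _), hscale _ (hP _)] at h2
    have h3 := h1 y
    rw [map_smul, smul_eq_mul, mul_assoc, ← h3] at h2
    simp only [mul_assoc, ← mul_add, ← Finset.mul_sum] at h2
    have h4 : ((2 : ℂ) ^ l - 2) ≠ 0 := by
      obtain ⟨k, rfl⟩ := Nat.exists_eq_add_of_le hl
      have : (2 : ℂ) ^ (2 + k) - 2 = ((2 ^ (2 + k) - 2 : ℕ) : ℂ) := by
        rw [Nat.cast_sub (by rw [pow_add]; nlinarith [Nat.one_le_two_pow (n := k)])]; push_cast; ring
      rw [this, Nat.cast_ne_zero]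
      rw [pow_add]
      have := Nat.one_le_two_pow (n := k)
      omega
    refine (mul_eq_zero.mp ?_).resolve_left h4
    linear_combination h2
  -- At such a sum `H` vanishes, so only the terms `Hᵃ(y) P̄ᵃ` remain. They are affine along `D`,
  -- hence add up to zero by `key`, and the independence of the `Hᵃ` gives `Pᵃ = 0`.
  have hPvan : ∀ a, ∀ L : List (σ → ℂ), (∀ A ∈ L, A ∈ D) → L.length < l →
      MvPolynomial.eval L.sum (P a) = 0 := by
    intro a L hL hLl
    by_cases hx : L.sum = 0
    · rw [hx]; exact hzero _ (hP a)
    · have h1 := key L.sum hx (by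
        intro A hA
        simp only [hvan _ L hL hLl, map_zero, mul_zero, add_zero, mul_comm _ (conj _)]
        exact AffineAlong.sum _ (fun a => haff a A hA) _)
      simp only [hvan _ L hL hLl, map_zero, mul_zero, add_zero] at h1
      have h2 := hind (fun a => conj (MvPolynomial.eval L.sum (P a))) (by
        intro y; rw [← h1 y]; exact Finset.sum_congr rfl fun _ _ => mul_comm _ _)
      simpa using congrFun h2 a
  -- The second difference of `Pᵃ` in the directions `sA`, `tA` has degree at most `l - 2`. On a sum
  -- of at most `l - 2` elements of `D` it involves only values of `Pᵃ` at sums of at most `l - 1`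
  -- elements, which are zero.
  have hPaff : ∀ a, ∀ A ∈ D, AffineAlong A fun y => MvPolynomial.eval y (P a) := by
    intro a A hA y s t
    have hdeg := hasDegreeLE_eval (hP a)
    obtain ⟨k, rfl⟩ := Nat.exists_eq_add_of_le' hl
    have h1 := HasDegreeLE.eq_zero hcone hD (hdeg (s • A) (t • A)) (fun L hL hLl => by
      have hm : ∀ u : ℂ, MvPolynomial.eval (L.sum + u • A) (P a) = 0 := by
        intro u
        have := hPvan a (L ++ [u • A])
          (by simpa using fun B hB => hB.elim (hL B) (fun h => h ▸ hcone A hA u)) (by simp; omega)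
        simpa using this
      have h0 := hm 0
      rw [zero_smul, add_zero] at h0
      simp only [add_assoc, ← add_smul, hm, h0, sub_zero]) y
    simp only [add_right_comm y (t • A) (s • A)] at h1
    linear_combination h1
  have hfin : ∀ x y : σ → ℂ, MvPolynomial.eval (Sum.elim x fun i => conj (y i)) (gamma H P) = 0 := by
    intro x y
    rw [eval_gamma]
    by_cases hy : y = 0
    · subst hy
      simp only [hzero _ (hP _), hzero _ (hhom _), map_zero, mul_zero, add_zero,
        Finset.sum_const_zero]
    · refine key y hy (fun A hA => ?_) x
      simp only [Finset.sum_add_distrib, mul_comm _ (conj _)]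
      exact (AffineAlong.sum _ (fun a => haff a A hA) _).add
        (AffineAlong.sum _ (fun a => hPaff a A hA) _)
  -- Every point of the space of the variables `(x, x̄)` is of the form `(x, ȳ)`, so the vanishing
  -- of the polarization suffices.
  refine MvPolynomial.funext fun z => ?_
  have h1 := hfin (fun i => z (.inl i)) (fun i => conj (z (.inr i)))
  have h2 : (Sum.elim (fun i => z (.inl i)) fun i => conj (conj (z (.inr i)))) = z := by
    funext i; cases i <;> simp
  rw [h2] at h1
  rw [h1, map_zero]

end Rigidity

/-! ### Charts of cones given by abelian unipotent groups -/

section Cone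

variable {E : Type*} [NormedAddCommGroup E] [InnerProductSpace ℂ E]

/-- The intersection of a cone with the unit sphere. -/
def link (C : Set E) : Set E := C ∩ Metric.sphere (0 : E) 1

/-- A chart, centred at `q`, of the cone `C`: near `q`, the elements of `C` are the multiples of
the `U a q`, where `U` is an action of the vector group `T`. The filtration `Fil` is spanned by the
derivatives of `U a q` at the origin, and `β` is a basis that is adapted to it. The vectors of `T`
whose action has square zero are required to be abundant. -/
structure ConeChart (C : Set E) (q : E) (T : Type*) [NormedAddCommGroup T] [NormedSpace ℂ T]
    (m τ : ℕ) (ν : ℕ → ℕ) where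
  U : T → E →L[ℂ] E
  N : T →L[ℂ] E →L[ℂ] E
  y0 : E →L[ℂ] ℂ
  κ : E →L[ℂ] T
  Fil : ℕ → Submodule ℂ E
  β : Basis (Fin (m + 1)) ℂ E
  U_add : ∀ a b, U (a + b) = U a * U b
  U_zero : U 0 = 1
  contDiff_U : ContDiff ℂ ∞ U
  hasFDerivAt_U : HasFDerivAt U N 0
  U_mem : ∀ a, ∀ v ∈ C, U a v ∈ C
  y0_U : ∀ a, y0 (U a q) = 1
  κ_U : ∀ a, κ (U a q) = a
  graph : ∀ v ∈ C, y0 v ≠ 0 → v = y0 v • U (κ ((y0 v)⁻¹ • v)) q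
  Fil_zero : Fil 0 = Submodule.span ℂ {q}
  Fil_mono : Monotone Fil
  N_mem : ∀ a l, ∀ v ∈ Fil l, N a v ∈ Fil (l + 1)
  Fil_succ : ∀ l, Fil (l + 1) ≤ Fil l ⊔ Submodule.span ℂ (Set.range fun a => (N a ^ (l + 1)) q)
  Fil_eq : ∀ l ≤ τ, Fil l = Submodule.span ℂ (β '' {a | (a : ℕ) ≤ ν l})
  span_sq : Submodule.span ℂ {a | N a * N a = 0} = ⊤
  span_sq_ne : ∀ lam : T →ₗ[ℂ] ℂ, lam ≠ 0 →
    Submodule.span ℂ {a | N a * N a = 0 ∧ lam a ≠ 0} = ⊤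

theorem mem_of_hasDerivAt_of_eventually_mem {F : Type*} [NormedAddCommGroup F] [NormedSpace ℂ F]
    [FiniteDimensional ℂ F] (S : Submodule ℂ F) {f : ℝ → F} {f' : F} (hf : HasDerivAt f f' 0)
    (h : ∀ᶠ t in 𝓝 (0 : ℝ), f t ∈ S) : f' ∈ S := by
  have h1 := hasDerivAt_iff_tendsto_slope.mp hf
  refine S.closed_of_finiteDimensional.mem_of_tendsto h1 ?_
  filter_upwards [h.filter_mono nhdsWithin_le_nhds] with t ht
  have h0 := h.self_of_nhds
  rw [slope_def_module]
  exact S.smul_of_tower_mem _ (S.sub_mem ht h0)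

theorem hasDerivAt_comp_curve {F : Type*} [NormedAddCommGroup F] [NormedSpace ℝ F] {γ : ℝ → E}
    {z X : E} (hγ : HasDerivAt γ X 0) (h0 : γ 0 = z) {g : E → F} {g' : E →L[ℝ] F}
    (hg : HasFDerivAt g g' z) : HasDerivAt (fun t => g (γ t)) (g' X) 0 := by
  subst h0
  exact hg.comp_hasDerivAt 0 hγ

theorem exists_curve_of_mem_tangentSet {M : Set E} {z X : E} (hX : X ∈ tangentSet M z) :
    ∃ γ : ℝ → E, HasDerivAt γ X 0 ∧ γ 0 = z ∧ Filter.Tendsto γ (𝓝 0) (𝓝 z) ∧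
      ∀ᶠ t in 𝓝 (0 : ℝ), γ t ∈ M := by
  obtain ⟨γ, h1, h2, h3, h4⟩ := hX
  have h5 := (h1.differentiableAt (by simp)).hasDerivAt
  rw [h4] at h5
  refine ⟨γ, h5, h2, ?_, h3⟩
  rw [← h2]
  exact h5.continuousAt

/-- The derivative of `G` at `z` along the (1,0) vector `(X - i JX) / 2`. -/
def delAt {F : Type*} [NormedAddCommGroup F] [NormedSpace ℂ F] (G : E → F) (z X : E) : F :=
  (1 / 2 : ℂ) • (fderiv ℝ G z X - Complex.I • fderiv ℝ G z (Complex.I • X))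

theorem delHol_apply (X : E → E) (G : E → E × ℂ) (z : E) : delHol X G z = delAt G z (X z) := rfl

namespace ConeChart

variable {C : Set E} {q : E} {T : Type*} [NormedAddCommGroup T] [NormedSpace ℂ T]
  {m τ : ℕ} {ν : ℕ → ℕ} (c : ConeChart C q T m τ ν)

/-- The coordinate of the chart. -/
def ξ (z : E) : T := c.κ ((c.y0 z)⁻¹ • z)

theorem U_neg_mul (a : T) : c.U (-a) * c.U a = 1 := by
  rw [← c.U_add, neg_add_cancel, c.U_zero]

theorem U_mul_neg (a : T) : c.U a * c.U (-a) = 1 := by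
  rw [← c.U_add, add_neg_cancel, c.U_zero]

theorem U_neg_apply (a : T) (v : E) : c.U (-a) (c.U a v) = v := by
  have := congrArg (fun f => f v) (c.U_neg_mul a)
  simpa using this

theorem U_apply_neg (a : T) (v : E) : c.U a (c.U (-a) v) = v := by
  have := congrArg (fun f => f v) (c.U_mul_neg a)
  simpa using this

theorem y0_q : c.y0 q = 1 := by
  have := c.y0_U 0
  rwa [c.U_zero] at this

theorem κ_q : c.κ q = 0 := by
  have := c.κ_U 0
  rwa [c.U_zero] at this

theorem q_ne_zero (c : ConeChart C q T m τ ν) : q ≠ 0 := by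
  intro h
  have := congrArg c.y0 h
  rw [c.y0_q, map_zero] at this
  exact one_ne_zero this

theorem ξ_q : c.ξ q = 0 := by
  rw [ξ, c.y0_q, inv_one, one_smul, c.κ_q]

/-- The group law `U b = U a · U (b - a)` moves the derivative at the origin to `a`. -/
theorem hasFDerivAt_U_at (a : T) :
    HasFDerivAt c.U ((ContinuousLinearMap.mul ℂ (E →L[ℂ] E) (c.U a)).comp c.N) a := by
  have h1 : HasFDerivAt (fun b => c.U (b - a)) c.N a := by
    have h2 : HasFDerivAt (fun b : T => b - a) (ContinuousLinearMap.id ℂ T) a :=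
      (hasFDerivAt_id a).sub_const a
    have h3 : HasFDerivAt c.U c.N (a - a) := by rw [sub_self]; exact c.hasFDerivAt_U
    exact HasFDerivAt.comp (f := fun b : T => b - a) a h3 h2
  have h4 := (ContinuousLinearMap.mul ℂ (E →L[ℂ] E) (c.U a)).hasFDerivAt.comp a h1
  refine h4.congr_of_eventuallyEq (Filter.Eventually.of_forall fun b => ?_)
  simp [← c.U_add]

theorem hasDerivAt_U_apply (a : T) (v : E) :
    HasDerivAt (fun t : ℂ => c.U (t • a) v) (c.N a v) 0 := by
  have h1 : HasDerivAt (fun t : ℂ => t • a) a 0 := by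
    simpa using (hasDerivAt_id (0 : ℂ)).smul_const a
  have h2 : HasFDerivAt c.U c.N ((0 : ℂ) • a) := by rw [zero_smul]; exact c.hasFDerivAt_U
  have h3 := h2.comp_hasDerivAt (0 : ℂ) h1
  exact (ContinuousLinearMap.apply ℂ E v).hasFDerivAt.comp_hasDerivAt (0 : ℂ) h3

theorem κ_N (a : T) : c.κ (c.N a q) = a := by
  have h1 := c.κ.hasFDerivAt.comp_hasDerivAt (0 : ℂ) (c.hasDerivAt_U_apply a q)
  have h2 : HasDerivAt (fun t : ℂ => t • a) a 0 := by
    simpa using (hasDerivAt_id (0 : ℂ)).smul_const a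
  refine h1.unique (h2.congr_of_eventuallyEq (Filter.Eventually.of_forall fun t => ?_))
  exact c.κ_U _

/-- Derivative at `t = 0` of `U a · U (tb) = U (tb) · U a`. -/
theorem U_commute_N (a b : T) : Commute (c.U a) (c.N b) := by
  have h0 : HasDerivAt (fun t : ℂ => c.U (t • b)) (c.N b) 0 := by
    have h1 : HasDerivAt (fun t : ℂ => t • b) b 0 := by
      simpa using (hasDerivAt_id (0 : ℂ)).smul_const b
    have h2 : HasFDerivAt c.U c.N ((0 : ℂ) • b) := by rw [zero_smul]; exact c.hasFDerivAt_U
    exact h2.comp_hasDerivAt (0 : ℂ) h1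
  have h1 := h0.const_mul (c.U a)
  have h2 := h0.mul_const (c.U a)
  refine h1.unique (h2.congr_of_eventuallyEq (Filter.Eventually.of_forall fun t => ?_))
  simp only [← c.U_add, add_comm]

theorem N_commute (a b : T) : Commute (c.N a) (c.N b) := by
  have h0 : HasDerivAt (fun t : ℂ => c.U (t • a)) (c.N a) 0 := by
    have h1 : HasDerivAt (fun t : ℂ => t • a) a 0 := by
      simpa using (hasDerivAt_id (0 : ℂ)).smul_const a
    have h2 : HasFDerivAt c.U c.N ((0 : ℂ) • a) := by rw [zero_smul]; exact c.hasFDerivAt_U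
    exact h2.comp_hasDerivAt (0 : ℂ) h1
  have h1 := h0.const_mul (c.N b)
  have h2 := h0.mul_const (c.N b)
  refine (h1.unique (h2.congr_of_eventuallyEq (Filter.Eventually.of_forall fun t => ?_))).symm
  exact (c.U_commute_N _ _).symm

theorem isOpen_domain : IsOpen {z | c.y0 z ≠ 0} :=
  isOpen_ne_fun c.y0.continuous continuous_const

theorem contDiffAt_ξ {z : E} (hz : c.y0 z ≠ 0) : ContDiffAt ℂ ∞ c.ξ z :=
  c.κ.contDiff.contDiffAt.comp z ((c.y0.contDiff.contDiffAt.inv hz).smul contDiffAt_id)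

theorem contDiffAt_U_ξ {z : E} (hz : c.y0 z ≠ 0) : ContDiffAt ℝ ∞ (fun w => c.U (c.ξ w)) z :=
  (c.contDiff_U.contDiffAt.comp z (c.contDiffAt_ξ hz)).restrict_scalars ℝ

theorem hasFDerivAt_ξ {z : E} (hz : c.y0 z ≠ 0) : HasFDerivAt c.ξ (fderiv ℂ c.ξ z) z :=
  ((c.contDiffAt_ξ hz).differentiableAt (by simp)).hasFDerivAt

/-- The fibre at `z` of the bundle of osculating spaces of order `l`. -/
def oscAt (l : ℕ) (z : E) : Submodule ℂ (E × ℂ) where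
  carrier := {G | c.U (-c.ξ z) G.1 ∈ c.Fil l ∧ G.2 = inner ℂ z G.1}
  add_mem' := by
    rintro G G' ⟨h1, h2⟩ ⟨h3, h4⟩
    refine ⟨?_, ?_⟩
    · simpa using Submodule.add_mem _ h1 h3
    · simp [h2, h4]
  zero_mem' := by simp
  smul_mem' := by
    rintro a G ⟨h1, h2⟩
    refine ⟨?_, ?_⟩
    · simpa using Submodule.smul_mem _ a h1
    · simp [h2]

theorem mem_oscAt {l : ℕ} {z : E} {G : E × ℂ} :
    G ∈ c.oscAt l z ↔ c.U (-c.ξ z) G.1 ∈ c.Fil l ∧ G.2 = inner ℂ z G.1 := Iff.rfl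

theorem mem_oscAt_q {l : ℕ} {G : E × ℂ} :
    G ∈ c.oscAt l q ↔ G.1 ∈ c.Fil l ∧ G.2 = inner ℂ q G.1 := by
  rw [mem_oscAt, c.ξ_q, neg_zero, c.U_zero]
  rfl

theorem U_neg_ξ_apply_self {z : E} (hz : z ∈ C) (h0 : c.y0 z ≠ 0) :
    c.U (-c.ξ z) z = c.y0 z • q := by
  have h1 := c.graph z hz h0
  change z = c.y0 z • c.U (c.ξ z) q at h1
  refine (congrArg (c.U (-c.ξ z)) h1).trans ?_
  rw [map_smul, c.U_neg_apply]

theorem lift_mem_oscAt {z : E} (hz : z ∈ link C) (h0 : c.y0 z ≠ 0) : lift z ∈ c.oscAt 0 z := by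
  refine ⟨?_, ?_⟩
  · change c.U (-c.ξ z) z ∈ c.Fil 0
    rw [c.U_neg_ξ_apply_self hz.1 h0, c.Fil_zero]
    exact Submodule.smul_mem _ _ (Submodule.mem_span_singleton_self q)
  · have : ‖z‖ = 1 := by simpa using hz.2
    simp [lift, inner_self_eq_norm_sq_to_K, this]

variable [FiniteDimensional ℂ E]

/-- Moved back by `U (-ξ)`, the section takes values in the fixed subspace `Fil l`, so its
derivative along a curve in `M` stays there. The product rule produces the correction `-N (dξ X) g`,
because `U` has logarithmic derivative `N`. -/
theorem fderiv_sub_N_mem {z X : E} (h0 : c.y0 z ≠ 0) {M : Set E} {l : ℕ} {g : E → E}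
    (hg : DifferentiableAt ℝ g z) (hmem : ∀ᶠ w in 𝓝 z, w ∈ M → c.U (-c.ξ w) (g w) ∈ c.Fil l)
    (hX : X ∈ tangentSet M z) :
    c.U (-c.ξ z) (fderiv ℝ g z X - c.N (fderiv ℂ c.ξ z X) (g z)) ∈ c.Fil l := by
  obtain ⟨γ, hγ, hγ0, hγt, hγM⟩ := exists_curve_of_mem_tangentSet hX
  have h1 : HasFDerivAt (fun w => c.U (-c.ξ w))
      (((ContinuousLinearMap.mul ℂ (E →L[ℂ] E) (c.U (-c.ξ z))).comp c.N).comp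
        (-fderiv ℂ c.ξ z)) z :=
    (c.hasFDerivAt_U_at (-c.ξ z)).comp z (c.hasFDerivAt_ξ h0).neg
  have h2 := hasDerivAt_comp_curve hγ hγ0 (h1.restrictScalars ℝ)
  have h3 := hasDerivAt_comp_curve hγ hγ0 hg.hasFDerivAt
  have h5 : HasDerivAt (fun t => c.U (-c.ξ (γ t)) (g (γ t)))
      (c.U (-c.ξ z) (fderiv ℝ g z X - c.N (fderiv ℂ c.ξ z X) (g z))) 0 := by
    have h4 := ((isBoundedBilinearMap_apply (𝕜 := ℂ) (E := E) (F := E)).hasFDerivAt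
      (c.U (-c.ξ (γ 0)), g (γ 0))).restrictScalars ℝ
    have h6 := h4.comp_hasDerivAt (0 : ℝ) (h2.prodMk h3)
    refine h6.congr_deriv ?_
    simp [hγ0, sub_eq_add_neg]
  refine mem_of_hasDerivAt_of_eventually_mem _ h5 ?_
  filter_upwards [hγt.eventually hmem, hγM] with t ht ht' using ht ht'

end ConeChart

end Cone

/-! ### Tangent vectors of the link, and (1,0) derivatives of sections of the osculating spaces. -/

section Cone

variable {E : Type*} [NormedAddCommGroup E] [InnerProductSpace ℂ E]

/-- A curve in the cone is pushed to the link by normalization; since `d‖Y‖ = Re ⟨y, v⟩` at a unit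
vector, this subtracts the radial part of the velocity. -/
theorem mem_tangentSet_link {C : Set E} (hC : ∀ v ∈ C, ∀ a : ℂ, a ≠ 0 → a • v ∈ C) {y X : E}
    (hy : y ∈ link C) {Y : ℝ → E} (hY : ContDiff ℝ ∞ Y) (hY0 : Y 0 = y) (hYC : ∀ t, Y t ∈ C)
    {v : E} (hYd : deriv Y 0 = v) (hX : v - ((inner ℂ y v).re : ℂ) • y = X) :
    X ∈ tangentSet (link C) y := by
  have hy1 : ‖y‖ = 1 := by simpa using hy.2
  have hne : y ≠ 0 := fun h => by simp [h] at hy1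
  have hev : ∀ᶠ t in 𝓝 (0 : ℝ), Y t ≠ 0 :=
    hY.continuous.continuousAt.eventually_ne (by rwa [hY0])
  have hYd' : HasDerivAt Y v 0 := by
    rw [← hYd]
    exact (hY.differentiable (by simp) 0).hasDerivAt
  have hn : ContDiffAt ℝ ∞ (fun t => ‖Y t‖) 0 :=
    hY.contDiffAt.norm ℂ (by rwa [hY0])
  refine ⟨fun t => (‖Y t‖⁻¹ : ℝ) • Y t, ?_, ?_, ?_, ?_⟩
  · exact (hn.inv (by simpa [hY0] using hne)).smul hY.contDiffAt
  · simp [hY0, hy1]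
  · filter_upwards [hev] with t ht
    refine ⟨?_, ?_⟩
    · have : (‖Y t‖⁻¹ : ℝ) • Y t = ((‖Y t‖⁻¹ : ℝ) : ℂ) • Y t := (Complex.coe_smul _ _).symm
      simp only [this]
      exact hC _ (hYC t) _ (by simpa using ht)
    · simp [norm_smul, ht]
  · have h1 : HasDerivAt (fun t => ‖Y t‖) (inner ℂ y v).re 0 := by
      have h2 := Complex.reCLM.hasFDerivAt.comp_hasDerivAt (0 : ℝ) (hYd'.inner ℂ hYd')
      have h3 := h2.sqrt (by simp [hY0, inner_self_eq_norm_sq_to_K, hy1])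
      refine (h3.congr_deriv ?_).congr_of_eventuallyEq (Filter.Eventually.of_forall fun t => ?_)
      · have h4 : (inner ℂ v y).re = (inner ℂ y v).re := by
          rw [← inner_conj_symm v y, Complex.conj_re]
        simp [hY0, inner_self_eq_norm_sq_to_K, hy1, h4]
      · simp [inner_self_eq_norm_sq_to_K, ← Complex.ofReal_pow]
    have h2 := (h1.inv (by simp [hY0, hy1])).smul hYd'
    have h3 := h2.deriv
    rw [show (fun t => (‖Y t‖⁻¹ : ℝ) • Y t) = (fun t => ‖Y t‖)⁻¹ • Y from rfl, h3, ← hX]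
    simp only [hY0, hy1, Pi.inv_apply]
    rw [Complex.coe_smul]
    simp [sub_eq_add_neg]

namespace ConeChart

variable {C : Set E} {q : E} {T : Type*} [NormedAddCommGroup T] [NormedSpace ℂ T]
  {m τ : ℕ} {ν : ℕ → ℕ} (c : ConeChart C q T m τ ν)

/-- The curves `e^{bt} U(ta) y` show that `N a y + b y` is tangent to the link. -/
theorem N_add_smul_mem_tangentSet (hC : ∀ v ∈ C, ∀ a : ℂ, a ≠ 0 → a • v ∈ C) {y : E}
    (hy : y ∈ link C) (a : T) (b : ℂ) (hre : (inner ℂ y (c.N a y + b • y)).re = 0) :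
    c.N a y + b • y ∈ tangentSet (link C) y := by
  have h1 : ∀ t : ℝ, HasDerivAt (fun t : ℝ => Complex.exp (t * b)) (Complex.exp (t * b) * b) t := by
    intro t
    have := ((Complex.ofRealCLM.hasDerivAt (x := t)).mul_const b).cexp
    simpa using this
  have h2 : ContDiff ℝ ∞ fun t : ℝ => Complex.exp (t * b) :=
    ((Complex.ofRealCLM.contDiff.mul contDiff_const)).cexp
  have h3 : ContDiff ℝ ∞ fun t : ℝ => c.U ((t : ℂ) • a) y := by
    have h4 : ContDiff ℝ ∞ fun t : ℝ => (t : ℂ) • a :=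
      Complex.ofRealCLM.contDiff.smul contDiff_const
    have h5 := (c.contDiff_U.restrict_scalars ℝ).comp h4
    exact ((ContinuousLinearMap.apply ℂ E y).restrictScalars ℝ).contDiff.comp h5
  refine mem_tangentSet_link hC hy (Y := fun t => Complex.exp (t * b) • c.U ((t : ℂ) • a) y)
    (h2.smul h3) ?_ (fun t => hC _ (c.U_mem _ _ hy.1) _ (Complex.exp_ne_zero _))
    (v := c.N a y + b • y) ?_ ?_
  · simp [c.U_zero]
  · have h6 : HasDerivAt (fun t : ℝ => c.U ((t : ℂ) • a) y) (c.N a y) 0 := by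
      have := (c.hasDerivAt_U_apply a y)
      have h7 : HasDerivAt (fun t : ℝ => (t : ℂ)) 1 0 := Complex.ofRealCLM.hasDerivAt
      have h8 := HasDerivAt.scomp (0 : ℝ) (h := fun t : ℝ => (t : ℂ)) (by simpa using this) h7
      rw [one_smul] at h8
      exact h8
    have := ((h1 0).smul h6).deriv
    refine this.trans ?_
    simp [c.U_zero]
  · rw [hre, Complex.ofReal_zero, zero_smul, sub_zero]

/-- The relation `G.2 = ⟨z, G.1⟩` says that `G` is orthogonal to `lift z`. Its dependence on `z` is
antiholomorphic, so the term in which `z` is differentiated is conjugate linear in `X` and drops out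
of a (1,0) derivative. -/
theorem delAt_snd {z X : E} {M : Set E} {l : ℕ} {G : E → E × ℂ}
    (hG : DifferentiableAt ℝ G z) (hmem : ∀ᶠ w in 𝓝 z, w ∈ M → G w ∈ c.oscAt l w)
    (hX : X ∈ tangentSet M z) (hIX : Complex.I • X ∈ tangentSet M z) :
    (delAt G z X).2 = inner ℂ z (delAt G z X).1 := by
  -- For a real tangent vector `Y` both terms of the product rule are present.
  have key : ∀ Y ∈ tangentSet M z,
      (fderiv ℝ G z Y).2 = inner ℂ Y (G z).1 + inner ℂ z (fderiv ℝ G z Y).1 := by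
    intro Y hY
    obtain ⟨γ, hγ, hγ0, hγt, hγM⟩ := exists_curve_of_mem_tangentSet hY
    have h1 := hasDerivAt_comp_curve hγ hγ0 hG.hasFDerivAt
    have h2 : HasDerivAt (fun t => (G (γ t)).2) (fderiv ℝ G z Y).2 0 := h1.snd
    have h3 : HasDerivAt (fun t => (G (γ t)).1) (fderiv ℝ G z Y).1 0 := h1.fst
    have h4 := hγ.inner ℂ h3
    have h5 : (fun t => (G (γ t)).2) =ᶠ[𝓝 0] fun t => inner ℂ (γ t) (G (γ t)).1 := by
      filter_upwards [hγt.eventually hmem, hγM] with t ht ht' using (ht ht').2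
    have h6 := h2.unique (h4.congr_of_eventuallyEq h5)
    rw [h6, hγ0, add_comm]
  have h1 := key X hX
  have h2 := key _ hIX
  simp only [delAt, Prod.smul_snd, Prod.smul_fst, Prod.fst_sub, Prod.snd_sub, h1, h2,
    inner_smul_left, inner_smul_right, inner_sub_right, Complex.conj_I, smul_eq_mul]
  ring_nf
  rw [Complex.I_sq]
  ring

theorem N_pow_mem (a : T) (l : ℕ) : (c.N a ^ l) q ∈ c.Fil l := by
  induction l with
  | zero => rw [c.Fil_zero]; exact Submodule.mem_span_singleton_self q
  | succ l ih => rw [pow_succ']; exact c.N_mem _ _ _ ih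

theorem exists_of_mem_Fil_one {X : E} (hX : X ∈ c.Fil 1) : ∃ (a : T) (b : ℂ), X = c.N a q + b • q := by
  have h1 := c.Fil_succ 0 hX
  rw [c.Fil_zero] at h1
  obtain ⟨u, hu, v, hv, rfl⟩ := Submodule.mem_sup.mp h1
  obtain ⟨b, rfl⟩ := Submodule.mem_span_singleton.mp hu
  have h2 : v ∈ LinearMap.range (((ContinuousLinearMap.apply ℂ E q).comp c.N : T →L[ℂ] E) : T →ₗ[ℂ] E) := by
    refine Submodule.span_le.mpr ?_ hv
    rintro _ ⟨a, rfl⟩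
    exact ⟨a, by simp⟩
  obtain ⟨a, rfl⟩ := h2
  exact ⟨a, b, by simp [add_comm]⟩

variable [FiniteDimensional ℂ E]

/-- Apply `fderiv_sub_N_mem` to `X` and to `iX`. The coordinate `ξ` is holomorphic and `N` is
complex linear, so the two corrections combine with the factor `½(1 - i·i) = 1` and the full term `N
(dξ X)` survives. -/
theorem delAt_sub_N_mem {z X : E} (h0 : c.y0 z ≠ 0) {M : Set E} {l : ℕ} {G : E → E × ℂ}
    (hG : DifferentiableAt ℝ G z) (hmem : ∀ᶠ w in 𝓝 z, w ∈ M → G w ∈ c.oscAt l w)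
    (hX : X ∈ tangentSet M z) (hIX : Complex.I • X ∈ tangentSet M z) :
    c.U (-c.ξ z) ((delAt G z X).1 - c.N (fderiv ℂ c.ξ z X) (G z).1) ∈ c.Fil l := by
  have hg : DifferentiableAt ℝ (fun w => (G w).1) z := hG.fst
  have h1 := c.fderiv_sub_N_mem h0 hg (hmem.mono fun w hw hM => (hw hM).1) hX
  have h2 := c.fderiv_sub_N_mem h0 hg (hmem.mono fun w hw hM => (hw hM).1) hIX
  have h3 := (c.Fil l).smul_mem (1 / 2 : ℂ) ((c.Fil l).sub_mem h1 ((c.Fil l).smul_mem Complex.I h2))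
  have h4 : fderiv ℝ (fun w => (G w).1) z = (ContinuousLinearMap.fst ℝ E ℂ).comp (fderiv ℝ G z) :=
    hG.hasFDerivAt.fst.fderiv
  refine (congrArg (· ∈ c.Fil l) ?_).mp h3
  simp only [← map_smul, ← map_sub]
  congr 1
  simp only [delAt, h4, ContinuousLinearMap.comp_apply, ContinuousLinearMap.coe_fst', map_smul,
    smul_apply, Prod.smul_fst, Prod.fst_sub, smul_sub, smul_smul]
  have h5 : (1 / 2 * (Complex.I * Complex.I) : ℂ) = -(1 / 2) := by rw [Complex.I_mul_I]; ring
  rw [h5]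
  module

/-- The (1,0) derivatives of sections of `oscAt l` are sections of `oscAt (l + 1)`. -/
theorem delAt_mem_oscAt {z X : E} (h0 : c.y0 z ≠ 0) {M : Set E} {l : ℕ} {G : E → E × ℂ}
    (hG : DifferentiableAt ℝ G z) (hmem : ∀ᶠ w in 𝓝 z, w ∈ M → G w ∈ c.oscAt l w) (hz : z ∈ M)
    (hX : X ∈ tangentSet M z) (hIX : Complex.I • X ∈ tangentSet M z) :
    delAt G z X ∈ c.oscAt (l + 1) z := by
  refine ⟨?_, c.delAt_snd hG hmem hX hIX⟩
  have h1 := c.Fil_mono (Nat.le_succ l) (c.delAt_sub_N_mem h0 hG hmem hX hIX)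
  have h2 : c.U (-c.ξ z) (c.N (fderiv ℂ c.ξ z X) (G z).1) ∈ c.Fil (l + 1) := by
    have h3 := congrArg (fun f => f (G z).1) (c.U_commute_N (-c.ξ z) (fderiv ℂ c.ξ z X)).eq
    simp only [mul_apply_eq_comp] at h3
    rw [h3]
    exact c.N_mem _ _ _ (hmem.self_of_nhds hz).1
  have h3 := (c.Fil (l + 1)).add_mem h1 h2
  rwa [← map_add, sub_add_cancel] at h3

theorem sub_N_mem_of_mem_tangentSet {X : E}
    (hX : X ∈ tangentSet (link C) q) :
    X - c.N (fderiv ℂ c.ξ q X) q ∈ c.Fil 0 := by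
  have h0 : c.y0 q ≠ 0 := by rw [c.y0_q]; exact one_ne_zero
  have h1 := c.fderiv_sub_N_mem h0 (l := 0) (g := fun w => w) differentiableAt_id (M := link C) ?_ hX
  · rw [c.ξ_q, neg_zero, c.U_zero] at h1
    simpa using h1
  · filter_upwards [c.isOpen_domain.mem_nhds h0] with w hw hM
    exact (c.lift_mem_oscAt hM hw).1

/-- The tangent space of the link at the centre of the chart. -/
theorem mem_tangentSet_q (hC : ∀ v ∈ C, ∀ a : ℂ, a ≠ 0 → a • v ∈ C) (hq : q ∈ link C) {X : E} :
    X ∈ tangentSet (link C) q ↔ X ∈ c.Fil 1 ∧ (inner ℂ q X).re = 0 := by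
  constructor
  · intro hX
    refine ⟨?_, ?_⟩
    · have h1 := c.Fil_mono (Nat.zero_le 1) (c.sub_N_mem_of_mem_tangentSet hX)
      have h2 := (c.Fil 1).add_mem h1 (by simpa using c.N_pow_mem (fderiv ℂ c.ξ q X) 1)
      simpa using h2
    · obtain ⟨γ, hγ, hγ0, hγt, hγM⟩ := exists_curve_of_mem_tangentSet hX
      have h1 := hγ.inner ℂ hγ
      have h2 : (fun t => inner ℂ (γ t) (γ t)) =ᶠ[𝓝 (0 : ℝ)] fun _ => (1 : ℂ) := by
        filter_upwards [hγM] with t ht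
        have : ‖γ t‖ = 1 := by simpa using ht.2
        simp [inner_self_eq_norm_sq_to_K, this]
      have h3 := h1.unique ((hasDerivAt_const (0 : ℝ) (1 : ℂ)).congr_of_eventuallyEq h2)
      rw [hγ0, ← inner_conj_symm X q] at h3
      have h4 := congrArg Complex.re h3
      rw [Complex.add_re, Complex.conj_re, Complex.zero_re] at h4
      linarith
  · rintro ⟨hX, hre⟩
    obtain ⟨a, b, rfl⟩ := c.exists_of_mem_Fil_one hX
    exact c.N_add_smul_mem_tangentSet hC hq a b hre

theorem mem_holTangent_q (hC : ∀ v ∈ C, ∀ a : ℂ, a ≠ 0 → a • v ∈ C) (hq : q ∈ link C) {X : E} :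
    X ∈ holTangent (link C) q ↔ X ∈ c.Fil 1 ∧ inner ℂ q X = 0 := by
  constructor
  · rintro ⟨h1, h2⟩
    exact ⟨((c.mem_tangentSet_q hC hq).mp h1).1, h2⟩
  · rintro ⟨h1, h2⟩
    exact ⟨(c.mem_tangentSet_q hC hq).mpr ⟨h1, by rw [h2]; rfl⟩, h2⟩

end ConeChart

end Cone

/-! ### The osculating spaces of the link. -/

section Cone

variable {E : Type*} [NormedAddCommGroup E] [InnerProductSpace ℂ E]

/-- The vector `(v, ⟨v, z̄⟩)` of the hyperplane orthogonal to the lift of `z`. -/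
def tangentLift (z : E) : E →ₗ[ℂ] E × ℂ :=
  LinearMap.prod LinearMap.id (innerSL ℂ z : E →ₗ[ℂ] ℂ)

theorem tangentLift_apply (z v : E) : tangentLift z v = (v, inner ℂ z v) := rfl

theorem osc_mono (M : Set E) (z : E) : Monotone fun l => osc M l z := by
  intro k l hkl
  refine Submodule.span_mono ?_
  rintro v ⟨Xs, h1, h2, h3⟩
  exact ⟨Xs, h1.trans hkl, h2, h3⟩

theorem contDiffOn_delHol {O : Set E} (hO : IsOpen O) {X : E → E} {G : E → E × ℂ}
    (hX : ContDiffOn ℝ ∞ X O) (hG : ContDiffOn ℝ ∞ G O) : ContDiffOn ℝ ∞ (delHol X G) O := by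
  have h1 : ContDiffOn ℝ ∞ (fderiv ℝ G) O := hG.fderiv_of_isOpen hO (by simp)
  have h2 := h1.clm_apply hX
  have h3 := h1.clm_apply (hX.const_smul Complex.I)
  exact (h2.sub (h3.const_smul Complex.I)).const_smul (1 / 2 : ℂ)

theorem contDiff_lift : ContDiff ℝ ∞ (lift : E → E × ℂ) := contDiff_id.prodMk contDiff_const

namespace ConeChart

variable {C : Set E} {q : E} {T : Type*} [NormedAddCommGroup T] [NormedSpace ℂ T]
  {m τ : ℕ} {ν : ℕ → ℕ} (c : ConeChart C q T m τ ν)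

theorem oscAt_mono (z : E) : Monotone fun l => c.oscAt l z := by
  intro k l hkl G hG
  exact ⟨c.Fil_mono hkl hG.1, hG.2⟩

theorem tangentLift_mem_oscAt_q {l : ℕ} {v : E} (hv : v ∈ c.Fil l) :
    tangentLift q v ∈ c.oscAt l q :=
  c.mem_oscAt_q.mpr ⟨hv, rfl⟩

theorem eq_tangentLift {l : ℕ} {z : E} {G : E × ℂ} (hG : G ∈ c.oscAt l z) :
    G = tangentLift z G.1 := Prod.ext rfl hG.2

/-- The osculating spaces are isomorphic to the steps of the filtration. -/
def oscAtEquiv (l : ℕ) (z : E) : c.oscAt l z ≃ₗ[ℂ] c.Fil l where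
  toFun G := ⟨c.U (-c.ξ z) G.1.1, G.2.1⟩
  map_add' G G' := by ext; simp
  map_smul' a G := by ext; simp
  invFun v := ⟨tangentLift z (c.U (c.ξ z) v), by
    refine ⟨?_, rfl⟩
    rw [tangentLift_apply, c.U_neg_apply]
    exact v.2⟩
  left_inv G := by
    refine Subtype.ext ?_
    simp only [c.U_apply_neg]
    exact (c.eq_tangentLift G.2).symm
  right_inv v := by
    refine Subtype.ext ?_
    simp only [tangentLift_apply, c.U_neg_apply]

/-- A vector of the abelian algebra of the chart, as a vector field on the link. -/
def field (a : T) (y : E) : E := c.N a y - inner ℂ y (c.N a y) • y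

theorem contDiff_field (a : T) : ContDiff ℝ ∞ (c.field a) := by
  have h1 : ContDiff ℝ ∞ (c.N a) := (c.N a).contDiff.restrict_scalars ℝ
  exact h1.sub ((contDiff_id.inner ℂ h1).smul contDiff_id)

theorem field_mem_holTangent (hC : ∀ v ∈ C, ∀ a : ℂ, a ≠ 0 → a • v ∈ C) (a : T) {y : E}
    (hy : y ∈ link C) : c.field a y ∈ holTangent (link C) y := by
  have h1 : ‖y‖ = 1 := by simpa using hy.2
  have h2 : inner ℂ y (c.field a y) = 0 := by
    rw [field, inner_sub_right, inner_smul_right, inner_self_eq_norm_sq_to_K, h1]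
    simp
  refine ⟨?_, h2⟩
  have h3 : c.field a y = c.N a y + (-inner ℂ y (c.N a y)) • y := by
    rw [field, neg_smul, sub_eq_add_neg]
  rw [h3] at h2 ⊢
  exact c.N_add_smul_mem_tangentSet hC hy a _ (by rw [h2]; rfl)

theorem κ_field (a : T) : c.κ (c.field a q) = a := by
  rw [field, map_sub, map_smul, c.κ_q, smul_zero, sub_zero, c.κ_N]

theorem isHolField_field (hC : ∀ v ∈ C, ∀ a : ℂ, a ≠ 0 → a • v ∈ C) (a : T) (y : E) :
    IsHolField (link C) y (c.field a) :=
  ⟨Set.univ, isOpen_univ, Set.mem_univ _, (c.contDiff_field a).contDiffOn,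
    fun _ hy => c.field_mem_holTangent hC a hy.1⟩

variable [FiniteDimensional ℂ E]

/-- `X - N (dξ X) q` is a multiple of `q`; apply `κ`, which kills `q` and inverts `a ↦ N a q`. -/
theorem fderiv_ξ_q {X : E} (hX : X ∈ tangentSet (link C) q) : fderiv ℂ c.ξ q X = c.κ X := by
  have h1 := c.sub_N_mem_of_mem_tangentSet hX
  rw [c.Fil_zero] at h1
  obtain ⟨b, hb⟩ := Submodule.mem_span_singleton.mp h1
  have h2 := congrArg c.κ hb
  rw [map_smul, c.κ_q, smul_zero, map_sub, c.κ_N] at h2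
  exact (sub_eq_zero.mp h2.symm).symm

theorem smul_mem_holTangent_q (hC : ∀ v ∈ C, ∀ a : ℂ, a ≠ 0 → a • v ∈ C) (hq : q ∈ link C)
    (c : ConeChart C q T m τ ν) {X : E} (hX : X ∈ holTangent (link C) q) (b : ℂ) :
    b • X ∈ holTangent (link C) q := by
  rw [c.mem_holTangent_q hC hq] at hX ⊢
  exact ⟨(c.Fil 1).smul_mem b hX.1, by rw [inner_smul_right, hX.2, mul_zero]⟩

end ConeChart

section Charts

variable {C : Set E} {T : Type*} [NormedAddCommGroup T] [NormedSpace ℂ T]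
  {m τ : ℕ} {ν : ℕ → ℕ} [FiniteDimensional ℂ E]
  (hC : ∀ v ∈ C, ∀ a : ℂ, a ≠ 0 → a • v ∈ C)
  (hch : ∀ y ∈ link C, Nonempty (ConeChart C y T m τ ν)) {q : E} (c : ConeChart C q T m τ ν)

include hC hch

theorem I_smul_mem_tangentSet {y X : E} (hy : y ∈ link C) (hX : X ∈ holTangent (link C) y) :
    Complex.I • X ∈ tangentSet (link C) y := by
  obtain ⟨d⟩ := hch y hy
  exact (ConeChart.smul_mem_holTangent_q hC hy d hX _).1

/-- The iterated (1,0) derivatives of the lift are sections of the osculating spaces. -/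
theorem exists_contDiffOn_foldr {y : E} (hy0 : c.y0 y ≠ 0) (Xs : List (E → E))
    (hXs : ∀ X ∈ Xs, IsHolField (link C) y X) :
    ∃ O : Set E, IsOpen O ∧ y ∈ O ∧ ContDiffOn ℝ ∞ (Xs.foldr delHol lift) O ∧
      ∀ w ∈ link C ∩ O, Xs.foldr delHol lift w ∈ c.oscAt Xs.length w := by
  induction Xs with
  | nil =>
    exact ⟨_, c.isOpen_domain, hy0, contDiff_lift.contDiffOn, fun w hw =>
      c.lift_mem_oscAt hw.1 hw.2⟩
  | cons X Xs ih =>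
    obtain ⟨O, hO, hyO, hsm, hmem⟩ := ih fun Y hY => hXs Y (by simp [hY])
    obtain ⟨O', hO', hyO', hsm', hmem'⟩ := hXs X (by simp)
    refine ⟨O ∩ O' ∩ {z | c.y0 z ≠ 0}, (hO.inter hO').inter c.isOpen_domain, ⟨⟨hyO, hyO'⟩, hy0⟩,
      ?_, ?_⟩
    · refine contDiffOn_delHol ((hO.inter hO').inter c.isOpen_domain)
        (hsm'.mono fun w hw => hw.1.2) (hsm.mono fun w hw => hw.1.1)
    · rintro w ⟨hwM, ⟨hwO, hwO'⟩, hw0⟩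
      have hXw := hmem' w ⟨hwM, hwO'⟩
      refine c.delAt_mem_oscAt hw0 ((hsm.contDiffAt (hO.mem_nhds hwO)).differentiableAt (by simp))
        ?_ hwM hXw.1 (I_smul_mem_tangentSet hC hch hwM hXw)
      filter_upwards [hO.mem_nhds hwO] with x hx hxM using hmem x ⟨hxM, hx⟩

theorem osc_le_oscAt {y : E} (hy : y ∈ link C) (hy0 : c.y0 y ≠ 0) (l : ℕ) :
    osc (link C) l y ≤ c.oscAt l y := by
  refine Submodule.span_le.mpr ?_
  rintro _ ⟨Xs, hl, hXs, rfl⟩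
  obtain ⟨O, hO, hyO, -, hmem⟩ := exists_contDiffOn_foldr hC hch c hy0 Xs hXs
  exact c.oscAt_mono y hl (hmem y ⟨hy, hyO⟩)

/-- The iterated derivatives of the lift along the field `c.field a` are the powers of `c.N a`, up
to terms of lower order. -/
theorem foldr_field_sub_mem (hq : q ∈ link C) (a : T) (l : ℕ) :
    ((List.replicate (l + 1) (c.field a)).foldr delHol lift q).1 - (c.N a ^ (l + 1)) q
      ∈ c.Fil l := by
  have h0 : c.y0 q ≠ 0 := by rw [c.y0_q]; exact one_ne_zero
  -- Each further derivative along `field a` acts as `N a` modulo `Fil l`, so the error of the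
  -- preceding stage only has to be pushed into `Fil l` by `N a`.
  have step : ∀ l, c.N a (((List.replicate l (c.field a)).foldr delHol lift q).1
        - (c.N a ^ l) q) ∈ c.Fil l →
      ((List.replicate (l + 1) (c.field a)).foldr delHol lift q).1 - (c.N a ^ (l + 1)) q
        ∈ c.Fil l := by
    intro l hl
    obtain ⟨O, hO, hqO, hsm, hmem⟩ := exists_contDiffOn_foldr hC hch c h0
      (List.replicate l (c.field a)) (fun X hX => by
        rw [List.eq_of_mem_replicate hX]; exact c.isHolField_field hC a q)
    have hX := c.field_mem_holTangent hC a hq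
    have h1 := c.delAt_sub_N_mem h0 ((hsm.contDiffAt (hO.mem_nhds hqO)).differentiableAt (by simp))
      (M := link C) (by
        filter_upwards [hO.mem_nhds hqO] with x hx hxM using hmem x ⟨hxM, hx⟩)
      hX.1 (I_smul_mem_tangentSet hC hch hq hX)
    rw [c.fderiv_ξ_q hX.1, c.κ_field, c.ξ_q, neg_zero, c.U_zero, List.length_replicate] at h1
    have h2 := (c.Fil l).add_mem h1 hl
    rw [map_sub] at h2
    rw [pow_succ']
    simpa [List.replicate_succ, delHol_apply] using h2
  induction l with
  | zero =>
    refine step 0 ?_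
    simp [lift]
  | succ l ih =>
    refine step (l + 1) ?_
    exact c.N_mem a l _ ih

/-- `Fil (l + 1)` is generated over `Fil l` by the `(N a)^(l+1) q`, and each of these is, modulo
`Fil l`, an iterated derivative of the lift along the globally defined field `field a`. -/
theorem oscAt_le_osc (hq : q ∈ link C) (l : ℕ) : c.oscAt l q ≤ osc (link C) l q := by
  have h0 : c.y0 q ≠ 0 := by rw [c.y0_q]; exact one_ne_zero
  have key : c.Fil l ≤ (osc (link C) l q).comap (tangentLift q) := by
    induction l with
    | zero =>
      rw [c.Fil_zero, Submodule.span_singleton_le_iff_mem, Submodule.mem_comap]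
      refine Submodule.subset_span ⟨[], by simp, by simp, ?_⟩
      exact ((c.eq_tangentLift (c.lift_mem_oscAt hq h0))).symm
    | succ l ih =>
      refine (c.Fil_succ l).trans (sup_le ?_ (Submodule.span_le.mpr ?_))
      · exact fun v hv => osc_mono _ _ (Nat.le_succ l) (ih hv)
      · rintro _ ⟨a, rfl⟩
        have h1 : (List.replicate (l + 1) (c.field a)).foldr delHol lift q
            ∈ osc (link C) (l + 1) q := by
          refine Submodule.subset_span ⟨_, by simp, fun X hX => ?_, rfl⟩
          rw [List.eq_of_mem_replicate hX]
          exact c.isHolField_field hC a q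
        have h2 := foldr_field_sub_mem hC hch c hq a l
        have h3 := osc_mono (link C) q (Nat.le_succ l) (ih h2)
        have h4 := (osc (link C) (l + 1) q).sub_mem h1 h3
        rw [map_sub, ← c.eq_tangentLift (osc_le_oscAt hC hch c hq h0 _ h1), sub_sub_cancel] at h4
        exact h4
  intro G hG
  rw [c.eq_tangentLift hG]
  exact key (c.mem_oscAt_q.mp hG).1

theorem osc_q (hq : q ∈ link C) (l : ℕ) : osc (link C) l q = c.oscAt l q :=
  le_antisymm (osc_le_oscAt hC hch c hq (by rw [c.y0_q]; exact one_ne_zero) l)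
    (oscAt_le_osc hC hch c hq l)

end Charts

theorem card_subtype_le_fin {m k : ℕ} (hk : k ≤ m) :
    Fintype.card {a : Fin (m + 1) // (a : ℕ) ≤ k} = k + 1 := by
  have h1 : (Finset.univ.filter fun a : Fin (m + 1) => (a : ℕ) ≤ k)
      = Finset.Iic (⟨k, by omega⟩ : Fin (m + 1)) := by
    ext a
    simp [Fin.le_def]
  rw [Fintype.card_subtype, h1, Fin.card_Iic]

theorem ConeChart.finrank_Fil {C : Set E} {q : E} {T : Type*} [NormedAddCommGroup T]
    [NormedSpace ℂ T] {m τ : ℕ} {ν : ℕ → ℕ} (c : ConeChart C q T m τ ν) {l : ℕ} (hl : l ≤ τ)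
    (hν : ν l ≤ m) : finrank ℂ (c.Fil l) = ν l + 1 := by
  have h1 : LinearIndependent ℂ fun a : {a : Fin (m + 1) // (a : ℕ) ≤ ν l} => c.β a :=
    c.β.linearIndependent.comp _ Subtype.val_injective
  rw [c.Fil_eq l hl, Set.image_eq_range, ← card_subtype_le_fin hν]
  exact finrank_span_eq_card h1

section Charts

variable {C : Set E} {T : Type*} [NormedAddCommGroup T] [NormedSpace ℂ T]
  {m τ : ℕ} {ν : ℕ → ℕ} [FiniteDimensional ℂ E]
  (hC : ∀ v ∈ C, ∀ a : ℂ, a ≠ 0 → a • v ∈ C) (hν : ∀ l ≤ τ, ν l ≤ m)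
  (hch : ∀ y ∈ link C, Nonempty (ConeChart C y T m τ ν)) {q : E} (c : ConeChart C q T m τ ν)

include hC hν hch

theorem finrank_osc_eq {y : E} (hy : y ∈ link C) {l : ℕ} (hl : l ≤ τ) :
    finrank ℂ (osc (link C) l y) = ν l + 1 := by
  obtain ⟨d⟩ := hch y hy
  rw [osc_q hC hch d hy, (d.oscAtEquiv l y).finrank_eq, d.finrank_Fil hl (hν l hl)]

/-- Away from the centre of the chart only one inclusion is available directly. The dimensions agree
because `y` is the centre of another chart with the same type numbers. -/
theorem osc_eq_oscAt {y : E} (hy : y ∈ link C) (hy0 : c.y0 y ≠ 0) {l : ℕ} (hl : l ≤ τ) :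
    osc (link C) l y = c.oscAt l y := by
  refine Submodule.eq_of_le_of_finrank_eq (osc_le_oscAt hC hch c hy hy0 l) ?_
  rw [finrank_osc_eq hC hν hch hy hl, (c.oscAtEquiv l y).finrank_eq, c.finrank_Fil hl (hν l hl)]

end Charts

end Cone

/-! ### The link as a CR submanifold of the sphere. -/

section Cone

variable {E : Type*} [NormedAddCommGroup E] [InnerProductSpace ℂ E]

theorem isSubmanifold_of_chart {F : Type*} [NormedAddCommGroup F] [NormedSpace ℝ F]
    [FiniteDimensional ℝ F] {d : ℕ} (hd : finrank ℝ F = d) {M : Set E}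
    (h : ∀ q ∈ M, ∃ (O : Set E) (U : Set F) (φ : F → E) (ψ : E → F),
      IsOpen O ∧ q ∈ O ∧ IsOpen U ∧ ContDiffOn ℝ ∞ φ U ∧ ContDiffOn ℝ ∞ ψ O ∧
      Set.MapsTo φ U (M ∩ O) ∧ Set.MapsTo ψ (M ∩ O) U ∧
      Set.LeftInvOn ψ φ U ∧ Set.LeftInvOn φ ψ (M ∩ O)) : IsSubmanifold d M := by
  intro q hq
  obtain ⟨O, U, φ, ψ, hO, hqO, hU, hφ, hψ, h1, h2, h3, h4⟩ := h q hq
  let L : EuclideanSpace ℝ (Fin d) ≃L[ℝ] F :=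
    ContinuousLinearEquiv.ofFinrankEq (by rw [finrank_euclideanSpace_fin, hd])
  refine ⟨O, L ⁻¹' U, φ ∘ L, L.symm ∘ ψ, hO, hqO, hU.preimage L.continuous,
    hφ.comp L.contDiff.contDiffOn fun _ hx => hx, L.symm.contDiff.comp_contDiffOn hψ,
    fun x hx => h1 hx, fun y hy => ?_, fun x hx => ?_, fun y hy => ?_⟩
  · simpa using h2 hy
  · simp [h3 hx]
  · simp [h4 hy]

namespace ConeChart

variable {C : Set E} {q : E} {T : Type*} [NormedAddCommGroup T] [NormedSpace ℂ T]
  {m τ : ℕ} {ν : ℕ → ℕ} (c : ConeChart C q T m τ ν)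

theorem U_q_ne_zero (a : T) : c.U a q ≠ 0 := by
  intro h
  have h1 := c.y0_U a
  rw [h, map_zero] at h1
  exact zero_ne_one h1

theorem ξ_smul_U {b : ℂ} (hb : b ≠ 0) (a : T) : c.ξ (b • c.U a q) = a := by
  rw [ξ, map_smul c.y0, c.y0_U, smul_eq_mul, mul_one, smul_smul, inv_mul_cancel₀ hb, one_smul, c.κ_U]

/-- The parametrization `(t, a) ↦ e^{it} U a q / ‖U a q‖` of the link. -/
def param (x : ℝ × T) : E := (Complex.exp (x.1 * Complex.I) * (‖c.U x.2 q‖⁻¹ : ℝ)) • c.U x.2 q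

theorem contDiff_param : ContDiff ℝ ∞ c.param := by
  have h1 : ContDiff ℝ ∞ fun x : ℝ × T => c.U x.2 q :=
    ((ContinuousLinearMap.apply ℂ E q).restrictScalars ℝ).contDiff.comp
      ((c.contDiff_U.restrict_scalars ℝ).comp contDiff_snd)
  have h2 : ContDiff ℝ ∞ fun x : ℝ × T => ‖c.U x.2 q‖⁻¹ :=
    (h1.norm ℂ fun x => c.U_q_ne_zero x.2).inv fun x => by simpa using c.U_q_ne_zero x.2
  have h3 : ContDiff ℝ ∞ fun x : ℝ × T => Complex.exp (x.1 * Complex.I) :=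
    ((Complex.ofRealCLM.contDiff.comp contDiff_fst).mul contDiff_const).cexp
  exact (h3.mul (Complex.ofRealCLM.contDiff.comp h2)).smul h1

theorem param_coeff_ne_zero (x : ℝ × T) :
    Complex.exp (x.1 * Complex.I) * (‖c.U x.2 q‖⁻¹ : ℝ) ≠ 0 := by
  simpa using c.U_q_ne_zero x.2

theorem y0_param (x : ℝ × T) :
    c.y0 (c.param x) = (‖c.U x.2 q‖⁻¹ : ℝ) * Complex.exp (x.1 * Complex.I) := by
  rw [param, map_smul, c.y0_U, smul_eq_mul, mul_one, mul_comm]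

theorem arg_y0_param {x : ℝ × T} (hx : x.1 ∈ Set.Ioo (-Real.pi) Real.pi) :
    (c.y0 (c.param x)).arg = x.1 := by
  have h0 : 0 < ‖c.U x.2 q‖⁻¹ := by simpa using c.U_q_ne_zero x.2
  rw [c.y0_param, Complex.arg_real_mul _ h0, Complex.exp_mul_I,
    Complex.arg_cos_add_sin_mul_I ⟨hx.1, hx.2.le⟩]

theorem param_mem_link (hC : ∀ v ∈ C, ∀ a : ℂ, a ≠ 0 → a • v ∈ C) (hq : q ∈ C) (x : ℝ × T) :
    c.param x ∈ link C := by
  refine ⟨hC _ (c.U_mem _ _ hq) _ (c.param_coeff_ne_zero x), ?_⟩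
  simp [param, norm_smul, Complex.norm_exp_ofReal_mul_I, c.U_q_ne_zero]

/-- The hyperplane orthogonal to `q` in the tangent space of the cone at `q`. -/
def contactSpace : Submodule ℂ E := c.Fil 1 ⊓ LinearMap.ker (innerSL ℂ q : E →ₗ[ℂ] ℂ)

/-- The contact space at the centre of the chart is isomorphic to the parameter space. -/
def contactEquiv (hq : q ∈ link C) : c.contactSpace ≃ₗ[ℂ] T :=
  LinearEquiv.ofBijective ((c.κ : E →ₗ[ℂ] T).comp c.contactSpace.subtype) (by
    have hq1 : ‖q‖ = 1 := by simpa using hq.2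
    refine ⟨?_, fun a => ?_⟩
    · rw [← LinearMap.ker_eq_bot, LinearMap.ker_eq_bot']
      rintro ⟨X, hX1, hX2⟩ hX
      obtain ⟨a, b, rfl⟩ := c.exists_of_mem_Fil_one hX1
      have h1 : c.κ (c.N a q + b • q) = 0 := hX
      rw [map_add, map_smul, c.κ_q, smul_zero, add_zero, c.κ_N] at h1
      subst h1
      have h2 : inner ℂ q (c.N 0 q + b • q) = 0 := hX2
      rw [map_zero, zero_apply, zero_add, inner_smul_right,
        inner_self_eq_norm_sq_to_K, hq1] at h2
      have h3 : b = 0 := by simpa using h2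
      ext
      simp [h3]
    · refine ⟨⟨c.field a q, ?_, ?_⟩, ?_⟩
      · refine (c.Fil 1).sub_mem (by simpa using c.N_pow_mem a 1) ((c.Fil 1).smul_mem _ ?_)
        exact c.Fil_mono (Nat.zero_le 1) (by simpa using c.N_pow_mem a 0)
      · change inner ℂ q (c.field a q) = 0
        rw [field, inner_sub_right, inner_smul_right, inner_self_eq_norm_sq_to_K, hq1]
        simp
      · exact c.κ_field a)

end ConeChart

section Charts

variable {C : Set E} {T : Type*} [NormedAddCommGroup T] [NormedSpace ℂ T] [FiniteDimensional ℂ T]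
  {m τ : ℕ} {ν : ℕ → ℕ} [FiniteDimensional ℂ E]
  (hC : ∀ v ∈ C, ∀ a : ℂ, a ≠ 0 → a • v ∈ C)
  (hch : ∀ y ∈ link C, Nonempty (ConeChart C y T m τ ν))

include hC hch

omit [FiniteDimensional ℂ E] in
-- Since `y0 (U a q) = 1`, the phase `t` of `param (t, a)` is the argument of `y0`, and `a` is
-- recovered by `ξ`. The slit plane is the domain on which the argument is smooth.
theorem isSubmanifold_link : IsSubmanifold (2 * finrank ℂ T + 1) (link C) := by
  have : FiniteDimensional ℝ T := FiniteDimensional.complexToReal T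
  refine isSubmanifold_of_chart (F := ℝ × T) ?_ fun q hq => ?_
  · rw [finrank_prod, finrank_real_of_complex, finrank_self, add_comm]
  obtain ⟨c⟩ := hch q hq
  refine ⟨c.y0 ⁻¹' Complex.slitPlane, Set.Ioo (-Real.pi) Real.pi ×ˢ Set.univ, c.param,
    fun y => ((c.y0 y).arg, c.ξ y), Complex.isOpen_slitPlane.preimage c.y0.continuous, ?_,
    isOpen_Ioo.prod isOpen_univ, c.contDiff_param.contDiffOn, ?_, ?_, ?_, ?_, ?_⟩
  · change c.y0 q ∈ Complex.slitPlane
    rw [c.y0_q]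
    exact Complex.one_mem_slitPlane
  · intro y hy
    have h0 : c.y0 y ≠ 0 := Complex.slitPlane_ne_zero hy
    have h1 : ContDiffAt ℝ ∞ (fun y => Complex.log (c.y0 y)) y :=
      (((Complex.contDiffAt_log hy).comp y c.y0.contDiff.contDiffAt)).restrict_scalars ℝ
    have h2 : ContDiffAt ℝ ∞ (fun y => (c.y0 y).arg) y := by
      have := Complex.imCLM.contDiff.contDiffAt.comp y h1
      refine this.congr_of_eventuallyEq (Filter.Eventually.of_forall fun z => ?_)
      simp [Complex.log_im]
    exact (h2.prodMk ((c.contDiffAt_ξ h0).restrict_scalars ℝ)).contDiffWithinAt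
  · rintro x ⟨hx, -⟩
    refine ⟨c.param_mem_link hC hq.1 x, ?_⟩
    change c.y0 (c.param x) ∈ Complex.slitPlane
    rw [Complex.mem_slitPlane_iff_arg, c.arg_y0_param hx]
    refine ⟨hx.2.ne, ?_⟩
    rw [c.y0_param, mul_comm]
    exact c.param_coeff_ne_zero x
  · rintro y ⟨-, hy⟩
    have := Complex.mem_slitPlane_iff_arg.mp hy
    exact ⟨⟨Complex.neg_pi_lt_arg _, lt_of_le_of_ne (Complex.arg_le_pi _) this.1⟩, trivial⟩
  · rintro x ⟨hx, -⟩
    refine Prod.ext (c.arg_y0_param hx) ?_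
    exact c.ξ_smul_U (c.param_coeff_ne_zero x) x.2
  · rintro y ⟨hyM, hy⟩
    have h0 : c.y0 y ≠ 0 := Complex.slitPlane_ne_zero hy
    have h1 := c.graph y hyM.1 h0
    change y = c.y0 y • c.U (c.ξ y) q at h1
    have h2 : ‖y‖ = 1 := by simpa using hyM.2
    have h3 : ‖c.y0 y‖ * ‖c.U (c.ξ y) q‖ = 1 := by
      rw [← norm_smul, ← h1, h2]
    change (Complex.exp ((c.y0 y).arg * Complex.I) * (‖c.U (c.ξ y) q‖⁻¹ : ℝ)) • c.U (c.ξ y) q = y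
    have h4 : ‖c.U (c.ξ y) q‖⁻¹ = ‖c.y0 y‖ := by
      exact (eq_inv_of_mul_eq_one_left h3).symm
    rw [h4, mul_comm, Complex.norm_mul_exp_arg_mul_I, ← h1]

theorem isCRSubmanifold_link : IsCRSubmanifold (finrank ℂ T) (link C) where
  subset_sphere := Set.inter_subset_right
  submanifold := isSubmanifold_link hC hch
  complex q hq := by
    obtain ⟨c⟩ := hch q hq
    refine ⟨c.contactSpace, (c.contactEquiv hq).finrank_eq, ?_⟩
    ext X
    exact (c.mem_holTangent_q hC hq).symm

end Charts

end Cone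

/-! ### Adapted frames -/

section Frames

variable {E : Type*} [NormedAddCommGroup E] [InnerProductSpace ℂ E]

theorem contDiffOn_gramSchmidt {k : ℕ} {O : Set E} {f : E → Fin k → E}
    (hf : ∀ a, ContDiffOn ℝ ∞ (fun z => f z a) O) (hli : ∀ z ∈ O, LinearIndependent ℂ (f z))
    (a : Fin k) : ContDiffOn ℝ ∞ (fun z => InnerProductSpace.gramSchmidt ℂ (f z) a) O := by
  induction a using WellFoundedLT.induction with
  | ind a ih =>
    -- The projections are written with inner products only, so that smoothness follows by strong
    -- induction on the index; the denominators do not vanish, by independence.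
    have h1 : ∀ z, InnerProductSpace.gramSchmidt ℂ (f z) a = f z a - ∑ i ∈ Finset.Iio a,
        (inner ℂ (InnerProductSpace.gramSchmidt ℂ (f z) i) (f z a) *
          (inner ℂ (InnerProductSpace.gramSchmidt ℂ (f z) i)
            (InnerProductSpace.gramSchmidt ℂ (f z) i))⁻¹) •
          InnerProductSpace.gramSchmidt ℂ (f z) i := by
      intro z
      rw [InnerProductSpace.gramSchmidt_def]
      simp only [Submodule.starProjection_singleton, inner_self_eq_norm_sq_to_K, div_eq_mul_inv]
      simp
    simp only [h1]
    refine (hf a).sub (ContDiffOn.sum fun i hi => ?_)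
    have h2 := ih i (Finset.mem_Iio.mp hi)
    refine ((h2.inner ℂ (hf a)).mul ((h2.inner ℂ h2).inv fun z hz => ?_)).smul h2
    exact inner_self_ne_zero.mpr (InnerProductSpace.gramSchmidt_ne_zero i (hli z hz))

theorem contDiffOn_gramSchmidtNormed {k : ℕ} {O : Set E} {f : E → Fin k → E}
    (hf : ∀ a, ContDiffOn ℝ ∞ (fun z => f z a) O) (hli : ∀ z ∈ O, LinearIndependent ℂ (f z))
    (a : Fin k) : ContDiffOn ℝ ∞ (fun z => InnerProductSpace.gramSchmidtNormed ℂ (f z) a) O := by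
  have h1 := contDiffOn_gramSchmidt hf hli a
  have h2 : ∀ z ∈ O, InnerProductSpace.gramSchmidt ℂ (f z) a ≠ 0 := fun z hz =>
    InnerProductSpace.gramSchmidt_ne_zero a (hli z hz)
  have h3 : ContDiffOn ℝ ∞ (fun z => ‖InnerProductSpace.gramSchmidt ℂ (f z) a‖) O := h1.norm ℂ h2
  exact ((Complex.ofRealCLM.contDiff.comp_contDiffOn h3).inv fun z hz => by
    simpa using h2 z hz).smul h1

theorem herm_sum_left {κ : Type*} (s : Finset κ) (g : κ → ℂ) (v : κ → E × ℂ) (w : E × ℂ) :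
    herm (∑ a ∈ s, g a • v a) w = ∑ a ∈ s, g a * herm (v a) w := by
  simp only [herm, Prod.fst_sum, Prod.snd_sum, inner_sum, Finset.sum_mul, Prod.smul_fst,
    Prod.smul_snd, inner_smul_right, smul_eq_mul, ← Finset.sum_sub_distrib]
  exact Finset.sum_congr rfl fun a _ => by ring

theorem herm_conj (v w : E × ℂ) : conj (herm v w) = herm w v := by
  simp [herm, mul_comm]

theorem herm_smul_left (a : ℂ) (v w : E × ℂ) : herm (a • v) w = a * herm v w := by
  simp only [herm, Prod.smul_fst, Prod.smul_snd, inner_smul_right, smul_eq_mul]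
  ring

theorem herm_smul_right (a : ℂ) (v w : E × ℂ) : herm v (a • w) = conj a * herm v w := by
  rw [← herm_conj, herm_smul_left, map_mul, herm_conj]

/-- The index that is paired with a given index by the form `gram`. -/
def gramDual (m : ℕ) (a : Fin (m + 2)) : Fin (m + 2) :=
  if a = 0 then Fin.last (m + 1) else if a = Fin.last (m + 1) then 0 else a

theorem gram_eq_zero {m : ℕ} {a b : Fin (m + 2)} (h : a ≠ gramDual m b) : gram m a b = 0 := by
  have h01 : Fin.last (m + 1) ≠ 0 := Fin.last_pos.ne'
  unfold gram gramDual at *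
  split_ifs at * <;> simp_all

theorem gram_gramDual_ne_zero {m : ℕ} (b : Fin (m + 2)) : gram m (gramDual m b) b ≠ 0 := by
  have h01 : Fin.last (m + 1) ≠ 0 := Fin.last_pos.ne'
  unfold gram gramDual at *
  split_ifs at * <;> simp_all

theorem gramDual_gramDual {m : ℕ} (b : Fin (m + 2)) : gramDual m (gramDual m b) = b := by
  have h01 : Fin.last (m + 1) ≠ 0 := Fin.last_pos.ne'
  unfold gramDual at *
  split_ifs at * <;> simp_all

/-- The matrix is monomial: its only nonzero entry in each column is in the row given by the
involution `gramDual`. -/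
theorem det_gram_ne_zero (m : ℕ) : (Matrix.of (gram m)).det ≠ 0 := by
  refine (Matrix.linearIndependent_rows_iff_isUnit.mp ?_ |> (Matrix.isUnit_iff_isUnit_det _).mp).ne_zero
  refine Fintype.linearIndependent_iff.mpr fun g hg a => ?_
  have h1 := congrFun hg (gramDual m a)
  simp only [Finset.sum_apply, Pi.smul_apply, smul_eq_mul, Matrix.row, Matrix.of_apply,
    Pi.zero_apply] at h1
  rw [Finset.sum_eq_single a] at h1
  · have h2 := gram_gramDual_ne_zero (gramDual m a)
    rw [gramDual_gramDual] at h2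
    exact (mul_eq_zero.mp h1).resolve_right h2
  · intro b _ hb
    rw [gram_eq_zero (by rwa [gramDual_gramDual]), mul_zero]
  · simp

/-- Both families have Gram matrix `gram`, so the matrix `A` of `v` in the basis `e` satisfies `Aᵗ ·
gram · Ā = gram`; take determinants. -/
theorem det_mul_conj_eq_one {m : ℕ} {e : Basis (Fin (m + 2)) ℂ (E × ℂ)} (he : IsUnitaryFrame e)
    {v : Fin (m + 2) → E × ℂ} (hv : ∀ a b, herm (v a) (v b) = gram m a b) :
    e.det v * conj (e.det v) = 1 := by
  set A := e.toMatrix v with hA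
  have h1 : A.transpose * Matrix.of (gram m) * A.map (starRingEnd ℂ) = Matrix.of (gram m) := by
    ext a b
    have h2 : ∀ a, v a = ∑ c, A c a • e c := fun a => by
      simp only [hA, Basis.toMatrix_apply]
      exact (e.sum_repr (v a)).symm
    have h3 : herm (v a) (v b) = ∑ d, (∑ c, A c a * gram m c d) * conj (A d b) := by
      rw [h2 b, ← herm_conj, herm_sum_left, map_sum]
      refine Finset.sum_congr rfl fun d _ => ?_
      rw [map_mul, herm_conj, h2 a, herm_sum_left, mul_comm]
      simp only [he _ _]
    rw [hv] at h3
    simp only [Matrix.mul_apply, Matrix.transpose_apply, Matrix.of_apply, Matrix.map_apply]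
    exact h3.symm
  have h2 := congrArg Matrix.det h1
  rw [Matrix.det_mul, Matrix.det_mul, Matrix.det_transpose,
    ← RingHom.mapMatrix_apply, ← RingHom.map_det] at h2
  rw [Basis.det_apply]
  refine mul_right_cancel₀ (det_gram_ne_zero m) ?_
  linear_combination h2

theorem contDiffOn_det {k : ℕ} {F : Type*} [NormedAddCommGroup F] [NormedSpace ℂ F]
    [FiniteDimensional ℂ F] (e : Basis (Fin k) ℂ F) {O : Set E} {v : E → Fin k → F}
    (hv : ∀ a, ContDiffOn ℝ ∞ (fun z => v z a) O) : ContDiffOn ℝ ∞ (fun z => e.det (v z)) O := by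
  simp only [Basis.det_apply, Matrix.det_apply]
  refine ContDiffOn.sum fun σ _ => ContDiffOn.const_smul _ (contDiffOn_prod fun i _ => ?_)
  have h1 : ContDiff ℝ ∞ (e.coord (σ i)) :=
    (LinearMap.toContinuousLinearMap (e.coord (σ i))).contDiff.restrict_scalars ℝ
  exact h1.comp_contDiffOn (hv i)

/-- The frame of `E × ℂ` given by an orthonormal basis of `E`. -/
def nullFrame {m : ℕ} (w : Fin (m + 1) → E) : Fin (m + 2) → E × ℂ :=
  Fin.snoc (α := fun _ => E × ℂ) (fun a => (w a, if a = 0 then 1 else 0))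
    ((-(Complex.I / 2)) • (w 0, (-1 : ℂ)))

theorem nullFrame_castSucc {m : ℕ} (w : Fin (m + 1) → E) (a : Fin (m + 1)) :
    nullFrame w a.castSucc = (w a, if a = 0 then 1 else 0) := by
  simp [nullFrame]

theorem nullFrame_last {m : ℕ} (w : Fin (m + 1) → E) :
    nullFrame w (Fin.last (m + 1)) = (-(Complex.I / 2)) • (w 0, (-1 : ℂ)) := by
  simp [nullFrame]

/-- `(w₀, 1)` and `(w₀, -1)` are null vectors with product `2`; the conjugate of the factor `-i/2`
of the last vector turns this into the required `i`. -/
theorem herm_nullFrame {m : ℕ} {w : Fin (m + 1) → E} (hw : Orthonormal ℂ w) (a b : Fin (m + 2)) :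
    herm (nullFrame w a) (nullFrame w b) = gram m a b := by
  classical
  have hw' : ∀ a b, inner ℂ (w a) (w b) = if a = b then (1 : ℂ) else 0 :=
    orthonormal_iff_ite.mp hw
  have hn : ‖w 0‖ = 1 := hw.1 0
  have h01 : Fin.last (m + 1) ≠ 0 := Fin.last_pos.ne'
  have hc : ∀ a : Fin (m + 1), a.castSucc = 0 ↔ a = 0 := fun a => Fin.castSucc_eq_zero_iff
  have hl : ∀ a : Fin (m + 1), a.castSucc ≠ Fin.last (m + 1) := fun a => (Fin.castSucc_lt_last a).ne
  induction a using Fin.lastCases with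
  | last =>
    induction b using Fin.lastCases with
    | last =>
      rw [nullFrame_last, herm_smul_left, herm_smul_right]
      simp [herm, hn, gram, h01]
    | cast b =>
      rw [nullFrame_last, nullFrame_castSucc, herm_smul_left]
      by_cases hb : b = 0
      · subst hb
        simp [herm, hn, gram, h01]
        ring
      · simp [herm, hw', gram, h01, hb]
  | cast a =>
    induction b using Fin.lastCases with
    | last =>
      rw [nullFrame_last, nullFrame_castSucc, herm_smul_right]
      by_cases ha : a = 0
      · subst ha
        simp [herm, hn, gram, map_ofNat]
        ring
      · simp [herm, hw', gram, ha, Ne.symm ha, hl]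
    | cast b =>
      rw [nullFrame_castSucc, nullFrame_castSucc]
      by_cases ha : a = 0
      · by_cases hb : b = 0
        · simp [herm, hn, gram, ha, hb, h01.symm]
        · simp [herm, hw', gram, ha, hb, hl]
      · by_cases hb : b = 0
        · subst hb
          simp [herm, hw', gram, ha, hl, Ne.symm ha]
        · simp only [herm, hw', gram, hc, ha, hl, if_false, Fin.castSucc_inj]
          by_cases hab : a = b
          · simp [hab]
          · simp [hab, Ne.symm hab]

end Frames

section Frames

variable {E : Type*} [NormedAddCommGroup E] [InnerProductSpace ℂ E]

namespace ConeChart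

variable {C : Set E} {q : E} {T : Type*} [NormedAddCommGroup T] [NormedSpace ℂ T]
  {m τ : ℕ} {ν : ℕ → ℕ} (c : ConeChart C q T m τ ν)

/-- A field of bases of `E` that is adapted to the osculating spaces. -/
def preframe (z : E) (a : Fin (m + 1)) : E := if a = 0 then z else c.U (c.ξ z) (c.β a)

theorem contDiffOn_preframe (a : Fin (m + 1)) :
    ContDiffOn ℝ ∞ (fun z => c.preframe z a) {z | c.y0 z ≠ 0} := by
  intro z hz
  unfold preframe
  split_ifs
  · exact contDiffWithinAt_id
  · exact (((ContinuousLinearMap.apply ℂ E (c.β a)).restrictScalars ℝ).contDiff.contDiffAt.comp z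
      (c.contDiffAt_U_ξ hz)).contDiffWithinAt

theorem linearIndependent_preframe_q (hν0 : ν 0 = 0) : LinearIndependent ℂ (c.preframe q) := by
  have h1 : q ∈ Submodule.span ℂ {c.β 0} := by
    have h2 : q ∈ c.Fil 0 := by rw [c.Fil_zero]; exact Submodule.mem_span_singleton_self q
    rw [c.Fil_eq 0 (Nat.zero_le _), hν0] at h2
    have h3 : {a : Fin (m + 1) | (a : ℕ) ≤ 0} = {0} := by
      ext a
      rw [Set.mem_ofPred_eq, Set.mem_singleton_iff, Fin.ext_iff]
      exact Nat.le_zero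
    rwa [h3, Set.image_singleton] at h2
  obtain ⟨t, ht⟩ := Submodule.mem_span_singleton.mp h1
  have ht0 : t ≠ 0 := by
    rintro rfl
    exact c.q_ne_zero (by rw [← ht, zero_smul])
  have h4 := c.β.linearIndependent.units_smul
    (fun a : Fin (m + 1) => if a = 0 then Units.mk0 t ht0 else 1)
  convert h4 using 1
  funext a
  by_cases ha : a = 0
  · subst ha
    simpa [preframe, Units.smul_def] using ht.symm
  · simp [preframe, ha, c.ξ_q, c.U_zero]

theorem U_neg_preframe_mem {z : E} (hz : z ∈ C) (h0 : c.y0 z ≠ 0) {l : ℕ} (hl : l ≤ τ)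
    {a : Fin (m + 1)} (ha : (a : ℕ) ≤ ν l) : c.U (-c.ξ z) (c.preframe z a) ∈ c.Fil l := by
  unfold preframe
  split_ifs
  · rw [c.U_neg_ξ_apply_self hz h0]
    refine c.Fil_mono (Nat.zero_le l) ?_
    rw [c.Fil_zero]
    exact Submodule.smul_mem _ _ (Submodule.mem_span_singleton_self q)
  · rw [c.U_neg_apply, c.Fil_eq l hl]
    exact Submodule.subset_span ⟨a, ha, rfl⟩

/-- The orthonormal frame obtained from `preframe`. -/
def orthoframe (z : E) (a : Fin (m + 1)) : E :=
  InnerProductSpace.gramSchmidtNormed ℂ (c.preframe z) a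

theorem orthoframe_zero {z : E} (hz : ‖z‖ = 1) : c.orthoframe z 0 = z := by
  have h1 : InnerProductSpace.gramSchmidt ℂ (c.preframe z) 0 = z :=
    InnerProductSpace.gramSchmidt_bot ℂ (c.preframe z)
  rw [orthoframe, InnerProductSpace.gramSchmidtNormed, h1, hz]
  simp

theorem U_neg_orthoframe_mem {z : E} (hz : z ∈ C) (h0 : c.y0 z ≠ 0) {l : ℕ} (hl : l ≤ τ)
    {a : Fin (m + 1)} (ha : (a : ℕ) ≤ ν l) : c.U (-c.ξ z) (c.orthoframe z a) ∈ c.Fil l := by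
  have h1 : c.orthoframe z a ∈ Submodule.span ℂ (c.preframe z '' Set.Iic a) := by
    rw [← InnerProductSpace.span_gramSchmidt_Iic, ← InnerProductSpace.span_gramSchmidtNormed]
    exact Submodule.subset_span ⟨a, Set.mem_Iic.mpr le_rfl, rfl⟩
  have h2 : Submodule.span ℂ (c.preframe z '' Set.Iic a)
      ≤ (c.Fil l).comap (c.U (-c.ξ z) : E →ₗ[ℂ] E) := by
    refine Submodule.span_le.mpr ?_
    rintro _ ⟨b, hb, rfl⟩
    exact c.U_neg_preframe_mem hz h0 hl ((Fin.le_def.mp hb).trans ha)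
  exact h2 h1

/-- As `z` itself is the first vector of `preframe`, the Gram-Schmidt frame starts with `z`. Hence
`⟨z, w_a⟩ = δ_{0a}`, which is exactly the last component of the null frame. -/
theorem nullFrame_orthoframe_mem {z : E} (hz : z ∈ link C) (h0 : c.y0 z ≠ 0)
    (hli : LinearIndependent ℂ (c.preframe z)) {l : ℕ} (hl : l ≤ τ) (hν : ν l ≤ m)
    {a : Fin (m + 2)} (ha : (a : ℕ) ≤ ν l) :
    nullFrame (c.orthoframe z) a ∈ c.oscAt l z := by
  have hz1 : ‖z‖ = 1 := by simpa using hz.2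
  induction a using Fin.lastCases with
  | last => simp at ha; omega
  | cast a =>
    rw [nullFrame_castSucc]
    refine ⟨c.U_neg_orthoframe_mem hz.1 h0 hl (by simpa using ha), ?_⟩
    have h1 := orthonormal_iff_ite.mp (InnerProductSpace.gramSchmidtNormed_orthonormal hli) 0 a
    change inner ℂ (c.orthoframe z 0) (c.orthoframe z a) = _ at h1
    rw [c.orthoframe_zero hz1] at h1
    simp only [h1, eq_comm]

end ConeChart

/-- For `m ≥ 1` the index `1` is paired only with itself, so `Z₁` may be multiplied by a phase. This
is the freedom that makes a frame unimodular. -/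
theorem gram_update {m : ℕ} (hm : 1 ≤ m) {v : Fin (m + 2) → E × ℂ}
    (hv : ∀ a b, herm (v a) (v b) = gram m a b) {t : ℂ} (ht : t * conj t = 1) (a b : Fin (m + 2)) :
    herm (Function.update v 1 (t • v 1) a) (Function.update v 1 (t • v 1) b) = gram m a b := by
  have h1 : (1 : Fin (m + 2)) ≠ Fin.last (m + 1) := by
    intro h
    have := congrArg Fin.val h
    simp at this
    omega
  have h2 : gramDual m 1 = 1 := by simp [gramDual, h1]
  have h3 : ∀ b, b ≠ 1 → gram m b 1 = 0 := fun b hb => gram_eq_zero (by rwa [h2])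
  have h4 : ∀ b, b ≠ 1 → gram m 1 b = 0 := fun b hb => gram_eq_zero fun h => hb (by
    rw [← gramDual_gramDual b, ← h, h2])
  by_cases ha : a = 1
  · subst ha
    by_cases hb : b = 1
    · subst hb
      rw [Function.update_self, herm_smul_left, herm_smul_right, hv]
      linear_combination gram m 1 1 * ht
    · rw [Function.update_self, Function.update_of_ne hb, herm_smul_left, hv, h4 b hb, mul_zero]
  · by_cases hb : b = 1
    · subst hb
      rw [Function.update_self, Function.update_of_ne ha, herm_smul_right, hv, h3 a ha, mul_zero]
    · rw [Function.update_of_ne ha, Function.update_of_ne hb, hv]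

variable {C : Set E} {T : Type*} [NormedAddCommGroup T] [NormedSpace ℂ T]
  {m τ : ℕ} {ν : ℕ → ℕ} [FiniteDimensional ℂ E]

theorem exists_isAdaptedFrame (hm : 1 ≤ m) (hC : ∀ v ∈ C, ∀ a : ℂ, a ≠ 0 → a • v ∈ C)
    (hν0 : ν 0 = 0) (hν : ∀ l ≤ τ, ν l ≤ m)
    (hch : ∀ y ∈ link C, Nonempty (ConeChart C y T m τ ν))
    {e : Basis (Fin (m + 2)) ℂ (E × ℂ)} (he : IsUnitaryFrame e) {q : E} (hq : q ∈ link C) :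
    ∃ O Z, q ∈ O ∧ IsAdaptedFrame (link C) τ ν e O Z := by
  classical
  obtain ⟨c⟩ := hch q hq
  -- Independence of `preframe` is known at `q` only; it is an open condition.
  set O : Set E := {z | c.y0 z ≠ 0} ∩ c.preframe ⁻¹' {f | LinearIndependent ℂ f} with hO
  have hOo : IsOpen O := by
    refine ContinuousOn.isOpen_inter_preimage (f := c.preframe)
      (continuousOn_pi.mpr fun a => (c.contDiffOn_preframe a).continuousOn) c.isOpen_domain ?_
    exact isOpen_setOfPred_linearIndependent
  have hqO : q ∈ O := ⟨by simp [c.y0_q], c.linearIndependent_preframe_q hν0⟩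
  set v : E → Fin (m + 2) → E × ℂ := fun z => nullFrame (c.orthoframe z) with hvdef
  have hgram : ∀ z ∈ O, ∀ a b, herm (v z a) (v z b) = gram m a b := fun z hz =>
    herm_nullFrame (InnerProductSpace.gramSchmidtNormed_orthonormal hz.2)
  have hsm : ∀ a, ContDiffOn ℝ ∞ (fun z => v z a) O := by
    have h1 : ∀ a, ContDiffOn ℝ ∞ (fun z => c.orthoframe z a) O := fun a =>
      contDiffOn_gramSchmidtNormed (fun a => (c.contDiffOn_preframe a).mono Set.inter_subset_left)
        (fun z hz => hz.2) a
    intro a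
    induction a using Fin.lastCases with
    | last =>
      simp only [hvdef, nullFrame_last]
      exact ((h1 0).prodMk contDiffOn_const).const_smul _
    | cast a =>
      simp only [hvdef, nullFrame_castSucc]
      exact (h1 a).prodMk contDiffOn_const
  set d : E → ℂ := fun z => e.det (v z) with hd
  have hdd : ∀ z ∈ O, d z * conj (d z) = 1 := fun z hz => det_mul_conj_eq_one he (hgram z hz)
  have hd0 : ∀ z ∈ O, d z ≠ 0 := fun z hz h => by simpa [h] using hdd z hz
  -- The determinant has modulus one, so dividing `Z₁` by it keeps the Gram matrix, and it changes
  -- none of the spans of initial segments.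
  set Z' : E → Fin (m + 2) → E × ℂ := fun z => Function.update (v z) 1 ((d z)⁻¹ • v z 1) with hZ'
  have hdet : ∀ z ∈ O, e.det (Z' z) = 1 := by
    intro z hz
    rw [hZ', AlternatingMap.map_update_smul, Function.update_eq_self]
    exact inv_mul_cancel₀ (hd0 z hz)
  have hbasis : ∀ z ∈ O, LinearIndependent ℂ (Z' z) ∧ Submodule.span ℂ (Set.range (Z' z)) = ⊤ :=
    fun z hz => (Module.Basis.is_basis_iff_det e).mpr (by rw [hdet z hz]; exact isUnit_one)
  set Z : E → Basis (Fin (m + 2)) ℂ (E × ℂ) := fun z =>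
    if hz : z ∈ O then Basis.mk (hbasis z hz).1 (hbasis z hz).2.ge else e with hZ
  have hZZ : ∀ z ∈ O, ∀ a, Z z a = Z' z a := by
    intro z hz a
    simp [hZ, hz]
  have hZZ' : ∀ z ∈ O, ⇑(Z z) = Z' z := fun z hz => funext (hZZ z hz)
  refine ⟨O, Z, hqO, hOo, fun a => ?_, ?_, ?_, ?_⟩
  · have h1 : ContDiffOn ℝ ∞ (fun z => Z' z a) O := by
      by_cases ha : a = 1
      · subst ha
        simp only [hZ', Function.update_self]
        exact ((contDiffOn_det e hsm).inv hd0).smul (hsm 1)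
      · simp only [hZ', Function.update_of_ne ha]
        exact hsm a
    exact h1.congr fun z hz => hZZ z hz a
  · rintro z ⟨-, hz⟩ a b
    rw [hZZ z hz, hZZ z hz]
    refine gram_update hm (hgram z hz) ?_ a b
    rw [map_inv₀, ← mul_inv, hdd z hz, inv_one]
  · rintro z ⟨-, hz⟩
    rw [hZZ' z hz, hdet z hz]
  · rintro z ⟨hzM, hz⟩ l hl
    have h1 : Submodule.span ℂ (Z z '' {a | (a : ℕ) ≤ ν l}) ≤ osc (link C) l z := by
      rw [osc_eq_oscAt hC hν hch c hzM hz.1 hl, Submodule.span_le]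
      rintro _ ⟨a, ha, rfl⟩
      have h2 := c.nullFrame_orthoframe_mem hzM hz.1 hz.2 hl (hν l hl) ha
      rw [hZZ z hz]
      by_cases ha1 : a = 1
      · subst ha1
        simp only [hZ', Function.update_self]
        exact Submodule.smul_mem _ _ h2
      · simp only [hZ', Function.update_of_ne ha1]
        exact h2
    refine (Submodule.eq_of_le_of_finrank_eq h1 ?_).symm
    rw [finrank_osc_eq hC hν hch hzM hl]
    have h3 : LinearIndependent ℂ fun a : {a : Fin (m + 2) // (a : ℕ) ≤ ν l} => Z z a :=
      (Z z).linearIndependent.comp _ Subtype.val_injective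
    rw [Set.image_eq_range, ← card_subtype_le_fin (m := m + 1) ((hν l hl).trans (Nat.le_succ m))]
    exact finrank_span_eq_card h3

end Frames

/-! ### Fundamental forms -/

section Nilpotent

variable {R : Type*} [Ring R] [Algebra ℂ R]

/-- The binomial expansion stops after the linear term in `A`. -/
theorem add_pow_of_sq_zero {S A : R} (h : Commute S A) (hA : A * A = 0) (k : ℕ) :
    (S + A) ^ (k + 1) = S ^ (k + 1) + ((k + 1 : ℕ) : ℂ) • (S ^ k * A) := by
  induction k with
  | zero => simp
  | succ k ih =>
    have h1 : A * S ^ k = S ^ k * A := (h.symm.pow_right k).eq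
    have h2 : S ^ k * A * A = 0 := by rw [mul_assoc, hA, mul_zero]
    have h3 : S ^ k * A * S = S ^ (k + 1) * A := by rw [mul_assoc, ← h.eq, ← mul_assoc, pow_succ]
    rw [pow_succ, ih, mul_add, add_mul, add_mul, smul_mul_assoc, smul_mul_assoc, h2, smul_zero,
      add_zero, h3, ← pow_succ]
    push_cast
    module

/-- A monomial of degree larger than the number of its commuting factors repeats one of them, and
squares vanish. -/
theorem list_sum_pow_eq_zero {L : List R} (hsq : ∀ A ∈ L, A * A = 0)
    (hcomm : ∀ A ∈ L, ∀ B ∈ L, Commute A B) {k : ℕ} (hk : L.length < k) : L.sum ^ k = 0 := by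
  induction L generalizing k with
  | nil => rw [List.sum_nil, zero_pow (by simp at hk; omega)]
  | cons A L ih =>
    obtain ⟨k, rfl⟩ : ∃ j, k = j + 1 := ⟨k - 1, by omega⟩
    have ih' : ∀ {j}, L.length < j → L.sum ^ j = 0 := ih (fun B hB => hsq B (by simp [hB]))
      (fun B hB B' hB' => hcomm B (by simp [hB]) B' (by simp [hB']))
    have hc : Commute L.sum A := by
      refine (Commute.list_sum_right _ _ fun B hB => ?_).symm
      exact hcomm A (by simp) B (by simp [hB])
    simp only [List.length_cons] at hk
    rw [List.sum_cons, add_comm, add_pow_of_sq_zero hc (hsq A (by simp)), ih' (by omega),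
      ih' (by omega), zero_mul, smul_zero, add_zero]

theorem add_smul_pow_of_sq_zero {S A : R} (h : Commute S A) (hA : A * A = 0) (k : ℕ) (u : ℂ) :
    (S + u • A) ^ (k + 1) = S ^ (k + 1) + u • (((k + 1 : ℕ) : ℂ) • (S ^ k * A)) := by
  rw [add_pow_of_sq_zero (h.smul_right u) (by rw [smul_mul_smul_comm, hA, smul_zero]),
    mul_smul_comm, smul_comm]

end Nilpotent

section FundamentalForms

variable {E : Type*} [NormedAddCommGroup E] [InnerProductSpace ℂ E]

theorem isHomogeneous_fundForm {m : ℕ} (ν : ℕ → ℕ)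
    (h : Fin (m + 2) → Fin (m + 2) → Level m ν 0 → ℂ) (l : ℕ) (b : Level m ν l) :
    (fundForm ν h l b).IsHomogeneous (l + 1) := by
  induction l with
  | zero => exact MvPolynomial.isHomogeneous_X _ _
  | succ l ih =>
    rw [fundForm]
    refine MvPolynomial.IsHomogeneous.sum _ _ _ fun a _ => ?_
    have h1 : (∑ j : Level m ν 0, MvPolynomial.C (h b a j) * MvPolynomial.X j).IsHomogeneous 1 :=
      MvPolynomial.IsHomogeneous.sum _ _ _ fun j _ => by
        simpa using
          (MvPolynomial.isHomogeneous_C _ (h b a j)).mul (MvPolynomial.isHomogeneous_X _ j)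
    have h2 := h1.mul (ih a)
    rwa [add_comm 1 (l + 1)] at h2

theorem map_complex_smul {F : Type*} [NormedAddCommGroup F] [NormedSpace ℂ F] (f : E →L[ℝ] F)
    (a : ℂ) (X : E) : f (a • X) = (a.re : ℂ) • f X + (a.im : ℂ) • f (Complex.I • X) := by
  have h1 : a • X = a.re • X + a.im • (Complex.I • X) := by
    conv_lhs => rw [← Complex.re_add_im a]
    rw [add_smul, mul_smul, Complex.coe_smul, Complex.coe_smul]
  rw [h1, map_add, map_smul, map_smul, Complex.coe_smul, Complex.coe_smul]

theorem map_I_smul_I_smul {F : Type*} [NormedAddCommGroup F] [NormedSpace ℂ F] (f : E →L[ℝ] F)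
    (X : E) : f (Complex.I • Complex.I • X) = -f X := by
  rw [smul_smul, Complex.I_mul_I, neg_one_smul, map_neg]

/-- The derivative along (1,0) vectors, as a linear map. -/
def delAtₗ {F : Type*} [NormedAddCommGroup F] [NormedSpace ℂ F] (G : E → F) (z : E) :
    E →ₗ[ℂ] F where
  toFun := delAt G z
  map_add' X Y := by
    simp only [delAt, map_add, smul_add]
    module
  map_smul' a X := by
    simp only [delAt, RingHom.id_apply]
    rw [smul_comm Complex.I, map_complex_smul _ a X, map_complex_smul _ a (Complex.I • X),
      map_I_smul_I_smul]
    conv_rhs => rw [← Complex.re_add_im a]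
    match_scalars
    · ring
    · linear_combination ((1 / 2 : ℂ) * a.im) * Complex.I_mul_I

/-- The conjugate of the antilinear part of a real linear functional. -/
def antilinearPart (f : E →L[ℝ] ℂ) : E →ₗ[ℂ] ℂ where
  toFun X := conj ((1 / 2 : ℂ) * (f X + Complex.I * f (Complex.I • X)))
  map_add' X Y := by
    simp only [map_add, smul_add, map_mul]
    ring
  map_smul' a X := by
    rw [smul_comm Complex.I, map_complex_smul _ a X, map_complex_smul _ a (Complex.I • X),
      map_I_smul_I_smul, RingHom.id_apply, smul_eq_mul]
    conv_rhs => rw [← Complex.re_add_im a]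
    simp only [map_mul, map_add, map_neg, smul_eq_mul, Complex.conj_I, Complex.conj_ofReal]
    linear_combination (conj (1 / 2 : ℂ) * a.im * conj (f (Complex.I • X))) * Complex.I_mul_I

end FundamentalForms

theorem IsAdaptedFrame.differentiableAt {E : Type*} [NormedAddCommGroup E] [InnerProductSpace ℂ E]
    {M O : Set E} {m τ : ℕ} {ν : ℕ → ℕ} {q : E} {e : Basis (Fin (m + 2)) ℂ (E × ℂ)}
    {Z : E → Basis (Fin (m + 2)) ℂ (E × ℂ)} (hqO : q ∈ O) (hZ : IsAdaptedFrame M τ ν e O Z)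
    (a : Fin (m + 2)) : DifferentiableAt ℝ (fun y => Z y a) q :=
  ((hZ.smooth a).contDiffAt (hZ.isOpen.mem_nhds hqO)).differentiableAt (by simp)

/-! ### Adapted frames on the link: membership in the osculating spaces, and the forms `π^b_0`. -/

section AdaptedFrame

variable {E : Type*} [NormedAddCommGroup E] [InnerProductSpace ℂ E] [FiniteDimensional ℂ E]
  {C : Set E} {T : Type*} [NormedAddCommGroup T] [NormedSpace ℂ T]
  {m τ : ℕ} {ν : ℕ → ℕ} {q : E} {O : Set E} {e : Basis (Fin (m + 2)) ℂ (E × ℂ)}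
  {Z : E → Basis (Fin (m + 2)) ℂ (E × ℂ)}

theorem repr_eq_zero_of_mem_span {k : ℕ} {F : Type*} [AddCommGroup F] [Module ℂ F]
    (b : Basis (Fin k) ℂ F) {s : Set (Fin k)} {G : F} (hG : G ∈ Submodule.span ℂ (b '' s))
    {a : Fin k} (ha : a ∉ s) : b.repr G a = 0 := by
  by_contra h
  exact ha ((Basis.mem_span_image b).mp hG (by simpa using h))

variable (hC : ∀ v ∈ C, ∀ a : ℂ, a ≠ 0 → a • v ∈ C) (hν0 : ν 0 = 0) (hν : ∀ l ≤ τ, ν l ≤ m)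
  (hch : ∀ y ∈ link C, Nonempty (ConeChart C y T m τ ν)) (hq : q ∈ link C) (hqO : q ∈ O)
  (hZ : IsAdaptedFrame (link C) τ ν e O Z) (c : ConeChart C q T m τ ν)

include hC hν hch hqO hZ in
theorem eventually_frame_mem_oscAt {l : ℕ} (hl : l ≤ τ) {a : Fin (m + 2)} (ha : (a : ℕ) ≤ ν l) :
    ∀ᶠ y in 𝓝 q, y ∈ link C → Z y a ∈ c.oscAt l y := by
  have h0 : c.y0 q ≠ 0 := by rw [c.y0_q]; exact one_ne_zero
  filter_upwards [hZ.isOpen.mem_nhds hqO, c.isOpen_domain.mem_nhds h0] with y hyO hy0 hy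
  rw [← osc_eq_oscAt hC hν hch c hy hy0 hl, hZ.adapted y ⟨hy, hyO⟩ l hl]
  exact Submodule.subset_span ⟨a, ha, rfl⟩

include hC hch hq hqO hZ in
theorem oscAt_eq_span {l : ℕ} (hl : l ≤ τ) :
    c.oscAt l q = Submodule.span ℂ (Z q '' {a | (a : ℕ) ≤ ν l}) := by
  rw [← osc_q hC hch c hq, hZ.adapted q ⟨hq, hqO⟩ l hl]

include hC hch hq hqO hZ in
theorem repr_eq_zero_of_mem_oscAt {l : ℕ} (hl : l ≤ τ) {G : E × ℂ} (hG : G ∈ c.oscAt l q)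
    {a : Fin (m + 2)} (ha : ν l < (a : ℕ)) : (Z q).repr G a = 0 := by
  rw [oscAt_eq_span hC hch hq hqO hZ c hl] at hG
  exact repr_eq_zero_of_mem_span (Z q) hG (by simpa using ha)

include hC hch hq hqO hZ in
theorem frame_mem_oscAt {l : ℕ} (hl : l ≤ τ) {a : Fin (m + 2)} (ha : (a : ℕ) ≤ ν l) :
    Z q a ∈ c.oscAt l q := by
  rw [oscAt_eq_span hC hch hq hqO hZ c hl]
  exact Submodule.subset_span ⟨a, ha, rfl⟩

include hC hch hq hqO hZ in
/-- The components of a vector of `oscAt (l + 1)` in the directions of `Level m ν l` determine it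
modulo `oscAt l`. -/
theorem sub_sum_level_mem_oscAt {l : ℕ} (hl : l + 1 ≤ τ) {G : E × ℂ}
    (hG : G ∈ c.oscAt (l + 1) q) :
    G - ∑ b : Level m ν l, (Z q).repr G b • Z q b ∈ c.oscAt l q := by
  classical
  have h1 : ∑ b : Level m ν l, (Z q).repr G b • Z q b
      = ∑ b ∈ Finset.univ.filter fun a : Fin (m + 2) => ν l < (a : ℕ) ∧ (a : ℕ) ≤ ν (l + 1),
        (Z q).repr G b • Z q b :=
    (Finset.sum_subtype (Finset.univ.filter fun a : Fin (m + 2) =>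
      ν l < (a : ℕ) ∧ (a : ℕ) ≤ ν (l + 1)) (fun a => by simp)
      fun b => (Z q).repr G b • Z q b).symm
  have h2 := Finset.sum_filter_add_sum_filter_not Finset.univ
    (fun a : Fin (m + 2) => ν l < (a : ℕ) ∧ (a : ℕ) ≤ ν (l + 1)) fun b => (Z q).repr G b • Z q b
  rw [(Z q).sum_repr G] at h2
  rw [h1, sub_eq_of_eq_add' h2.symm]
  refine Submodule.sum_mem _ fun a ha => ?_
  simp only [Finset.mem_filter, Finset.mem_univ, true_and, not_and_or, not_lt, not_le] at ha
  rcases ha with ha | ha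
  · exact Submodule.smul_mem _ _ (frame_mem_oscAt hC hch hq hqO hZ c (by omega) ha)
  · rw [repr_eq_zero_of_mem_oscAt hC hch hq hqO hZ c hl hG ha, zero_smul]
    exact Submodule.zero_mem _

include hC hch hZ in
theorem frame_zero_eq {y : E} (hy : y ∈ link C) (hyO : y ∈ O) :
    Z y 0 = (Z y 0).2 • lift y := by
  obtain ⟨d⟩ := hch y hy
  have h1 : Z y 0 ∈ d.oscAt 0 y := frame_mem_oscAt hC hch hy hyO hZ d (Nat.zero_le _) (by simp)
  obtain ⟨h2, h3⟩ := d.mem_oscAt_q.mp h1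
  rw [d.Fil_zero] at h2
  obtain ⟨b, hb⟩ := Submodule.mem_span_singleton.mp h2
  have h4 : ‖y‖ = 1 := by simpa using hy.2
  have h5 : (Z y 0).2 = b := by
    rw [h3, ← hb, inner_smul_right, inner_self_eq_norm_sq_to_K, h4]
    simp
  rw [h5]
  refine Prod.ext hb.symm ?_
  simp [lift, h5]

include hC hch hq hqO hZ in
theorem frame_zero_snd_ne_zero : (Z q 0).2 ≠ 0 := by
  intro h
  have h1 := frame_zero_eq hC hch hZ hq hqO
  rw [h, zero_smul] at h1
  exact (Z q).ne_zero 0 h1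

include hC hch hqO hZ in
-- On the link `Z₀` is a multiple of the lift, with factor its own last component; differentiate the
-- product along a curve.
theorem fderiv_frame_zero {X : E} (hX : X ∈ tangentSet (link C) q) :
    ∃ s : ℂ, fderiv ℝ (fun y => Z y 0) q X = s • lift q + (Z q 0).2 • (X, 0) := by
  obtain ⟨γ, hγ, hγ0, hγt, hγM⟩ := exists_curve_of_mem_tangentSet hX
  have h1 := hasDerivAt_comp_curve hγ hγ0 (hZ.differentiableAt hqO 0).hasFDerivAt
  have h2 : HasDerivAt (fun t => (Z (γ t) 0).2) (fderiv ℝ (fun y => Z y 0) q X).2 0 := h1.snd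
  have h3 : HasDerivAt (fun t => lift (γ t)) ((X, 0) : E × ℂ) 0 :=
    hγ.prodMk (hasDerivAt_const (0 : ℝ) (1 : ℂ))
  have h4 := h2.smul h3
  have h5 : (fun t => Z (γ t) 0) =ᶠ[𝓝 0] fun t => (Z (γ t) 0).2 • lift (γ t) := by
    filter_upwards [hγM, hγt.eventually (hZ.isOpen.mem_nhds hqO)] with t ht ht'
    exact frame_zero_eq hC hch hZ ht ht'
  refine ⟨(fderiv ℝ (fun y => Z y 0) q X).2, ?_⟩
  have h6 := h1.unique (h4.congr_of_eventuallyEq h5)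
  rw [h6]
  simp only [hγ0]
  simp [lift, add_comm]

include hC hν0 hch hq hqO hZ in
theorem maurerCartan_zero {X : E} (hX : X ∈ tangentSet (link C) q) {b : Fin (m + 2)} (hb : b ≠ 0) :
    maurerCartan Z q b 0 X = (Z q 0).2 * (Z q).repr (X, 0) b := by
  obtain ⟨s, hs⟩ := fderiv_frame_zero hC hch hqO hZ hX
  obtain ⟨c⟩ := hch q hq
  have h1 : (Z q).repr (lift q) b = 0 := by
    refine repr_eq_zero_of_mem_oscAt hC hch hq hqO hZ c (Nat.zero_le _)
      (c.lift_mem_oscAt hq (by rw [c.y0_q]; exact one_ne_zero)) ?_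
    rw [hν0]
    exact Nat.pos_of_ne_zero fun h => hb (Fin.ext h)
  rw [maurerCartan, hs, map_add, map_smul, map_smul]
  simp [h1]

end AdaptedFrame

/-! ### The coframe on the contact space, and the coefficients `h^b_{aj}`. -/

section AdaptedFrame

variable {E : Type*} [NormedAddCommGroup E] [InnerProductSpace ℂ E] [FiniteDimensional ℂ E]
  {C : Set E} {T : Type*} [NormedAddCommGroup T] [NormedSpace ℂ T]
  {m τ : ℕ} {ν : ℕ → ℕ} {q : E} {O : Set E} {e : Basis (Fin (m + 2)) ℂ (E × ℂ)}
  {Z : E → Basis (Fin (m + 2)) ℂ (E × ℂ)}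
  (hC : ∀ v ∈ C, ∀ a : ℂ, a ≠ 0 → a • v ∈ C) (hν0 : ν 0 = 0) (hν : ∀ l ≤ τ, ν l ≤ m)
  (hτ : 1 ≤ τ) (hνm : ν τ = m)
  (hch : ∀ y ∈ link C, Nonempty (ConeChart C y T m τ ν)) (hq : q ∈ link C) (hqO : q ∈ O)
  (hZ : IsAdaptedFrame (link C) τ ν e O Z) (c : ConeChart C q T m τ ν)

theorem level_zero_ne (j : Level m ν 0) : (j : Fin (m + 2)) ≠ 0 := by
  intro h
  have := j.2.1
  rw [h] at this
  simp at this

theorem ConeChart.mem_tangentSet_of_mem_contactSpace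
    (hC : ∀ v ∈ C, ∀ a : ℂ, a ≠ 0 → a • v ∈ C) (hq : q ∈ link C) {X : E}
    (hX : X ∈ c.contactSpace) : X ∈ tangentSet (link C) q :=
  ((c.mem_holTangent_q hC hq).mpr hX).1

omit [FiniteDimensional ℂ E] in
theorem ConeChart.contact_mem_oscAt {X : E} (hX : X ∈ c.contactSpace) :
    ((X, 0) : E × ℂ) ∈ c.oscAt 1 q :=
  c.mem_oscAt_q.mpr ⟨hX.1, hX.2.symm⟩

/-- The coframe `π¹, …, πⁿ`, as a linear map on the contact space. -/
def coframe (Z : E → Basis (Fin (m + 2)) ℂ (E × ℂ)) (c : ConeChart C q T m τ ν) :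
    c.contactSpace →ₗ[ℂ] Level m ν 0 → ℂ :=
  LinearMap.pi fun j => (Z q 0).2 •
    (((Z q).coord j).comp (LinearMap.inl ℂ E ℂ)).comp c.contactSpace.subtype

omit [FiniteDimensional ℂ E] in
theorem coframe_apply (X : c.contactSpace) (j : Level m ν 0) :
    coframe Z c X j = (Z q 0).2 * (Z q).repr ((X : E), 0) j := rfl

include hC hν0 hch hq hqO hZ in
theorem maurerCartan_eq_coframe (X : c.contactSpace) (j : Level m ν 0) :
    maurerCartan Z q j 0 X = coframe Z c X j :=
  maurerCartan_zero hC hν0 hch hq hqO hZ (c.mem_tangentSet_of_mem_contactSpace hC hq X.2)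
    (level_zero_ne j)

include hC hτ hch hq hqO hZ in
-- A contact vector without components `π^j` lies in the line of the lift, so it is a multiple of
-- `q` orthogonal to `q`. Conversely, a combination of the `Z_j` becomes a contact vector after
-- subtraction of a multiple of the lift, which the coframe does not see.
theorem coframe_bijective : Function.Bijective (coframe Z c) := by
  have h0 := frame_zero_snd_ne_zero hC hch hq hqO hZ
  constructor
  · rw [← LinearMap.ker_eq_bot, LinearMap.ker_eq_bot']
    intro X hX
    have h1 := sub_sum_level_mem_oscAt hC hch hq hqO hZ c (l := 0) hτ (c.contact_mem_oscAt X.2)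
    have h2 : ∀ j : Level m ν 0, (Z q).repr ((X : E), 0) j = 0 := by
      intro j
      have := congrFun hX j
      rw [coframe_apply] at this
      exact (mul_eq_zero.mp this).resolve_left h0
    simp only [h2, zero_smul, Finset.sum_const_zero, sub_zero] at h1
    have h3 := (c.mem_oscAt_q.mp h1).1
    rw [c.Fil_zero] at h3
    obtain ⟨b, hb⟩ := Submodule.mem_span_singleton.mp h3
    have h4 := X.2.2
    have hq1 : ‖q‖ = 1 := by simpa using hq.2
    have h5 : inner ℂ q (X : E) = 0 := h4
    change b • q = (X : E) at hb
    rw [← hb, inner_smul_right, inner_self_eq_norm_sq_to_K, hq1] at h5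
    have h6 : b = 0 := by simpa using h5
    ext
    rw [← hb, h6, zero_smul]
    rfl
  · intro x
    set G : E × ℂ := ∑ j : Level m ν 0, ((Z q 0).2⁻¹ * x j) • Z q j with hG
    have hG1 : G ∈ c.oscAt 1 q := by
      refine Submodule.sum_mem _ fun j _ => Submodule.smul_mem _ _ ?_
      exact frame_mem_oscAt hC hch hq hqO hZ c hτ j.2.2
    have h0q : c.y0 q ≠ 0 := by rw [c.y0_q]; exact one_ne_zero
    have h1 := c.lift_mem_oscAt hq h0q
    have h2 : G - G.2 • lift q ∈ c.oscAt 1 q :=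
      Submodule.sub_mem _ hG1 (Submodule.smul_mem _ _ (c.oscAt_mono q (Nat.zero_le 1) h1))
    have h3 : (G - G.2 • lift q).2 = 0 := by simp [lift]
    obtain ⟨h4, h5⟩ := c.mem_oscAt_q.mp h2
    refine ⟨⟨(G - G.2 • lift q).1, h4, h5.symm.trans h3⟩, ?_⟩
    funext j
    have h6 : (((G - G.2 • lift q).1, 0) : E × ℂ) = G - G.2 • lift q := Prod.ext rfl h3.symm
    rw [coframe_apply]
    simp only [h6]
    have h7 : (Z q).repr (lift q) j = 0 := by
      refine repr_eq_zero_of_mem_oscAt hC hch hq hqO hZ c (Nat.zero_le _) h1 ?_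
      exact j.2.1
    have h8 : (Z q).repr G j = (Z q 0).2⁻¹ * x j := by
      classical
      rw [hG, map_sum, Finsupp.finsetSum_apply, Finset.sum_eq_single j]
      · simp
      · intro i _ hij
        have : (i : Fin (m + 2)) ≠ j := fun h => hij (Subtype.ext h)
        simp [this]
      · simp
    rw [map_sub, map_smul, Finsupp.sub_apply, Finsupp.smul_apply, h7, smul_zero, sub_zero, h8,
      mul_inv_cancel_left₀ h0]

/-- The coframe as a linear equivalence. -/
def coframeEquiv (hb : Function.Bijective (coframe Z c)) :
    c.contactSpace ≃ₗ[ℂ] (Level m ν 0 → ℂ) :=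
  LinearEquiv.ofBijective _ hb

/-- The coefficients `h^b_{aj}` of the connection forms of an adapted frame. -/
def holCoeff (hb : Function.Bijective (coframe Z c)) (b a : Fin (m + 2)) (j : Level m ν 0) : ℂ :=
  (Z q).repr (delAt (fun y => Z y a) q ((coframeEquiv c hb).symm (Pi.single j 1))) b

omit [FiniteDimensional ℂ E] in
theorem apply_eq_sum_coframe (hb : Function.Bijective (coframe Z c)) (f : E →ₗ[ℂ] ℂ)
    (X : c.contactSpace) :
    f X = ∑ j, f ((coframeEquiv c hb).symm (Pi.single j 1)) * coframe Z c X j := by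
  have h1 : X = ∑ j, coframe Z c X j • (coframeEquiv c hb).symm (Pi.single j 1) := by
    apply (coframeEquiv c hb).injective
    rw [map_sum]
    funext i
    simp only [map_smul, LinearEquiv.apply_symm_apply, Finset.sum_apply, Pi.smul_apply,
      Pi.single_apply, smul_eq_mul, mul_ite, mul_one, mul_zero, Finset.sum_ite_eq,
      Finset.mem_univ, if_true]
    rfl
  conv_lhs => rw [h1]
  simp [mul_comm]

omit [FiniteDimensional ℂ E] in
theorem repr_delAt_eq_sum (hb : Function.Bijective (coframe Z c)) (b a : Fin (m + 2))
    (X : c.contactSpace) :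
    (Z q).repr (delAt (fun y => Z y a) q X) b
      = ∑ j, holCoeff c hb b a j * coframe Z c X j :=
  apply_eq_sum_coframe c hb (((Z q).coord b).comp (delAtₗ (fun y => Z y a) q)) X

include hC hν0 hν hch hq hqO hZ hνm hτ in
-- The tangent space is the contact space plus the real line of `iq`. On the contact space a real
-- linear form splits into its (1,0) and (0,1) parts; on `iq`, where `θ ≠ 0`, the coefficient `c` of
-- `θ` absorbs what is left.
theorem isHolCoeff_holCoeff (hb : Function.Bijective (coframe Z c)) :
    IsHolCoeff (link C) ν Z q (holCoeff c hb) := by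
  intro b a
  have hq1 : ‖q‖ = 1 := by simpa using hq.2
  let f : E →L[ℝ] ℂ :=
    ((LinearMap.toContinuousLinearMap ((Z q).coord b)).restrictScalars ℝ).comp
      (fderiv ℝ (fun y => Z y a) q)
  have hf : ∀ X, maurerCartan Z q b a X = f X := fun X => rfl
  have hdel : ∀ X, (Z q).repr (delAt (fun y => Z y a) q X) b
      = (1 / 2 : ℂ) * (f X - Complex.I * f (Complex.I • X)) := by
    intro X
    simp only [delAt, map_smul, map_sub, Finsupp.smul_apply, Finsupp.sub_apply, smul_eq_mul]
    rfl
  let d : Level m ν 0 → ℂ := fun j =>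
    conj (antilinearPart f ((coframeEquiv c hb).symm (Pi.single j 1)))
  have hX : ∀ X : c.contactSpace, f X = ∑ j, holCoeff c hb b a j * coframe Z c X j
      + ∑ j, d j * conj (coframe Z c X j) := by
    intro X
    have h1 := repr_delAt_eq_sum c hb b a X
    have h2 := congrArg conj (apply_eq_sum_coframe c hb (antilinearPart f) X)
    rw [hdel] at h1
    simp only [map_sum, map_mul] at h2
    rw [← h1, ← h2]
    simp only [antilinearPart, LinearMap.coe_mk, AddHom.coe_mk, Complex.conj_conj]
    ring
  have hlast : (Fin.last (m + 1) : Fin (m + 2)) ≠ 0 := Fin.last_pos.ne'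
  have hIq : Complex.I • q ∈ tangentSet (link C) q := by
    rw [c.mem_tangentSet_q hC hq]
    refine ⟨Submodule.smul_mem _ _ (c.Fil_mono (Nat.zero_le 1) (by simpa using c.N_pow_mem 0 0)), ?_⟩
    rw [inner_smul_right, inner_self_eq_norm_sq_to_K, hq1]
    simp
  have hθ0 : ∀ X : c.contactSpace, maurerCartan Z q (Fin.last (m + 1)) 0 X = 0 := by
    intro X
    have h1 := hν 1 hτ
    rw [maurerCartan_zero hC hν0 hch hq hqO hZ (c.mem_tangentSet_of_mem_contactSpace hC hq X.2)
      hlast, repr_eq_zero_of_mem_oscAt hC hch hq hqO hZ c hτ (c.contact_mem_oscAt X.2)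
        (by rw [Fin.val_last]; omega), mul_zero]
  -- If `θ(iq)` were zero, `(iq, 0)` would lie in the top osculating space, whose elements satisfy
  -- `G.2 = ⟨q, G.1⟩`; but `⟨q, iq⟩ = i`.
  have hθ : maurerCartan Z q (Fin.last (m + 1)) 0 (Complex.I • q) ≠ 0 := by
    rw [maurerCartan_zero hC hν0 hch hq hqO hZ hIq hlast]
    refine mul_ne_zero (frame_zero_snd_ne_zero hC hch hq hqO hZ) fun h => ?_
    have h1 : ((Complex.I • q, 0) : E × ℂ) ∈ c.oscAt τ q := by
      rw [oscAt_eq_span hC hch hq hqO hZ c le_rfl, Basis.mem_span_image]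
      intro x hx
      have hx0 : (Z q).repr (Complex.I • q, 0) x ≠ 0 := by simpa using hx
      change (x : ℕ) ≤ ν τ
      by_contra hx1
      refine hx0 ?_
      have hx2 : x = Fin.last (m + 1) := Fin.ext (by rw [Fin.val_last]; omega)
      rw [hx2, h]
    have h2 := (c.mem_oscAt_q.mp h1).2
    rw [inner_smul_right, inner_self_eq_norm_sq_to_K, hq1] at h2
    exact Complex.I_ne_zero (by simpa using h2.symm)
  have hlin : ∀ i k (X : E) (r : ℝ), maurerCartan Z q i k (X + r • (Complex.I • q))
      = maurerCartan Z q i k X + r * maurerCartan Z q i k (Complex.I • q) := by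
    intro i k X r
    simp only [maurerCartan]
    rw [map_add, map_smul, map_add, ← Complex.coe_smul r, map_smul]
    rfl
  -- The coefficient of `θ` is forced by the equation at `X = iq`.
  refine ⟨(maurerCartan Z q b a (Complex.I • q)
    - ∑ j : Level m ν 0, holCoeff c hb b a j * maurerCartan Z q j 0 (Complex.I • q)
    - ∑ j : Level m ν 0, d j * conj (maurerCartan Z q j 0 (Complex.I • q)))
      / maurerCartan Z q (Fin.last (m + 1)) 0 (Complex.I • q), d, fun X hXt => ?_⟩
  obtain ⟨hX1, hX2⟩ := (c.mem_tangentSet_q hC hq).mp hXt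
  obtain ⟨r, hr⟩ : ∃ r : ℝ, inner ℂ q X = r * Complex.I :=
    ⟨(inner ℂ q X).im, by rw [← Complex.re_add_im (inner ℂ q X), hX2]; simp⟩
  have hY : X - r • (Complex.I • q) ∈ c.contactSpace := by
    refine ⟨Submodule.sub_mem _ hX1 ?_, ?_⟩
    · rw [← Complex.coe_smul r]
      exact Submodule.smul_mem _ _ ((c.mem_tangentSet_q hC hq).mp hIq).1
    · change inner ℂ q (X - r • (Complex.I • q)) = 0
      rw [← Complex.coe_smul r, inner_sub_right, inner_smul_right, inner_smul_right,
        inner_self_eq_norm_sq_to_K, hq1, hr]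
      simp
  obtain ⟨Y, hYX⟩ : ∃ Y : c.contactSpace, X = Y + r • (Complex.I • q) := ⟨⟨_, hY⟩, by simp⟩
  rw [hYX]
  simp only [hlin, hθ0, zero_add, maurerCartan_eq_coframe hC hν0 hch hq hqO hZ c, map_add, map_mul,
    mul_add, Finset.sum_add_distrib, Complex.conj_ofReal, mul_left_comm _ (r : ℂ),
    ← Finset.mul_sum]
  rw [hf Y, hX Y]
  field_simp
  ring

end AdaptedFrame

/-! ### The fundamental forms as powers of the nilpotent action. -/

section FundamentalForms

variable {E : Type*} [NormedAddCommGroup E] [InnerProductSpace ℂ E]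

theorem delAt_sum {ι F : Type*} [Fintype ι] [NormedAddCommGroup F] [NormedSpace ℂ F]
    {G : ι → E → F} {z : E} (hG : ∀ i, DifferentiableAt ℝ (G i) z) (k : ι → ℂ) (X : E) :
    delAt (fun y => ∑ i, k i • G i y) z X = ∑ i, k i • delAt (G i) z X := by
  have h1 : fderiv ℝ (fun y => ∑ i, k i • G i y) z = ∑ i, k i • fderiv ℝ (G i) z := by
    refine (fderiv_fun_sum fun i _ => (hG i).const_smul (k i)).trans ?_
    exact Finset.sum_congr rfl fun i _ => fderiv_const_smul (hG i) (k i)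
  simp only [delAt, h1, sum_apply, smul_apply, Finset.smul_sum,
    ← Finset.sum_sub_distrib]
  refine Finset.sum_congr rfl fun i _ => ?_
  simp only [smul_sub, smul_comm (k i)]

variable [FiniteDimensional ℂ E]
  {C : Set E} {T : Type*} [NormedAddCommGroup T] [NormedSpace ℂ T]
  {m τ : ℕ} {ν : ℕ → ℕ} {q : E} {O : Set E} {e : Basis (Fin (m + 2)) ℂ (E × ℂ)}
  {Z : E → Basis (Fin (m + 2)) ℂ (E × ℂ)}
  (hC : ∀ v ∈ C, ∀ a : ℂ, a ≠ 0 → a • v ∈ C) (hν0 : ν 0 = 0) (hν : ∀ l ≤ τ, ν l ≤ m)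
  (hch : ∀ y ∈ link C, Nonempty (ConeChart C y T m τ ν)) (hq : q ∈ link C) (hqO : q ∈ O)
  (hZ : IsAdaptedFrame (link C) τ ν e O Z) (c : ConeChart C q T m τ ν)
  (hb : Function.Bijective (coframe Z c))

include hC hν hch hq hqO hZ in
-- The recursion for the forms is differentiation of the frame: along the (1,0) vector of `X`, the
-- derivative of `∑ F_a Z_a` with frozen coefficients has the next form as its components at the
-- next level. The same derivative equals `N (κ X)` applied to the sum, modulo the current step of
-- the filtration. The factor `(Z q 0).2` enters once, through `π^j`.
theorem sum_fundForm_sub_mem (X : c.contactSpace) {l : ℕ} (hl : l + 1 ≤ τ) :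
    (∑ b : Level m ν l, (fundForm ν (holCoeff c hb) l b).eval (coframe Z c X) • Z q b).1
      - (Z q 0).2 • (c.N (c.κ X) ^ (l + 1)) q ∈ c.Fil l := by
  have hXh : (X : E) ∈ holTangent (link C) q := (c.mem_holTangent_q hC hq).mpr X.2
  have h0 : c.y0 q ≠ 0 := by rw [c.y0_q]; exact one_ne_zero
  induction l with
  | zero =>
    have h1 := (c.mem_oscAt_q.mp
      (sub_sum_level_mem_oscAt hC hch hq hqO hZ c hl (c.contact_mem_oscAt X.2))).1
    have h2 := c.sub_N_mem_of_mem_tangentSet hXh.1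
    rw [c.fderiv_ξ_q hXh.1] at h2
    have h3 := (c.Fil 0).smul_mem (Z q 0).2 ((c.Fil 0).sub_mem h2 h1)
    refine (congrArg (· ∈ c.Fil 0) ?_).mp h3
    simp only [fundForm, MvPolynomial.eval_X, coframe_apply, mul_smul, ← Finset.smul_sum,
      Prod.smul_fst, Prod.fst_sub, zero_add, pow_one]
    module
  | succ l ih =>
    specialize ih (by omega)
    set F : Level m ν l → ℂ :=
      fun a => (fundForm ν (holCoeff c hb) l a).eval (coframe Z c X) with hF
    set G : E → E × ℂ := fun y => ∑ a : Level m ν l, F a • Z y a with hG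
    have hd : ∀ a : Level m ν l, DifferentiableAt ℝ (fun y => Z y a) q :=
      fun a => hZ.differentiableAt hqO a
    have hGd : DifferentiableAt ℝ G q := by
      rw [hG]
      exact DifferentiableAt.fun_sum fun a _ => (hd a).const_smul (F a)
    have hmem : ∀ᶠ y in 𝓝 q, y ∈ link C → G y ∈ c.oscAt (l + 1) y := by
      have h1 : ∀ᶠ y in 𝓝 q, ∀ a : Level m ν l, y ∈ link C → Z y a ∈ c.oscAt (l + 1) y :=
        Filter.eventually_all.mpr fun a =>
          eventually_frame_mem_oscAt hC hν hch hqO hZ c (by omega) a.2.2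
      filter_upwards [h1] with y hy hyM
      exact Submodule.sum_mem _ fun a _ => Submodule.smul_mem _ _ (hy a hyM)
    have hI := I_smul_mem_tangentSet hC hch hq hXh
    have h1 := c.delAt_sub_N_mem h0 hGd hmem hXh.1 hI
    have h2 := c.delAt_mem_oscAt h0 hGd hmem hq hXh.1 hI
    have h3 := (c.mem_oscAt_q.mp (sub_sum_level_mem_oscAt hC hch hq hqO hZ c hl h2)).1
    rw [c.ξ_q, neg_zero, c.U_zero, c.fderiv_ξ_q hXh.1, one_apply_eq_self] at h1
    -- The error in the induction hypothesis lies in `Fil l`; `N` raises it only to `Fil (l + 1)`,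
    -- the error now allowed.
    have h4 := c.N_mem (c.κ X) l _ ih
    change c.N (c.κ X) ((G q).1 - _) ∈ _ at h4
    have h5 : ∀ b : Level m ν (l + 1), (Z q).repr (delAt G q X) b
        = (fundForm ν (holCoeff c hb) (l + 1) b).eval (coframe Z c X) := by
      intro b
      rw [hG, delAt_sum hd, map_sum, Finsupp.finsetSum_apply, fundForm, map_sum]
      refine Finset.sum_congr rfl fun a _ => ?_
      rw [map_smul, Finsupp.smul_apply, repr_delAt_eq_sum c hb, map_mul, map_sum, smul_eq_mul,
        mul_comm]
      simp [hF]
    simp only [h5] at h3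
    have h6 := (c.Fil (l + 1)).add_mem ((c.Fil (l + 1)).sub_mem h1 h3) h4
    refine (congrArg (· ∈ c.Fil (l + 1)) ?_).mp h6
    rw [pow_succ' _ (l + 1), mul_apply_eq_comp, map_sub, map_smul, Prod.fst_sub]
    abel

/-- The component of `tangentLift q v` in the direction of a vector of the frame. -/
def frameCoord (Z : E → Basis (Fin (m + 2)) ℂ (E × ℂ)) (q : E) (b : Fin (m + 2)) : E →ₗ[ℂ] ℂ :=
  ((Z q).coord b).comp (tangentLift q)

include hC hch hq hqO hZ c in
theorem frameCoord_eq_zero {l : ℕ} (hl : l ≤ τ) {v : E} (hv : v ∈ c.Fil l) {b : Fin (m + 2)}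
    (hlb : ν l < (b : ℕ)) : frameCoord Z q b v = 0 :=
  repr_eq_zero_of_mem_oscAt hC hch hq hqO hZ c hl (c.tangentLift_mem_oscAt_q hv) hlb

include hC hch hq hqO hZ c in
theorem frameCoord_frame {l : ℕ} (hl : l ≤ τ) (b : Fin (m + 2)) {a : Fin (m + 2)}
    (ha : (a : ℕ) ≤ ν l) : frameCoord Z q b (Z q a).1 = if a = b then 1 else 0 := by
  have h1 := ConeChart.eq_tangentLift c (frame_mem_oscAt hC hch hq hqO hZ c hl ha)
  rw [frameCoord, LinearMap.comp_apply, ← h1, Basis.coord_apply, Basis.repr_self,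
    Finsupp.single_apply]

include hC hν hch hq hqO hZ in
/-- The components of the fundamental forms in terms of the powers of the action. -/
theorem eval_fundForm (X : c.contactSpace) {l : ℕ} (hl : l + 1 ≤ τ) (b : Level m ν l) :
    (fundForm ν (holCoeff c hb) l b).eval (coframe Z c X)
      = (Z q 0).2 * frameCoord Z q b ((c.N (c.κ X) ^ (l + 1)) q) := by
  have h1 := frameCoord_eq_zero hC hch hq hqO hZ c (by omega)
    (sum_fundForm_sub_mem hC hν hch hq hqO hZ c hb X hl) b.2.1
  rw [map_sub, map_smul, sub_eq_zero, Prod.fst_sum, map_sum] at h1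
  rw [← smul_eq_mul, ← h1, Finset.sum_eq_single b]
  · rw [Prod.smul_fst, map_smul, frameCoord_frame hC hch hq hqO hZ c hl _ b.2.2, if_pos rfl,
      smul_eq_mul, mul_one]
  · intro a _ hab
    rw [Prod.smul_fst, map_smul, frameCoord_frame hC hch hq hqO hZ c hl _ a.2.2,
      if_neg fun h => hab (Subtype.ext h), smul_zero]
  · simp

include hC hν hch hq hqO hZ in
-- A relation gives a functional that kills all the powers `(N a)^(l+1) q`. It also kills `Fil l`,
-- hence all of `Fil (l + 1)`, which contains the first components of the `Z_b`; on these it reads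
-- off the coefficients.
theorem linearIndependent_fundForm {l : ℕ} (hl : l + 1 ≤ τ) (k : Level m ν l → ℂ)
    (hk : ∀ X, ∑ b, k b * (fundForm ν (holCoeff c hb) l b).eval (coframe Z c X) = 0) : k = 0 := by
  have ht := frame_zero_snd_ne_zero hC hch hq hqO hZ
  set Φ : E →ₗ[ℂ] ℂ := ∑ b : Level m ν l, k b • frameCoord Z q b with hΦ
  have hΦa : ∀ v, Φ v = ∑ b : Level m ν l, k b * frameCoord Z q b v := by
    intro v
    simp [hΦ, LinearMap.sum_apply]
  have h1 : c.Fil (l + 1) ≤ LinearMap.ker Φ := by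
    refine (c.Fil_succ l).trans (sup_le (fun v hv => ?_) (Submodule.span_le.mpr ?_))
    · rw [LinearMap.mem_ker, hΦa]
      refine Finset.sum_eq_zero fun b _ => ?_
      rw [frameCoord_eq_zero hC hch hq hqO hZ c (by omega) hv b.2.1, mul_zero]
    · rintro _ ⟨a, rfl⟩
      obtain ⟨X, rfl⟩ := (c.contactEquiv hq).surjective a
      rw [SetLike.mem_coe, LinearMap.mem_ker, hΦa]
      have h2 := hk X
      simp only [eval_fundForm hC hν hch hq hqO hZ c hb X hl, mul_left_comm _ (Z q 0).2,
        ← Finset.mul_sum] at h2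
      exact (mul_eq_zero.mp h2).resolve_left ht
  funext b
  have h2 := h1 (c.mem_oscAt_q.mp (frame_mem_oscAt hC hch hq hqO hZ c hl b.2.2)).1
  rw [LinearMap.mem_ker, hΦa, Finset.sum_eq_single b] at h2
  · rw [frameCoord_frame hC hch hq hqO hZ c hl _ b.2.2, if_pos rfl, mul_one] at h2
    exact h2
  · intro a _ hab
    rw [frameCoord_frame hC hch hq hqO hZ c hl _ b.2.2, if_neg fun h => hab (Subtype.ext h.symm),
      mul_zero]
  · simp

theorem span_preimage_eq_top {V W : Type*} [AddCommGroup V] [Module ℂ V] [AddCommGroup W]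
    [Module ℂ W] (f : V ≃ₗ[ℂ] W) {s : Set W} (hs : Submodule.span ℂ s = ⊤) :
    Submodule.span ℂ {x | f x ∈ s} = ⊤ := by
  have h1 : {x | f x ∈ s} = f.symm '' s := by
    ext x
    constructor
    · exact fun hx => ⟨f x, hx, f.symm_apply_apply x⟩
    · rintro ⟨y, hy, rfl⟩
      simpa using hy
  rw [h1]
  have h2 := Submodule.map_span (f.symm : W →ₗ[ℂ] V) s
  rw [hs, Submodule.map_top, LinearMap.range_eq_top.mpr f.symm.surjective] at h2
  exact h2.symm

include hC hν hch hq hqO hZ in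
-- The criterion is applied with the cone `D` of directions that act with square zero: there powers
-- of `N` have no quadratic term, and sums of few elements of `D` are nilpotent of low order.
theorem isBochnerRigidForm_fundForm {l : ℕ} (hl1 : 1 ≤ l) (hl : l + 1 ≤ τ) :
    IsBochnerRigidForm (l + 1) (fundForm ν (holCoeff c hb) l) := by
  -- The variables `π^j` and the chart parameter `a` are both linear coordinates on the contact
  -- space.
  set η : (Level m ν 0 → ℂ) ≃ₗ[ℂ] T := (coframeEquiv c hb).symm.trans (c.contactEquiv hq) with hη
  have hev : ∀ x b, (fundForm ν (holCoeff c hb) l b).eval x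
      = (Z q 0).2 * frameCoord Z q b ((c.N (η x) ^ (l + 1)) q) := by
    intro x b
    have h1 := eval_fundForm hC hν hch hq hqO hZ c hb ((coframeEquiv c hb).symm x) hl b
    have h2 : coframe Z c ((coframeEquiv c hb).symm x) = x :=
      (coframeEquiv c hb).apply_symm_apply x
    rwa [h2] at h1
  clear_value η
  refine isBochnerRigidForm_of_affineAlong (D := {x | c.N (η x) * c.N (η x) = 0}) (by omega)
    ?_ ?_ ?_ (fun a => isHomogeneous_fundForm ν _ l a) ?_ ?_ ?_
  · intro A hA t
    change c.N (η A) * c.N (η A) = 0 at hA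
    change c.N (η (t • A)) * c.N (η (t • A)) = 0
    rw [map_smul, map_smul, smul_mul_smul_comm, hA, smul_zero]
  · exact span_preimage_eq_top η c.span_sq
  · intro lam hlam
    have h1 : lam.comp (η.symm : T →ₗ[ℂ] Level m ν 0 → ℂ) ≠ 0 := by
      intro h
      refine hlam (LinearMap.ext fun x => ?_)
      have := LinearMap.congr_fun h (η x)
      simpa using this
    have h2 := span_preimage_eq_top η (c.span_sq_ne _ h1)
    refine (congrArg (fun s => Submodule.span ℂ s = ⊤) ?_).mp h2
    ext x
    simp
  · intro b A hA y s t
    simp only [hev, map_add, map_smul]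
    have hc : Commute (c.N (η y)) (c.N (η A)) := c.N_commute _ _
    have h1 : c.N (η y) + s • c.N (η A) + t • c.N (η A) = c.N (η y) + (s + t) • c.N (η A) := by
      rw [add_assoc, add_smul]
    rw [h1, add_smul_pow_of_sq_zero hc hA, add_smul_pow_of_sq_zero hc hA,
      add_smul_pow_of_sq_zero hc hA]
    simp only [add_apply, smul_apply, map_add, map_smul, smul_eq_mul]
    ring
  · intro b L hL hlen
    rw [hev]
    have h1 : c.N (η L.sum) = (L.map fun A => c.N (η A)).sum := by
      have := map_list_sum ((c.N : T →ₗ[ℂ] E →L[ℂ] E).comp (η : (Level m ν 0 → ℂ) →ₗ[ℂ] T)) L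
      simpa [Function.comp_def] using this
    rw [h1, list_sum_pow_eq_zero (L := L.map fun A => c.N (η A)) ?_ ?_ (by simpa using hlen)]
    · simp
    · intro A hA
      obtain ⟨B, hB, rfl⟩ := List.mem_map.mp hA
      exact hL B hB
    · intro A hA A' hA'
      obtain ⟨B, hB, rfl⟩ := List.mem_map.mp hA
      obtain ⟨B', hB', rfl⟩ := List.mem_map.mp hA'
      exact c.N_commute _ _
  · intro k hk
    exact linearIndependent_fundForm hC hν hch hq hqO hZ c hb hl k fun X => hk _

end FundamentalForms

/-! ### Conclusion for a cone with charts. -/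

section Main

variable {E : Type*} [NormedAddCommGroup E] [InnerProductSpace ℂ E] [FiniteDimensional ℂ E]
  {C : Set E} {T : Type*} [NormedAddCommGroup T] [NormedSpace ℂ T] [FiniteDimensional ℂ T]
  {m τ : ℕ} {ν : ℕ → ℕ}

/-- The link of a cone that has charts around all of its points is Bochner rigid. -/
theorem isBochnerRigidSubmanifold_link (hC : ∀ v ∈ C, ∀ a : ℂ, a ≠ 0 → a • v ∈ C)
    (hch : ∀ y ∈ link C, Nonempty (ConeChart C y T m τ ν)) (hτ : 1 ≤ τ) (hν0 : ν 0 = 0)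
    (hν1 : ν 1 = finrank ℂ T) (hνm : ν τ = m) (hmono : ∀ l < τ, ν l < ν (l + 1)) :
    IsBochnerRigidSubmanifold m (finrank ℂ T) (link C) := by
  -- Descending induction from `τ`, where `ν τ = m`; `k` is the distance to the top.
  have hle : ∀ k, ∀ l ≤ τ, l + k = τ → ν l ≤ m := by
    intro k
    induction k with
    | zero => intro l hl h; rw [← hνm, ← h, add_zero]
    | succ k ih => exact fun l hl h => (hmono l (by omega)).le.trans (ih _ (by omega) (by omega))
  have hν : ∀ l ≤ τ, ν l ≤ m := fun l hl => hle (τ - l) l hl (by omega)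
  have hm : 1 ≤ m := by
    have h1 := hmono 0 (by omega)
    have h2 := hν 1 hτ
    simp only [zero_add] at h1
    omega
  refine ⟨isCRSubmanifold_link hC hch, τ, ν, ⟨hτ, hν0, hν1, hνm, hmono, fun q hq l hl =>
    finrank_osc_eq hC hν hch hq hl⟩, fun e he q hq =>
    ⟨exists_isAdaptedFrame hm hC hν0 hν hch he hq, fun O Z hqO hZ => ?_⟩⟩
  obtain ⟨c⟩ := hch q hq
  have hb := coframe_bijective hC hτ hch hq hqO hZ c
  exact ⟨holCoeff c hb, isHolCoeff_holCoeff hC hν0 hν hτ hνm hch hq hqO hZ c hb,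
    fun l hl1 hl => isBochnerRigidForm_fundForm hC hν hch hq hqO hZ c hb hl1 hl⟩

end Main

/-! ### Decomposable vectors -/

section Wedge

variable {k n : ℕ}

/-- The product `v₁ ∧ ⋯ ∧ vₙ`, as a vector of the coordinate space. -/
def wedge (k n : ℕ) : (Fin k → ℂ) [⋀^Fin n]→ₗ[ℂ] Wedge k n :=
  (wedgeEquiv k n).toLinearMap.compAlternatingMap (exteriorPower.ιMulti ℂ n)

theorem wedge_apply (v : Fin n → Fin k → ℂ) :
    wedge k n v = wedgeEquiv k n (exteriorPower.ιMulti ℂ n v) := rfl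

theorem wedge_coord (v : Fin n → Fin k → ℂ) (I : Set.powersetCard (Fin k) n) :
    wedge k n v I
      = (Matrix.of fun i j => v i (Set.powersetCard.ofFinEmbEquiv.symm I j)).det := by
  have h1 : wedge k n v I
      = ((Pi.basisFun ℂ (Fin k)).exteriorPower n).repr (exteriorPower.ιMulti ℂ n v) I := rfl
  rw [h1, exteriorPower.basis_repr_apply, exteriorPower.ιMultiDual_apply_ιMulti]
  rfl

theorem span_range_wedge : Submodule.span ℂ (Set.range (wedge k n)) = ⊤ := by
  have h1 : Set.range (wedge k n)
      = (wedgeEquiv k n).toLinearMap '' Set.range (exteriorPower.ιMulti ℂ n (M := Fin k → ℂ)) := by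
    rw [← Set.range_comp]
    rfl
  rw [h1, ← Submodule.map_span, exteriorPower.ιMulti_span, Submodule.map_top]
  exact LinearMap.range_eq_top.mpr (wedgeEquiv k n).surjective

theorem linearMap_ext_wedge {F : Type*} [AddCommGroup F] [Module ℂ F] {f g : Wedge k n →ₗ[ℂ] F}
    (h : ∀ v, f (wedge k n v) = g (wedge k n v)) : f = g := by
  refine LinearMap.ext_on_range span_range_wedge h

/-- The linear map on the exterior power given by an alternating map. -/
def wedgeLift {F : Type*} [AddCommGroup F] [Module ℂ F] (f : (Fin k → ℂ) [⋀^Fin n]→ₗ[ℂ] F) :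
    Wedge k n →ₗ[ℂ] F :=
  (exteriorPower.alternatingMapLinearEquiv f).comp (wedgeEquiv k n).symm.toLinearMap

@[simp]
theorem wedgeLift_wedge {F : Type*} [AddCommGroup F] [Module ℂ F]
    (f : (Fin k → ℂ) [⋀^Fin n]→ₗ[ℂ] F) (v : Fin n → Fin k → ℂ) :
    wedgeLift f (wedge k n v) = f v := by
  simp [wedgeLift, wedge_apply]

/-- The action of an endomorphism of `ℂᵏ` on the exterior power. -/
def wedgeMap (n : ℕ) (g : (Fin k → ℂ) →ₗ[ℂ] Fin k → ℂ) : Wedge k n →L[ℂ] Wedge k n :=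
  LinearMap.toContinuousLinearMap (wedgeLift ((wedge k n).compLinearMap g))

@[simp]
theorem wedgeMap_wedge (g : (Fin k → ℂ) →ₗ[ℂ] Fin k → ℂ) (v : Fin n → Fin k → ℂ) :
    wedgeMap n g (wedge k n v) = wedge k n fun i => g (v i) := by
  simp only [wedgeMap, LinearMap.coe_toContinuousLinearMap', wedgeLift_wedge]
  rfl

theorem clm_ext_wedge {F : Type*} [NormedAddCommGroup F] [NormedSpace ℂ F]
    {f g : Wedge k n →L[ℂ] F} (h : ∀ v, f (wedge k n v) = g (wedge k n v)) : f = g :=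
  ContinuousLinearMap.coe_injective (linearMap_ext_wedge h)

theorem wedgeMap_mul (g h : (Fin k → ℂ) →ₗ[ℂ] Fin k → ℂ) :
    wedgeMap n (g * h) = wedgeMap n g * wedgeMap n h :=
  clm_ext_wedge fun v => by simp

theorem wedgeMap_one : wedgeMap n (1 : (Fin k → ℂ) →ₗ[ℂ] Fin k → ℂ) = 1 :=
  clm_ext_wedge fun v => by simp

/-- The product `v₁ ∧ ⋯ ∧ vₙ`, as a continuous multilinear map. -/
def wedgeCM (k n : ℕ) : ContinuousMultilinearMap ℂ (fun _ : Fin n => Fin k → ℂ) (Wedge k n) where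
  toMultilinearMap := (wedge k n).toMultilinearMap
  cont := by
    change Continuous fun v : Fin n → Fin k → ℂ => wedge k n v
    have h1 : Continuous fun v : Fin n → Fin k → ℂ => (wedge k n v).ofLp := by
      refine continuous_pi fun I => ?_
      refine Continuous.congr (Continuous.matrix_det (continuous_matrix fun i j => ?_))
        fun v => (wedge_coord v I).symm
      exact (continuous_apply (Set.powersetCard.ofFinEmbEquiv.symm I j)).comp (continuous_apply i)
    exact (PiLp.continuous_toLp 2 _).comp h1

theorem hasDerivAt_wedge_line (v u : Fin n → Fin k → ℂ) :
    HasDerivAt (fun t : ℂ => wedge k n fun i => v i + t • u i)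
      (∑ i, wedge k n (Function.update v i (u i))) 0 := by
  have h1 : HasDerivAt (fun t : ℂ => v + t • u) u 0 := by
    simpa using ((hasDerivAt_id (0 : ℂ)).smul_const u).const_add v
  have h2 := ((wedgeCM k n).hasFDerivAt (v + (0 : ℂ) • u)).comp_hasDerivAt (0 : ℂ) h1
  rw [zero_smul, add_zero, ContinuousMultilinearMap.linearDeriv_apply] at h2
  exact h2

/-- The alternating maps transform with the determinant. -/
theorem alternatingMap_sum_smul {V F : Type*} [AddCommGroup V] [Module ℂ V] [AddCommGroup F]
    [Module ℂ F] (f : V [⋀^Fin n]→ₗ[ℂ] F) (B : Matrix (Fin n) (Fin n) ℂ) (u : Fin n → V) :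
    f (fun i => ∑ j, B i j • u j) = B.det • f u := by
  have h : f.compLinearMap (Fintype.linearCombination ℂ u)
      = (LinearMap.toSpanSingleton ℂ F (f u)).compAlternatingMap Matrix.detRowAlternating := by
    -- On distinct basis vectors the index map is a permutation, and both sides change by its sign.
    refine Basis.ext_alternating (Pi.basisFun ℂ (Fin n)) fun s hs => ?_
    let σ : Equiv.Perm (Fin n) := Equiv.ofBijective s (Finite.injective_iff_bijective.mp hs)
    have h1 : (fun i => Pi.basisFun ℂ (Fin n) (s i)) = (Pi.basisFun ℂ (Fin n)) ∘ σ := rfl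
    rw [h1, AlternatingMap.map_perm, AlternatingMap.map_perm]
    congr 1
    have h2 : (Matrix.detRowAlternating (Pi.basisFun ℂ (Fin n)) : ℂ) = 1 := by
      rw [← Pi.basisFun_det, Basis.det_self]
    rw [LinearMap.compAlternatingMap_apply, h2, LinearMap.toSpanSingleton_apply, one_smul,
      AlternatingMap.compLinearMap_apply]
    congr 1
    funext i
    simp [Fintype.linearCombination_apply, Pi.single_apply]
  exact DFunLike.congr_fun h B

/-- The minor with columns `s` of the matrix with rows `vᵢ`. -/
def minor (s : Fin n → Fin k) : Wedge k n →ₗ[ℂ] ℂ :=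
  wedgeLift (Matrix.detRowAlternating.compLinearMap (LinearMap.funLeft ℂ ℂ s))

theorem minor_wedge (s : Fin n → Fin k) (v : Fin n → Fin k → ℂ) :
    minor s (wedge k n v) = (Matrix.of fun i j => v i (s j)).det := by
  rw [minor, wedgeLift_wedge]
  rfl

/-- The product of the standard basis vectors with indices `s`. -/
def wedgeBasis (s : Fin n → Fin k) : Wedge k n := wedge k n fun i => Pi.single (s i) 1

theorem wedgeBasis_comp_perm (s : Fin n → Fin k) (σ : Equiv.Perm (Fin n)) :
    wedgeBasis (s ∘ σ) = Equiv.Perm.sign σ • wedgeBasis s :=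
  (wedge k n).map_perm (fun i => Pi.single (s i) (1 : ℂ)) σ

theorem wedgeBasis_eq_zero {s : Fin n → Fin k} (hs : ¬ Function.Injective s) :
    wedgeBasis s = 0 := by
  obtain ⟨i, j, hij, hne⟩ : ∃ i j, s i = s j ∧ i ≠ j := by
    simpa [Function.Injective] using hs
  exact (wedge k n).map_eq_zero_of_eq _ (by simp [hij]) hne

/-- The orthonormal basis of the exterior power that is formed by the products of basis vectors. -/
def wedgeONB (k n : ℕ) : Basis (Set.powersetCard (Fin k) n) ℂ (Wedge k n) :=
  ((Pi.basisFun ℂ (Fin k)).exteriorPower n).map (wedgeEquiv k n)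

theorem wedgeONB_apply (I : Set.powersetCard (Fin k) n) :
    wedgeONB k n I = wedgeBasis (Set.powersetCard.ofFinEmbEquiv.symm I) := by
  rw [wedgeONB, Basis.map_apply, exteriorPower.basis_apply, wedgeBasis, wedge_apply]
  congr 1
  rw [exteriorPower.ιMulti_family]
  congr 1
  funext i
  simp

end Wedge

/-! ### The abelian group of unipotent maps acting on the Grassmannian -/

section Unipotent

variable {n p : ℕ}

/-- The nilpotent map with matrix `η` from the span of the first `n` basis vectors of `ℂⁿ⁺ᵖ` to
the span of the last `p` basis vectors. -/
def nilMap : (Fin p → Fin n → ℂ) →ₗ[ℂ] (Fin (n + p) → ℂ) →ₗ[ℂ] Fin (n + p) → ℂ :=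
  LinearMap.mk₂ ℂ (fun η x => Fin.append 0 fun j => ∑ i, η j i * x (Fin.castAdd p i))
    (fun η η' x => by
      funext k
      refine Fin.addCases (fun i => ?_) (fun j => ?_) k <;>
        simp [add_mul, Finset.sum_add_distrib])
    (fun a η x => by
      funext k
      refine Fin.addCases (fun i => ?_) (fun j => ?_) k <;> simp [mul_assoc, Finset.mul_sum])
    (fun η x x' => by
      funext k
      refine Fin.addCases (fun i => ?_) (fun j => ?_) k <;>
        simp [mul_add, Finset.sum_add_distrib])
    (fun a η x => by
      funext k
      refine Fin.addCases (fun i => ?_) (fun j => ?_) k <;>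
        simp [mul_left_comm, Finset.mul_sum])

theorem nilMap_apply (η : Fin p → Fin n → ℂ) (x : Fin (n + p) → ℂ) :
    nilMap η x = Fin.append 0 fun j => ∑ i, η j i * x (Fin.castAdd p i) := rfl

theorem nilMap_nilMap (η η' : Fin p → Fin n → ℂ) (x : Fin (n + p) → ℂ) :
    nilMap η (nilMap η' x) = 0 := by
  funext k
  refine Fin.addCases (fun i => ?_) (fun j => ?_) k <;> simp [nilMap_apply]

theorem nilMap_single_castAdd (η : Fin p → Fin n → ℂ) (i : Fin n) :
    nilMap η (Pi.single (Fin.castAdd p i) 1)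
      = ∑ j, η j i • (Pi.single (Fin.natAdd n j) 1 : Fin (n + p) → ℂ) := by
  funext k
  refine Fin.addCases (fun i' => ?_) (fun j => ?_) k
  · simp only [nilMap_apply, Fin.append_left, Pi.zero_apply, Finset.sum_apply, Pi.smul_apply]
    refine (Finset.sum_eq_zero fun j _ => ?_).symm
    rw [Pi.single_eq_of_ne, smul_zero]
    intro h
    have h1 := congrArg Fin.val h
    simp only [Fin.val_castAdd, Fin.val_natAdd] at h1
    have := i'.2
    omega
  · simp [nilMap_apply, Pi.single_apply, Finset.sum_apply]

theorem nilMap_single_natAdd (η : Fin p → Fin n → ℂ) (j : Fin p) :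
    nilMap η (Pi.single (Fin.natAdd n j) 1) = 0 := by
  funext k
  refine Fin.addCases (fun i' => ?_) (fun j' => ?_) k
  · simp [nilMap_apply]
  · simp only [nilMap_apply, Fin.append_right, Pi.zero_apply]
    refine Finset.sum_eq_zero fun i _ => ?_
    rw [Pi.single_eq_of_ne, mul_zero]
    intro h
    have := congrArg Fin.val h
    simp at this
    have := i.2
    omega

/-- The action of the vector group of all `η` on the exterior power. -/
def unip (η : Fin p → Fin n → ℂ) : Wedge (n + p) n →L[ℂ] Wedge (n + p) n :=
  wedgeMap n (1 + nilMap η)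

theorem unip_wedge (η : Fin p → Fin n → ℂ) (v : Fin n → Fin (n + p) → ℂ) :
    unip η (wedge (n + p) n v) = wedge (n + p) n fun i => v i + nilMap η (v i) := by
  simp [unip]

/-- `nilMap` maps into the span of the last `p` basis vectors, on which every `nilMap` vanishes, so
`(1 + a)(1 + b) = 1 + a + b`. -/
theorem unip_add (a b : Fin p → Fin n → ℂ) : unip (a + b) = unip a * unip b := by
  rw [unip, unip, unip, ← wedgeMap_mul]
  congr 1
  refine LinearMap.ext fun x => ?_
  simp [nilMap_nilMap]
  abel

theorem unip_zero : unip (0 : Fin p → Fin n → ℂ) = 1 := by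
  rw [unip, map_zero, add_zero, wedgeMap_one]

/-- It suffices to test on the spanning set of products, where the dependence on `η` is an affine
map followed by a multilinear one. -/
theorem contDiff_unip : ContDiff ℂ ∞ (unip : (Fin p → Fin n → ℂ) → _) := by
  rw [contDiff_clm_apply_iff]
  intro y
  have hy : y ∈ Submodule.span ℂ (Set.range (wedge (n + p) n)) := by
    rw [span_range_wedge]
    exact Submodule.mem_top
  induction hy using Submodule.span_induction with
  | mem y hy =>
    obtain ⟨v, rfl⟩ := hy
    have h1 : ∀ η : Fin p → Fin n → ℂ, unip η (wedge (n + p) n v)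
      = wedgeCM (n + p) n fun i => v i + nilMap η (v i) := fun η => unip_wedge η v
    simp only [h1]
    refine (wedgeCM (n + p) n).contDiff.comp (contDiff_pi.mpr fun i => contDiff_const.add ?_)
    exact (LinearMap.toContinuousLinearMap ((nilMap (n := n) (p := p)).flip (v i))).contDiff
  | zero => simpa using contDiff_const
  | add y z _ _ hy hz => simpa using hy.add hz
  | smul a y _ hy => simpa using hy.const_smul a

/-- The action of the Lie algebra of the group of all `unip η`. -/
def unipDeriv : (Fin p → Fin n → ℂ) →L[ℂ] Wedge (n + p) n →L[ℂ] Wedge (n + p) n :=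
  fderiv ℂ unip 0

theorem hasFDerivAt_unip : HasFDerivAt (unip : (Fin p → Fin n → ℂ) → _) unipDeriv 0 :=
  (contDiff_unip.contDiffAt.differentiableAt (by simp)).hasFDerivAt

/-- The infinitesimal action is by derivations: differentiate `(v₁ + tηv₁) ∧ ⋯ ∧ (vₙ + tηvₙ)` at `t
= 0`. -/
theorem unipDeriv_wedge (η : Fin p → Fin n → ℂ) (v : Fin n → Fin (n + p) → ℂ) :
    unipDeriv η (wedge (n + p) n v)
      = ∑ i, wedge (n + p) n (Function.update v i (nilMap η (v i))) := by
  have h1 : HasDerivAt (fun t : ℂ => t • η) η 0 := by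
    simpa using (hasDerivAt_id (0 : ℂ)).smul_const η
  have h2 : HasFDerivAt (unip : (Fin p → Fin n → ℂ) → _) unipDeriv ((0 : ℂ) • η) := by
    rw [zero_smul]
    exact hasFDerivAt_unip
  have h3 := (ContinuousLinearMap.apply ℂ (Wedge (n + p) n) (wedge (n + p) n v)).hasFDerivAt
    |>.comp_hasDerivAt (0 : ℂ) (h2.comp_hasDerivAt (0 : ℂ) h1)
  refine h3.unique ((hasDerivAt_wedge_line v fun i => nilMap η (v i)).congr_of_eventuallyEq
    (Filter.Eventually.of_forall fun t => ?_))
  change unip (t • η) (wedge (n + p) n v) = _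
  simp [unip_wedge]

/-- The maps of rank one act with square zero. -/
theorem unipDeriv_sq {η : Fin p → Fin n → ℂ} {u : Fin p → ℂ} {f : Fin n → ℂ}
    (h : ∀ j i, η j i = u j * f i) : unipDeriv η * unipDeriv η = 0 := by
  -- The image of a rank-one map is a line; applying the derivation twice puts two vectors of it
  -- into a product, unless it hits the same factor twice, which `nilMap_nilMap` kills.
  have h1 : ∀ x, ∃ a : ℂ, nilMap η x = a • (Fin.append 0 u : Fin (n + p) → ℂ) := by
    intro x
    refine ⟨∑ i, f i * x (Fin.castAdd p i), ?_⟩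
    funext k
    refine Fin.addCases (fun i' => ?_) (fun j' => ?_) k
    · simp [nilMap_apply]
    · simp [nilMap_apply, h, Finset.mul_sum, mul_comm, mul_left_comm]
  refine clm_ext_wedge fun v => ?_
  rw [mul_apply_eq_comp, unipDeriv_wedge, map_sum, zero_apply]
  refine Finset.sum_eq_zero fun i _ => ?_
  rw [unipDeriv_wedge]
  refine Finset.sum_eq_zero fun j _ => ?_
  by_cases hij : j = i
  · subst hij
    rw [Function.update_self, nilMap_nilMap]
    exact (wedge (n + p) n).map_update_zero _ _
  · rw [Function.update_of_ne hij]
    obtain ⟨a, ha⟩ := h1 (v i)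
    obtain ⟨b, hb⟩ := h1 (v j)
    rw [ha, hb, AlternatingMap.map_update_smul, Function.update_comm (Ne.symm hij),
      AlternatingMap.map_update_smul,
      (wedge (n + p) n).map_eq_zero_of_eq (i := i) (j := j) _ ?_ (Ne.symm hij)]
    · simp
    · simp [Function.update_of_ne hij]

/-- The number of indices that exceed `n`. -/
def height (s : Fin n → Fin (n + p)) : ℕ := (Finset.univ.filter fun i => n ≤ (s i : ℕ)).card

theorem height_castAdd : height (Fin.castAdd p : Fin n → Fin (n + p)) = 0 := by
  rw [height, Finset.card_eq_zero, Finset.filter_eq_empty_iff]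
  intro i _
  have := i.2
  simp

theorem height_update_le (s : Fin n → Fin (n + p)) (i : Fin n) (k : Fin (n + p)) :
    height (Function.update s i k) ≤ height s + 1 := by
  refine (Finset.card_le_card (t := insert i (Finset.univ.filter fun i => n ≤ (s i : ℕ))) ?_).trans
    (Finset.card_insert_le _ _)
  intro j hj
  by_cases hij : j = i
  · simp [hij]
  · simpa [hij] using hj

theorem update_single (s : Fin n → Fin (n + p)) (i : Fin n) (k : Fin (n + p)) :
    wedge (n + p) n (Function.update (fun i => Pi.single (s i) 1) i (Pi.single k 1))
      = wedgeBasis (Function.update s i k) := by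
  rw [wedgeBasis]
  congr 1
  funext j
  by_cases hij : j = i
  · subst hij
    simp
  · simp [hij]

/-- The filtration of the exterior power by the height. -/
def wedgeFil (n p l : ℕ) : Submodule ℂ (Wedge (n + p) n) :=
  Submodule.span ℂ {x | ∃ s : Fin n → Fin (n + p), height s ≤ l ∧ x = wedgeBasis s}

theorem wedgeBasis_mem_wedgeFil {s : Fin n → Fin (n + p)} {l : ℕ} (h : height s ≤ l) :
    wedgeBasis s ∈ wedgeFil n p l := Submodule.subset_span ⟨s, h, rfl⟩

theorem wedgeFil_mono : Monotone (wedgeFil n p) := by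
  intro k l hkl
  refine Submodule.span_mono ?_
  rintro _ ⟨s, hs, rfl⟩
  exact ⟨s, hs.trans hkl, rfl⟩

/-- Each term of the derivation changes a single factor, so it raises the height by at most one. -/
theorem unipDeriv_mem_wedgeFil (η : Fin p → Fin n → ℂ) {l : ℕ} {x : Wedge (n + p) n}
    (hx : x ∈ wedgeFil n p l) : unipDeriv η x ∈ wedgeFil n p (l + 1) := by
  have h : wedgeFil n p l
      ≤ (wedgeFil n p (l + 1)).comap (unipDeriv η : Wedge (n + p) n →ₗ[ℂ] Wedge (n + p) n) := by
    refine Submodule.span_le.mpr ?_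
    rintro _ ⟨s, hs, rfl⟩
    change unipDeriv η (wedgeBasis s) ∈ wedgeFil n p (l + 1)
    rw [wedgeBasis, unipDeriv_wedge]
    refine Submodule.sum_mem _ fun i _ => ?_
    have h1 : nilMap η (Pi.single (s i) 1) ∈ Submodule.span ℂ
        (Set.range fun k : Fin (n + p) => (Pi.single k 1 : Fin (n + p) → ℂ)) := by
      have h2 : (fun k : Fin (n + p) => (Pi.single k 1 : Fin (n + p) → ℂ))
          = Pi.basisFun ℂ (Fin (n + p)) := by
        funext k
        rw [Pi.basisFun_apply]
      rw [h2]
      exact (Pi.basisFun ℂ (Fin (n + p))).mem_span _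
    refine Submodule.span_induction
      (p := fun y _ => wedge (n + p) n (Function.update (fun i => Pi.single (s i) 1) i y)
        ∈ wedgeFil n p (l + 1)) ?_ ?_ ?_ ?_ h1
    · rintro _ ⟨k, rfl⟩
      rw [update_single]
      exact wedgeBasis_mem_wedgeFil ((height_update_le s i k).trans (by omega))
    · rw [AlternatingMap.map_update_zero]
      exact Submodule.zero_mem _
    · intro y z _ _ hy hz
      rw [AlternatingMap.map_update_add]
      exact Submodule.add_mem _ hy hz
    · intro a y _ hy
      rw [AlternatingMap.map_update_smul]
      exact Submodule.smul_mem _ _ hy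
  exact h hx

end Unipotent

/-! ### Generation of the filtration by powers of the action. -/

section Unipotent

variable {n p : ℕ}

/-- Only the squarefree monomial survives, once for each ordering of its factors. This converts
products of different operators into powers of one. -/
theorem list_sum_pow_length {R : Type*} [Ring R] [Algebra ℂ R] {L : List R}
    (hsq : ∀ A ∈ L, A * A = 0) (hcomm : ∀ A ∈ L, ∀ B ∈ L, Commute A B) :
    L.sum ^ L.length = (L.length.factorial : ℂ) • L.prod := by
  induction L with
  | nil => simp
  | cons A L ih =>
    have ih' := ih (fun B hB => hsq B (by simp [hB]))
      (fun B hB B' hB' => hcomm B (by simp [hB]) B' (by simp [hB']))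
    have h0 : L.sum ^ (L.length + 1) = 0 :=
      list_sum_pow_eq_zero (fun B hB => hsq B (by simp [hB]))
        (fun B hB B' hB' => hcomm B (by simp [hB]) B' (by simp [hB'])) (Nat.lt_succ_self _)
    have hc : Commute L.sum A :=
      (Commute.list_sum_right _ _ fun B hB => hcomm A (by simp) B (by simp [hB])).symm
    have hp : Commute L.prod A :=
      (Commute.list_prod_right _ _ fun B hB => hcomm A (by simp) B (by simp [hB])).symm
    rw [List.sum_cons, List.length_cons, add_comm A, add_pow_of_sq_zero hc (hsq A (by simp)), h0,
      zero_add, ih', List.prod_cons, smul_mul_assoc, hp.eq, smul_smul, Nat.factorial_succ]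
    push_cast
    rfl

theorem unipDeriv_commute (a b : Fin p → Fin n → ℂ) :
    Commute (unipDeriv a) (unipDeriv b) := by
  have h0 : ∀ b : Fin p → Fin n → ℂ,
      HasDerivAt (fun t : ℂ => unip (t • b)) (unipDeriv b) 0 := by
    intro b
    have h1 : HasDerivAt (fun t : ℂ => t • b) b 0 := by
      simpa using (hasDerivAt_id (0 : ℂ)).smul_const b
    have h2 : HasFDerivAt (unip : (Fin p → Fin n → ℂ) → _) unipDeriv ((0 : ℂ) • b) := by
      rw [zero_smul]
      exact hasFDerivAt_unip
    exact h2.comp_hasDerivAt (0 : ℂ) h1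
  have h1 : ∀ s : ℂ, Commute (unip (s • a)) (unipDeriv b) := by
    intro s
    have h1 := (h0 b).const_mul (unip (s • a))
    have h2 := (h0 b).mul_const (unip (s • a))
    refine h1.unique (h2.congr_of_eventuallyEq (Filter.Eventually.of_forall fun t => ?_))
    simp only [← unip_add, add_comm]
  have h2 := (h0 a).mul_const (unipDeriv b)
  have h3 := (h0 a).const_mul (unipDeriv b)
  exact h2.unique (h3.congr_of_eventuallyEq (Filter.Eventually.of_forall fun t => (h1 t).eq))

/-- An elementary matrix replaces one basis vector among the first `n` by one of the last `p`;
injectivity of `s` leaves a single nonzero term. -/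
theorem unipDeriv_single_wedgeBasis {s : Fin n → Fin (n + p)} (hs : Function.Injective s)
    {a b : Fin n} (hab : s a = Fin.castAdd p b) (j : Fin p) :
    unipDeriv (Pi.single j (Pi.single b 1)) (wedgeBasis s)
      = wedgeBasis (Function.update s a (Fin.natAdd n j)) := by
  have h1 : ∀ i, i ≠ a →
      nilMap (Pi.single j (Pi.single b 1)) (Pi.single (s i) 1 : Fin (n + p) → ℂ) = 0 := by
    intro i hi
    have hne : s i ≠ Fin.castAdd p b := fun h => hi (hs (h.trans hab.symm))
    generalize s i = k at hne
    revert hne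
    refine Fin.addCases (fun i' => ?_) (fun j' => ?_) k
    · intro hne
      have hne' : b ≠ i' := fun h => hne (by rw [h])
      rw [nilMap_single_castAdd]
      refine Finset.sum_eq_zero fun j' _ => ?_
      by_cases hj : j' = j
      · subst hj
        rw [Pi.single_eq_same, Pi.single_eq_of_ne hne'.symm, zero_smul]
      · rw [Pi.single_eq_of_ne hj, Pi.zero_apply, zero_smul]
    · exact fun _ => nilMap_single_natAdd _ _
  have h2 : nilMap (Pi.single j (Pi.single b 1)) (Pi.single (s a) 1 : Fin (n + p) → ℂ)
      = Pi.single (Fin.natAdd n j) 1 := by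
    rw [hab, nilMap_single_castAdd, Finset.sum_eq_single j]
    · rw [Pi.single_eq_same, Pi.single_eq_same, one_smul]
    · intro j' _ hj
      rw [Pi.single_eq_of_ne hj, Pi.zero_apply, zero_smul]
    · simp
  rw [wedgeBasis, unipDeriv_wedge, Finset.sum_eq_single a]
  · rw [h2, update_single]
  · intro i _ hi
    rw [h1 i hi, AlternatingMap.map_update_zero]
  · simp

theorem unipDeriv_single_sq (j : Fin p) (b : Fin n) :
    unipDeriv (Pi.single j (Pi.single b 1) : Fin p → Fin n → ℂ)
      * unipDeriv (Pi.single j (Pi.single b 1)) = 0 := by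
  refine unipDeriv_sq (u := Pi.single j 1) (f := Pi.single b 1) fun j' i => ?_
  by_cases hj : j' = j
  · subst hj
    simp
  · simp [hj]

/-- The products of basis vectors are obtained from the product of the first `n` basis vectors by
applying endomorphisms with square zero. -/
theorem exists_wedgeBasis_eq_prod {l : ℕ} {s : Fin n → Fin (n + p)} (hs : Function.Injective s)
    (hl : height s = l) : ∃ (L : List (Fin p → Fin n → ℂ)) (c : ℂ), L.length = l ∧
      (∀ a ∈ L, unipDeriv a * unipDeriv a = 0) ∧
      wedgeBasis s = c • (L.map unipDeriv).prod (wedgeBasis (Fin.castAdd p)) := by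
  induction l generalizing s with
  | zero =>
    have h1 : ∀ i, (s i : ℕ) < n := by
      intro i
      by_contra h
      have h2 : i ∈ Finset.univ.filter fun i => n ≤ (s i : ℕ) := by simpa using h
      rw [height, Finset.card_eq_zero] at hl
      rw [hl] at h2
      simp at h2
    let f : Fin n → Fin n := fun i => ⟨s i, h1 i⟩
    -- At height zero all indices are below `n`, so `s` permutes the first `n` and the constant is
    -- the sign.
    have hf : Function.Injective f := by
      intro i j hij
      exact hs (Fin.ext (Fin.mk.inj_iff.mp hij))
    let σ : Equiv.Perm (Fin n) := Equiv.ofBijective f (Finite.injective_iff_bijective.mp hf)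
    have h2 : s = Fin.castAdd p ∘ σ := rfl
    refine ⟨[], ((Equiv.Perm.sign σ : ℤ) : ℂ), rfl, by simp, ?_⟩
    rw [h2, wedgeBasis_comp_perm]
    simpa [Units.smul_def] using (Int.cast_smul_eq_zsmul ℂ _ _).symm
  | succ l ih =>
    obtain ⟨a, ha⟩ : ∃ a, a ∈ Finset.univ.filter fun i => n ≤ (s i : ℕ) := by
      rw [← Finset.Nonempty, ← Finset.card_pos]
      rw [height] at hl
      omega
    have ha' : n ≤ (s a : ℕ) := by simpa using ha
    -- Pigeonhole: `s` has only `n` values and one of them is at least `n`, so some index below `n`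
    -- is missing. Putting it in place of `s a` lowers the height by one.
    obtain ⟨b, hb⟩ : ∃ b, ∀ i, s i ≠ Fin.castAdd p b := by
      by_contra! h
      have h1 : Finset.univ.image (Fin.castAdd p : Fin n → Fin (n + p)) ∪ {s a}
          ⊆ Finset.univ.image s := by
        intro k hk
        rw [Finset.mem_union] at hk
        rcases hk with hk | hk
        · obtain ⟨b, -, rfl⟩ := Finset.mem_image.mp hk
          obtain ⟨i, hi⟩ := h b
          exact Finset.mem_image.mpr ⟨i, Finset.mem_univ _, hi⟩
        · rw [Finset.mem_singleton.mp hk]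
          exact Finset.mem_image_of_mem _ (Finset.mem_univ _)
      have h2 := Finset.card_le_card h1
      rw [Finset.card_union_of_disjoint, Finset.card_image_of_injective _ hs,
        Finset.card_image_of_injective _ (Fin.castAdd_injective n p)] at h2
      · simp at h2
      · rw [Finset.disjoint_singleton_right, Finset.mem_image]
        rintro ⟨b, -, hb⟩
        have := b.2
        rw [← hb] at ha'
        simp at ha'
        omega
    set s' := Function.update s a (Fin.castAdd p b) with hs'
    have hs'i : Function.Injective s' := by
      intro i j hij
      by_cases hi : i = a <;> by_cases hj : j = a
      · rw [hi, hj]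
      · subst hi
        rw [hs', Function.update_self, Function.update_of_ne hj] at hij
        exact absurd hij.symm (hb j)
      · subst hj
        rw [hs', Function.update_self, Function.update_of_ne hi] at hij
        exact absurd hij (hb i)
      · rw [hs', Function.update_of_ne hj, Function.update_of_ne hi] at hij
        exact hs hij
    have hs'l : height s' = l := by
      have h1 : (Finset.univ.filter fun i => n ≤ (s' i : ℕ))
          = (Finset.univ.filter fun i => n ≤ (s i : ℕ)).erase a := by
        ext i
        by_cases hi : i = a
        · subst hi
          simp [hs']
        · simp [hs', hi]
      rw [height, h1, Finset.card_erase_of_mem ha, ← height, hl]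
      rfl
    obtain ⟨L, c, hL1, hL2, hL3⟩ := ih hs'i hs'l
    obtain ⟨j, hj⟩ : ∃ j, s a = Fin.natAdd n j :=
      ⟨⟨(s a : ℕ) - n, by have := (s a).2; omega⟩, Fin.ext (by simp; omega)⟩
    refine ⟨Pi.single j (Pi.single b 1) :: L, c, by rw [List.length_cons, hL1], ?_, ?_⟩
    · intro x hx
      rcases List.mem_cons.mp hx with rfl | hx
      · exact unipDeriv_single_sq j b
      · exact hL2 x hx
    · have h1 := unipDeriv_single_wedgeBasis hs'i (a := a) (b := b)
        (by rw [hs', Function.update_self]) j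
      rw [hs', Function.update_idem, ← hj, Function.update_eq_self, ← hs', hL3, map_smul] at h1
      rw [← h1]
      simp

theorem wedgeFil_zero :
    wedgeFil n p 0 = Submodule.span ℂ {wedgeBasis (Fin.castAdd p)} := by
  refine le_antisymm (Submodule.span_le.mpr ?_) ?_
  · rintro _ ⟨s, hs, rfl⟩
    by_cases hi : Function.Injective s
    · obtain ⟨L, c, hL, -, h⟩ := exists_wedgeBasis_eq_prod hi (Nat.le_zero.mp hs)
      rw [List.length_eq_zero_iff.mp hL] at h
      exact Submodule.mem_span_singleton.mpr ⟨c, by simpa using h.symm⟩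
    · rw [wedgeBasis_eq_zero hi]
      exact Submodule.zero_mem _
  · rw [Submodule.span_singleton_le_iff_mem]
    exact wedgeBasis_mem_wedgeFil height_castAdd.le

/-- A basis product of height `l + 1` is a product of `l + 1` commuting operators of square zero
applied to the first one, and that product is `1/(l+1)!` times a power of the operator of the sum.
-/
theorem wedgeFil_succ (l : ℕ) : wedgeFil n p (l + 1) ≤ wedgeFil n p l ⊔ Submodule.span ℂ
    (Set.range fun a => (unipDeriv a ^ (l + 1)) (wedgeBasis (Fin.castAdd p))) := by
  refine Submodule.span_le.mpr ?_
  rintro _ ⟨s, hs, rfl⟩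
  by_cases hi : Function.Injective s
  · rcases Nat.lt_or_ge (height s) (l + 1) with h | h
    · exact Submodule.mem_sup_left (wedgeBasis_mem_wedgeFil (by omega))
    · refine Submodule.mem_sup_right ?_
      obtain ⟨L, c, hL1, hL2, h⟩ := exists_wedgeBasis_eq_prod hi (le_antisymm hs h)
      have h1 := list_sum_pow_length (L := L.map unipDeriv) (fun A hA => by
        obtain ⟨a, ha, rfl⟩ := List.mem_map.mp hA
        exact hL2 a ha) (fun A hA B hB => by
        obtain ⟨a, ha, rfl⟩ := List.mem_map.mp hA
        obtain ⟨b, hb, rfl⟩ := List.mem_map.mp hB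
        exact unipDeriv_commute a b)
      rw [List.length_map, hL1, ← map_list_sum] at h1
      have h2 : ((l + 1).factorial : ℂ) ≠ 0 := by exact_mod_cast (l + 1).factorial_ne_zero
      have h3 : (L.map unipDeriv).prod = ((l + 1).factorial : ℂ)⁻¹ • unipDeriv L.sum ^ (l + 1) := by
        rw [h1, smul_smul, inv_mul_cancel₀ h2, one_smul]
      rw [h, h3]
      exact Submodule.smul_mem _ _ (Submodule.smul_mem _ _ (Submodule.subset_span ⟨_, rfl⟩))
  · rw [wedgeBasis_eq_zero hi]
    exact Submodule.zero_mem _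

end Unipotent

/-! ### Levels of the basis products and the type numbers. -/

section GrassmannCone

variable {n p : ℕ}

theorem height_comp_perm (s : Fin n → Fin (n + p)) (σ : Equiv.Perm (Fin n)) :
    height (s ∘ σ) = height s := by
  refine Finset.card_bij' (fun i _ => σ i) (fun i _ => σ.symm i) ?_ ?_ ?_ ?_ <;> simp

/-- The height of an element of the basis. -/
def level (I : Set.powersetCard (Fin (n + p)) n) : ℕ :=
  height (Set.powersetCard.ofFinEmbEquiv.symm I)

theorem wedgeFil_eq_span_wedgeONB (l : ℕ) :
    wedgeFil n p l = Submodule.span ℂ (wedgeONB (n + p) n '' {I | level I ≤ l}) := by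
  refine le_antisymm (Submodule.span_le.mpr ?_) (Submodule.span_le.mpr ?_)
  · rintro _ ⟨s, hs, rfl⟩
    by_cases hi : Function.Injective s
    · let f : Fin n ↪o Fin (n + p) := OrderEmbedding.ofStrictMono (s ∘ Tuple.sort s)
        ((Tuple.monotone_sort s).strictMono_of_injective (hi.comp (Tuple.sort s).injective))
      have h1 : s = f ∘ (Tuple.sort s).symm := by
        funext i
        simp [f]
      have h2 : wedgeONB (n + p) n (Set.powersetCard.ofFinEmbEquiv f) = wedgeBasis f := by
        rw [wedgeONB_apply, Equiv.symm_apply_apply]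
      rw [h1, wedgeBasis_comp_perm, ← h2, Units.smul_def]
      refine zsmul_mem (Submodule.subset_span (Set.mem_image_of_mem _ ?_)) _
      rw [h1, height_comp_perm] at hs
      change level _ ≤ l
      rwa [level, Equiv.symm_apply_apply]
    · rw [wedgeBasis_eq_zero hi]
      exact Submodule.zero_mem _
  · rintro _ ⟨I, hI, rfl⟩
    rw [wedgeONB_apply]
    exact wedgeBasis_mem_wedgeFil hI

/-- The type numbers of the Grassmannian. -/
def grassmannNu (n p l : ℕ) : ℕ :=
  (Finset.univ.filter fun I : Set.powersetCard (Fin (n + p)) n => level I ≤ l).card - 1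

/-- Order the basis by level; the sublevel sets become initial segments. -/
theorem exists_adapted_basis {ι E : Type*} [Fintype ι] [AddCommGroup E] [Module ℂ E] {m : ℕ}
    (hm : Fintype.card ι = m + 1) (b : Basis ι ℂ E) (lev : ι → ℕ) :
    ∃ β : Basis (Fin (m + 1)) ℂ E, ∀ l, b '' {i | lev i ≤ l}
      = β '' {a | (a : ℕ) < (Finset.univ.filter fun i => lev i ≤ l).card} := by
  let f : Fin (m + 1) ≃ ι := (Fintype.equivFinOfCardEq hm).symm
  let g : Fin (m + 1) ≃ ι := (Tuple.sort (lev ∘ f)).trans f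
  have hg : Monotone (lev ∘ g) := Tuple.monotone_sort (lev ∘ f)
  refine ⟨b.reindex g.symm, fun l => ?_⟩
  have h1 : (Finset.univ.filter fun i => lev i ≤ l).card
      = (Finset.univ.filter fun a => (lev ∘ g) a ≤ l).card := by
    refine (Finset.card_bij' (fun a _ => g a) (fun i _ => g.symm i) ?_ ?_ ?_ ?_).symm <;> simp
  have h2 : {a : Fin (m + 1) | (a : ℕ) < (Finset.univ.filter fun i => lev i ≤ l).card}
      = g ⁻¹' {i | lev i ≤ l} := by
    ext a
    rw [h1]
    exact Tuple.lt_card_le_iff_apply_le_of_monotone hg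
  rw [h2]
  ext x
  constructor
  · rintro ⟨i, hi, rfl⟩
    exact ⟨g.symm i, by simpa using hi, by simp⟩
  · rintro ⟨a, ha, rfl⟩
    exact ⟨g a, ha, by simp⟩

theorem card_powersetCard_fin (k n : ℕ) :
    Fintype.card (Set.powersetCard (Fin k) n) = k.choose n := by
  rw [Fintype.card_eq_nat_card, Set.powersetCard.card]
  simp

theorem exists_level_eq {l : ℕ} (hl : l ≤ p) (hln : l ≤ n) :
    ∃ I : Set.powersetCard (Fin (n + p)) n, level I = l := by
  -- The interval `l, …, n + l - 1` contains exactly `l` indices that are at least `n`; `l ≤ n` and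
  -- `l ≤ p` make this possible.
  let f : Fin n ↪o Fin (n + p) := OrderEmbedding.ofStrictMono
    (fun i => ⟨(i : ℕ) + l, by have := i.2; omega⟩) (fun i j hij => by
      have : (i : ℕ) < j := hij
      exact Fin.mk_lt_mk.mpr (by omega))
  refine ⟨Set.powersetCard.ofFinEmbEquiv f, ?_⟩
  rw [level, Equiv.symm_apply_apply, height]
  have h1 : (Finset.univ.filter fun i : Fin n => n ≤ (f i : ℕ))
      = Finset.univ.filter fun i : Fin n => n - l ≤ (i : ℕ) := by
    ext i
    have : ((f i : Fin (n + p)) : ℕ) = (i : ℕ) + l := rfl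
    simp only [Finset.mem_filter, Finset.mem_univ, true_and, this]
    omega
  rw [h1]
  have h2 := Fin.card_filter_val_lt (n := n) (m := n - l)
  have h3 := Finset.card_filter_add_card_filter_not (s := (Finset.univ : Finset (Fin n)))
    (fun i => (i : ℕ) < n - l)
  simp only [not_lt, Finset.card_univ, Fintype.card_fin] at h3
  omega

theorem level_le (I : Set.powersetCard (Fin (n + p)) n) : level I ≤ p := by
  have h1 : Function.Injective (Set.powersetCard.ofFinEmbEquiv.symm I) :=
    (Set.powersetCard.ofFinEmbEquiv.symm I).injective
  rw [level, height]
  have h2 : (Finset.univ.filter fun k : Fin (n + p) => n ≤ (k : ℕ)).card = p := by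
    have h2 := Fin.card_filter_val_lt (n := n + p) (m := n)
    have h3 := Finset.card_filter_add_card_filter_not (s := (Finset.univ : Finset (Fin (n + p))))
      (fun i => (i : ℕ) < n)
    simp only [not_lt, Finset.card_univ, Fintype.card_fin] at h3
    omega
  conv_rhs => rw [← h2]
  refine Finset.card_le_card_of_injOn _ (fun i hi => ?_) h1.injOn
  simpa using hi

theorem one_le_card_level_le (l : ℕ) :
    1 ≤ (Finset.univ.filter fun I : Set.powersetCard (Fin (n + p)) n => level I ≤ l).card := by
  obtain ⟨I, hI⟩ := exists_level_eq (n := n) (p := p) (Nat.zero_le _) (Nat.zero_le _)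
  exact Finset.card_pos.mpr ⟨I, by simp [hI]⟩

theorem grassmannNu_lt {l : ℕ} (hp : l < p) (hn : l < n) :
    grassmannNu n p l < grassmannNu n p (l + 1) := by
  have h1 := one_le_card_level_le (n := n) (p := p) l
  obtain ⟨I, hI⟩ := exists_level_eq (n := n) (p := p) (l := l + 1) hp hn
  have h2 : (Finset.univ.filter fun I : Set.powersetCard (Fin (n + p)) n => level I ≤ l).card
      < (Finset.univ.filter fun I : Set.powersetCard (Fin (n + p)) n => level I ≤ l + 1).card := by
    refine Finset.card_lt_card ⟨fun J hJ => ?_, fun h => ?_⟩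
    · simp only [Finset.mem_filter, Finset.mem_univ, true_and] at hJ ⊢
      omega
    · have h3 := @h I (by simp [hI])
      simp [hI] at h3
  rw [grassmannNu, grassmannNu]
  omega

theorem grassmannNu_top {N : ℕ} (hN : N + 1 = (n + p).choose n) : grassmannNu n p p = N := by
  rw [grassmannNu, Finset.filter_true_of_mem fun I _ => level_le I, Finset.card_univ,
    card_powersetCard_fin, ← hN, Nat.add_sub_cancel]

theorem minor_wedgeBasis_castAdd :
    minor (Fin.castAdd p) (wedgeBasis (Fin.castAdd p : Fin n → Fin (n + p))) = 1 := by
  rw [wedgeBasis, minor_wedge]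
  convert! Matrix.det_one (n := Fin n) (R := ℂ) using 2
  ext i j
  simp [Matrix.one_apply, Pi.single_apply, eq_comm]

theorem wedgeBasis_castAdd_ne_zero :
    wedgeBasis (Fin.castAdd p : Fin n → Fin (n + p)) ≠ 0 := by
  intro h
  have h1 := minor_wedgeBasis_castAdd (n := n) (p := p)
  rw [h, map_zero] at h1
  exact zero_ne_one h1

/-- The number of basis elements of level zero is the dimension of `wedgeFil n p 0`, which is a
line. -/
theorem grassmannNu_zero : grassmannNu n p 0 = 0 := by
  have h1 : finrank ℂ (wedgeFil n p 0) = 1 := by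
    rw [wedgeFil_zero]
    exact finrank_span_singleton wedgeBasis_castAdd_ne_zero
  have h2 : finrank ℂ (wedgeFil n p 0) = (Finset.univ.filter
      fun I : Set.powersetCard (Fin (n + p)) n => level I ≤ 0).card := by
    have h3 : wedgeONB (n + p) n '' {I | level I ≤ 0}
        = ((Finset.univ.filter fun I : Set.powersetCard (Fin (n + p)) n => level I ≤ 0).image
          (wedgeONB (n + p) n) : Set _) := by
      ext
      simp
    rw [wedgeFil_eq_span_wedgeONB, h3, finrank_span_finset_eq_card,
      Finset.card_image_of_injective _ (wedgeONB (n + p) n).injective]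
    rw [← h3]
    exact ((wedgeONB (n + p) n).linearIndependent.linearIndepOn _).id_image
  rw [grassmannNu]
  omega

end GrassmannCone

/-! ### Decomposable vectors in the open cell, and the matrices of rank one. -/

section GrassmannCone

variable {n p : ℕ}

/-- The cone of the nonzero decomposable vectors. -/
def decomposables (k n : ℕ) : Set (Wedge k n) :=
  {y | ∃ v : Fin n → Fin k → ℂ, LinearIndependent ℂ v ∧ y = wedge k n v}

theorem smul_mem_decomposables {k n : ℕ} (hn : 1 ≤ n) {y : Wedge k n} (hy : y ∈ decomposables k n)
    {a : ℂ} (ha : a ≠ 0) : a • y ∈ decomposables k n := by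
  obtain ⟨v, hv, rfl⟩ := hy
  refine ⟨fun i => (Function.update (1 : Fin n → ℂˣ) ⟨0, hn⟩ (Units.mk0 a ha) i) • v i,
    hv.units_smul _, ?_⟩
  have h1 : (fun i => (Function.update (1 : Fin n → ℂˣ) ⟨0, hn⟩ (Units.mk0 a ha) i) • v i)
      = Function.update v ⟨0, hn⟩ (a • v ⟨0, hn⟩) := by
    funext i
    by_cases hi : i = ⟨0, hn⟩
    · subst hi
      simp [Units.smul_def]
    · simp [hi]
  rw [h1, AlternatingMap.map_update_smul, Function.update_eq_self]

theorem wedgeMap_mem_decomposables {k n : ℕ} {g : (Fin k → ℂ) →ₗ[ℂ] Fin k → ℂ}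
    (hg : LinearMap.ker g = ⊥) {y : Wedge k n} (hy : y ∈ decomposables k n) :
    wedgeMap n g y ∈ decomposables k n := by
  obtain ⟨v, hv, rfl⟩ := hy
  exact ⟨fun i => g (v i), hv.map' g hg, wedgeMap_wedge g v⟩

/-- The affine coordinates on the open cell of the Grassmannian. -/
def cellCoord : Wedge (n + p) n →ₗ[ℂ] Fin p → Fin n → ℂ :=
  LinearMap.pi fun j => LinearMap.pi fun i =>
    minor (Function.update (Fin.castAdd p) i (Fin.natAdd n j))

theorem cellCoord_apply (y : Wedge (n + p) n) (j : Fin p) (i : Fin n) :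
    cellCoord y j i = minor (Function.update (Fin.castAdd p) i (Fin.natAdd n j)) y := rfl

theorem unip_wedgeBasis (η : Fin p → Fin n → ℂ) :
    unip η (wedgeBasis (Fin.castAdd p)) = wedge (n + p) n fun i =>
      Pi.single (Fin.castAdd p i) 1 + ∑ j, η j i • Pi.single (Fin.natAdd n j) 1 := by
  rw [wedgeBasis, unip_wedge]
  simp only [nilMap_single_castAdd]

theorem cell_row_castAdd (η : Fin p → Fin n → ℂ) (i c : Fin n) :
    ((Pi.single (Fin.castAdd p i) 1 + ∑ j, η j i • Pi.single (Fin.natAdd n j) 1 :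
      Fin (n + p) → ℂ)) (Fin.castAdd p c) = if i = c then 1 else 0 := by
  rw [← nilMap_single_castAdd, Pi.add_apply, nilMap_apply, Fin.append_left, Pi.zero_apply, add_zero,
    Pi.single_apply]
  simp [eq_comm]

theorem cell_row_natAdd (η : Fin p → Fin n → ℂ) (i : Fin n) (j : Fin p) :
    ((Pi.single (Fin.castAdd p i) 1 + ∑ j, η j i • Pi.single (Fin.natAdd n j) 1 :
      Fin (n + p) → ℂ)) (Fin.natAdd n j) = η j i := by
  have h1 : Fin.natAdd n j ≠ Fin.castAdd p i := by
    intro h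
    have h1 := congrArg Fin.val h
    simp only [Fin.val_castAdd, Fin.val_natAdd] at h1
    have := i.2
    omega
  rw [Pi.add_apply, Pi.single_eq_of_ne h1, zero_add, Finset.sum_apply, Finset.sum_eq_single j]
  · simp
  · intro j' _ hj
    have h2 : Fin.natAdd n j ≠ Fin.natAdd n j' := fun h => hj (Fin.natAdd_injective p n h).symm
    rw [Pi.smul_apply, Pi.single_eq_of_ne h2, smul_zero]
  · simp

theorem minor_unip (η : Fin p → Fin n → ℂ) :
    minor (Fin.castAdd p) (unip η (wedgeBasis (Fin.castAdd p))) = 1 := by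
  rw [unip_wedgeBasis, minor_wedge]
  convert! Matrix.det_one (n := Fin n) (R := ℂ) using 2
  ext i c
  rw [Matrix.of_apply, cell_row_castAdd, Matrix.one_apply]

/-- The minor in question is that of the identity matrix with column `i` replaced by `(η j r)_r`; by
Cramer's rule it is `η j i`. -/
theorem cellCoord_unip (η : Fin p → Fin n → ℂ) :
    cellCoord (unip η (wedgeBasis (Fin.castAdd p))) = η := by
  funext j i
  rw [cellCoord_apply, unip_wedgeBasis, minor_wedge]
  have h1 : (Matrix.of fun r c => (Pi.single (Fin.castAdd p r) 1
      + ∑ j, η j r • Pi.single (Fin.natAdd n j) 1 : Fin (n + p) → ℂ)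
        (Function.update (Fin.castAdd p) i (Fin.natAdd n j) c))
      = (1 : Matrix (Fin n) (Fin n) ℂ).updateCol i (fun r => η j r) := by
    ext r c
    rw [Matrix.of_apply, Matrix.updateCol_apply]
    by_cases hc : c = i
    · subst hc
      rw [Function.update_self, cell_row_natAdd, if_pos rfl]
    · rw [Function.update_of_ne hc, cell_row_castAdd, if_neg hc, Matrix.one_apply]
  rw [h1, ← Matrix.cramer_apply, Matrix.cramer_one]
  rfl

/-- The decomposable vectors in the open cell. -/
theorem eq_minor_smul_unip {y : Wedge (n + p) n} (hy : y ∈ decomposables (n + p) n)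
    (h0 : minor (Fin.castAdd p) y ≠ 0) : y = minor (Fin.castAdd p) y •
      unip (cellCoord ((minor (Fin.castAdd p) y)⁻¹ • y)) (wedgeBasis (Fin.castAdd p)) := by
  obtain ⟨u, -, hu⟩ := hy
  set A : Matrix (Fin n) (Fin n) ℂ := Matrix.of fun i j => u i (Fin.castAdd p j) with hA
  have hdet : minor (Fin.castAdd p) y = A.det := by rw [hu, minor_wedge]
  rw [hdet] at h0 ⊢
  have hAu : IsUnit A.det := isUnit_iff_ne_zero.mpr h0
  -- Multiplication of the rows by `A⁻¹` makes the first `n` columns the identity, and the product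
  -- changes by the factor `det A⁻¹`.
  have h1 := alternatingMap_sum_smul (wedge (n + p) n) A⁻¹ u
  obtain ⟨η, hη'⟩ : ∃ η : Fin p → Fin n → ℂ, ∀ j i,
      η j i = (∑ k, A⁻¹ i k • u k) (Fin.natAdd n j) := ⟨fun _ _ => _, fun _ _ => rfl⟩
  have hη : (fun i => ∑ k, A⁻¹ i k • u k) = fun i =>
      Pi.single (Fin.castAdd p i) 1 + ∑ j, η j i • Pi.single (Fin.natAdd n j) 1 := by
    funext i c
    refine Fin.addCases (fun c => ?_) (fun j => ?_) c
    · refine Eq.trans ?_ (cell_row_castAdd η i c).symm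
      have h2 := congrFun (congrFun (Matrix.nonsing_inv_mul A hAu) i) c
      rw [Matrix.mul_apply, Matrix.one_apply] at h2
      rw [← h2, Finset.sum_apply]
      rfl
    · exact (hη' j i).symm.trans (cell_row_natAdd η i j).symm
  have h2 : (A.det)⁻¹ • y = unip η (wedgeBasis (Fin.castAdd p)) := by
    rw [unip_wedgeBasis, ← hη, h1, Matrix.det_nonsing_inv, Ring.inverse_eq_inv', hu]
  rw [h2, cellCoord_unip, ← h2, smul_smul, mul_inv_cancel₀ h0, one_smul]

theorem unip_mem_decomposables (η : Fin p → Fin n → ℂ) {y : Wedge (n + p) n}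
    (hy : y ∈ decomposables (n + p) n) : unip η y ∈ decomposables (n + p) n := by
  refine wedgeMap_mem_decomposables (LinearMap.ker_eq_bot'.mpr fun x hx => ?_) hy
  have h1 : x + nilMap η x = 0 := hx
  have h2 := congrArg (nilMap η) h1
  rw [map_add, nilMap_nilMap, add_zero, map_zero] at h2
  rwa [h2, add_zero] at h1

/-- The matrix `u fᵗ`. -/
def dyad (u : Fin p → ℂ) (f : Fin n → ℂ) : Fin p → Fin n → ℂ := fun j i => u j * f i

theorem dyad_add_left (u u' : Fin p → ℂ) (f : Fin n → ℂ) :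
    dyad (u + u') f = dyad u f + dyad u' f := by
  funext j i
  simp [dyad, add_mul]

theorem dyad_add_right (u : Fin p → ℂ) (f f' : Fin n → ℂ) :
    dyad u (f + f') = dyad u f + dyad u f' := by
  funext j i
  simp [dyad, mul_add]

theorem dyad_neg_left (u : Fin p → ℂ) (f : Fin n → ℂ) : dyad (-u) f = -dyad u f := by
  funext j i
  simp [dyad]

theorem dyad_neg_right (u : Fin p → ℂ) (f : Fin n → ℂ) : dyad u (-f) = -dyad u f := by
  funext j i
  simp [dyad]

theorem unipDeriv_dyad_sq (u : Fin p → ℂ) (f : Fin n → ℂ) :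
    unipDeriv (dyad u f) * unipDeriv (dyad u f) = 0 :=
  unipDeriv_sq fun _ _ => rfl

theorem single_eq_dyad (j : Fin p) (i : Fin n) :
    (Pi.single j (Pi.single i 1) : Fin p → Fin n → ℂ) = dyad (Pi.single j 1) (Pi.single i 1) := by
  funext j' i'
  by_cases hj : j' = j
  · subst hj
    simp [dyad]
  · simp [dyad, hj]

theorem span_range_dyad :
    Submodule.span ℂ (Set.range fun x : (Fin p → ℂ) × (Fin n → ℂ) => dyad x.1 x.2) = ⊤ := by
  rw [eq_top_iff]
  intro a _
  have h1 : a = ∑ j, ∑ i, a j i • dyad (Pi.single j 1) (Pi.single i 1) := by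
    simp only [← single_eq_dyad]
    funext j i
    simp only [Finset.sum_apply, Pi.smul_apply]
    rw [Finset.sum_eq_single j, Finset.sum_eq_single i]
    · simp
    · intro i' _ hi
      simp [Pi.single_eq_of_ne hi.symm]
    · simp
    · intro j' _ hj
      simp [Pi.single_eq_of_ne hj.symm]
    · simp
  rw [h1]
  exact Submodule.sum_mem _ fun j _ => Submodule.sum_mem _ fun i _ =>
    Submodule.smul_mem _ _ (Submodule.subset_span ⟨(_, _), rfl⟩)

theorem span_unipDeriv_sq :
    Submodule.span ℂ {a : Fin p → Fin n → ℂ | unipDeriv a * unipDeriv a = 0} = ⊤ := by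
  rw [eq_top_iff, ← span_range_dyad]
  refine Submodule.span_mono ?_
  rintro _ ⟨x, rfl⟩
  exact unipDeriv_dyad_sq x.1 x.2

/-- Fix a dyad `u₀ f₀ᵗ` on which `lam` is nonzero. A dyad in the kernel of `lam` is shifted by `u₀`
and `f₀` to dyads outside the kernel, from whose span it is recovered by bilinearity. -/
theorem span_unipDeriv_sq_ne (lam : (Fin p → Fin n → ℂ) →ₗ[ℂ] ℂ) (hlam : lam ≠ 0) :
    Submodule.span ℂ {a : Fin p → Fin n → ℂ | unipDeriv a * unipDeriv a = 0 ∧ lam a ≠ 0} = ⊤ := by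
  set S := Submodule.span ℂ {a : Fin p → Fin n → ℂ | unipDeriv a * unipDeriv a = 0 ∧ lam a ≠ 0}
    with hS
  have hmem : ∀ u f, lam (dyad u f) ≠ 0 → dyad u f ∈ S := fun u f h =>
    Submodule.subset_span ⟨unipDeriv_dyad_sq u f, h⟩
  obtain ⟨u₀, f₀, h0⟩ : ∃ u f, lam (dyad u f) ≠ 0 := by
    by_contra! h
    refine hlam (LinearMap.ext_on_range span_range_dyad fun x => ?_)
    rw [h, LinearMap.zero_apply]
  have hl : ∀ u, dyad u f₀ ∈ S := by
    intro u
    by_cases h : lam (dyad u f₀) = 0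
    · have h1 := S.sub_mem (hmem (u + u₀) f₀ (by rw [dyad_add_left, map_add, h, zero_add]; exact h0))
        (hmem u₀ f₀ h0)
      rwa [dyad_add_left, add_sub_cancel_right] at h1
    · exact hmem _ _ h
  have hr : ∀ f, dyad u₀ f ∈ S := by
    intro f
    by_cases h : lam (dyad u₀ f) = 0
    · have h1 := S.sub_mem (hmem u₀ (f + f₀) (by rw [dyad_add_right, map_add, h, zero_add]; exact h0))
        (hmem u₀ f₀ h0)
      rwa [dyad_add_right, add_sub_cancel_right] at h1
    · exact hmem _ _ h
  have hall : ∀ u f, dyad u f ∈ S := by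
    intro u f
    by_cases h : lam (dyad u f) = 0
    · have h1 : dyad (u + u₀) (f + f₀) ∈ S ∨ dyad (u + -u₀) (f + -f₀) ∈ S := by
        by_contra! h1
        have h2 : lam (dyad (u + u₀) (f + f₀)) = 0 := by
          by_contra h2
          exact h1.1 (hmem _ _ h2)
        have h3 : lam (dyad (u + -u₀) (f + -f₀)) = 0 := by
          by_contra h3
          exact h1.2 (hmem _ _ h3)
        simp only [dyad_add_left, dyad_add_right, dyad_neg_left, dyad_neg_right, map_add, map_neg,
          h] at h2 h3
        exact h0 (by linear_combination (h2 + h3) / 2)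
      rcases h1 with h1 | h1
      · have h2 := S.sub_mem (S.sub_mem (S.sub_mem h1 (hl u)) (hr f)) (hmem u₀ f₀ h0)
        refine (congrArg (· ∈ S) ?_).mp h2
        simp only [dyad_add_left, dyad_add_right]
        abel
      · have h2 := S.sub_mem (S.add_mem (S.add_mem h1 (hl u)) (hr f)) (hmem u₀ f₀ h0)
        refine (congrArg (· ∈ S) ?_).mp h2
        simp only [dyad_add_left, dyad_add_right, dyad_neg_left, dyad_neg_right]
        abel
    · exact hmem _ _ h
  rw [eq_top_iff, ← span_range_dyad, Submodule.span_le]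
  rintro _ ⟨x, rfl⟩
  exact hall _ _

end GrassmannCone

/-! ### Transport of charts by automorphisms of the cone, and the first type number. -/

section Transport

variable {E : Type*} [NormedAddCommGroup E] [InnerProductSpace ℂ E]
  {C : Set E} {q : E} {T : Type*} [NormedAddCommGroup T] [NormedSpace ℂ T]
  {m τ : ℕ} {ν : ℕ → ℕ}

/-- The image of a chart of a cone under a linear automorphism of the cone. -/
def ConeChart.transport (c : ConeChart C q T m τ ν) (L : E ≃L[ℂ] E) (hL : ∀ v ∈ C, L v ∈ C)
    (hL' : ∀ v ∈ C, L.symm v ∈ C) : ConeChart C (L q) T m τ ν where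
  U a := L.conjContinuousAlgEquiv (c.U a)
  N := (L.conjContinuousAlgEquiv : (E →L[ℂ] E) →L[ℂ] (E →L[ℂ] E)).comp c.N
  y0 := c.y0.comp (L.symm : E →L[ℂ] E)
  κ := c.κ.comp (L.symm : E →L[ℂ] E)
  Fil l := (c.Fil l).map (L : E →ₗ[ℂ] E)
  β := c.β.map L.toLinearEquiv
  U_add a b := by rw [c.U_add, map_mul]
  U_zero := by rw [c.U_zero, map_one]
  contDiff_U := (L.conjContinuousAlgEquiv : (E →L[ℂ] E) →L[ℂ] (E →L[ℂ] E)).contDiff.comp c.contDiff_U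
  hasFDerivAt_U :=
    (L.conjContinuousAlgEquiv : (E →L[ℂ] E) →L[ℂ] (E →L[ℂ] E)).hasFDerivAt.comp 0 c.hasFDerivAt_U
  U_mem a v hv := hL _ (c.U_mem a _ (hL' v hv))
  y0_U a := by simpa using c.y0_U a
  κ_U a := by simpa using c.κ_U a
  graph v hv h0 := by
    have h1 := congrArg L (c.graph (L.symm v) (hL' v hv) h0)
    simpa using h1
  Fil_zero := by
    rw [c.Fil_zero, Submodule.map_span, Set.image_singleton]
    rfl
  Fil_mono _ _ h := Submodule.map_mono (c.Fil_mono h)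
  N_mem a l v hv := by
    obtain ⟨u, hu, rfl⟩ := hv
    exact ⟨c.N a u, c.N_mem a l u hu, by simp⟩
  Fil_succ l := by
    refine (Submodule.map_mono (c.Fil_succ l)).trans ?_
    rw [Submodule.map_sup, Submodule.map_span, ← Set.range_comp]
    refine sup_le_sup_left (Submodule.span_mono ?_) _
    rintro _ ⟨a, rfl⟩
    refine ⟨a, ?_⟩
    change (L.conjContinuousAlgEquiv (c.N a) ^ (l + 1)) (L q) = L ((c.N a ^ (l + 1)) q)
    rw [← map_pow, ContinuousLinearEquiv.conjContinuousAlgEquiv_apply_apply,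
      ContinuousLinearEquiv.symm_apply_apply]
  Fil_eq l hl := by
    rw [c.Fil_eq l hl, Submodule.map_span, ← Set.image_comp]
    rfl
  span_sq := by
    refine (congrArg (fun s => Submodule.span ℂ s = ⊤) ?_).mp c.span_sq
    ext a
    change _ ↔ L.conjContinuousAlgEquiv (c.N a) * L.conjContinuousAlgEquiv (c.N a) = 0
    rw [← map_mul, map_eq_zero_iff L.conjContinuousAlgEquiv (EquivLike.injective _)]
    rfl
  span_sq_ne lam hlam := by
    refine (congrArg (fun s => Submodule.span ℂ s = ⊤) ?_).mp (c.span_sq_ne lam hlam)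
    ext a
    change _ ↔ L.conjContinuousAlgEquiv (c.N a) * L.conjContinuousAlgEquiv (c.N a) = 0 ∧ lam a ≠ 0
    rw [← map_mul, map_eq_zero_iff L.conjContinuousAlgEquiv (EquivLike.injective _)]
    rfl

/-- `(a, b) ↦ N a q + b q` is an isomorphism of `T × ℂ` onto `Fil 1`, whose dimension is `ν 1 + 1`.
-/
theorem ConeChart.nu_one [FiniteDimensional ℂ E] [FiniteDimensional ℂ T]
    (c : ConeChart C q T m τ ν) (hτ : 1 ≤ τ)
    (hν : ν 1 ≤ m) : ν 1 = finrank ℂ T := by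
  let f : T × ℂ →ₗ[ℂ] E := LinearMap.coprod
    (((ContinuousLinearMap.apply ℂ E q).comp c.N : T →L[ℂ] E) : T →ₗ[ℂ] E)
    (LinearMap.toSpanSingleton ℂ E q)
  have hf : ∀ x, f x = c.N x.1 q + x.2 • q := fun x => rfl
  have hi : Function.Injective f := by
    rw [← LinearMap.ker_eq_bot, LinearMap.ker_eq_bot']
    rintro ⟨a, b⟩ h
    rw [hf] at h
    have h1 := congrArg c.κ h
    rw [map_add, map_smul, c.κ_N, c.κ_q, smul_zero, add_zero, map_zero] at h1
    change a = 0 at h1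
    subst h1
    have h2 : b = 0 ∨ q = 0 := by simpa using h
    replace h2 := h2.resolve_right c.q_ne_zero
    exact Prod.ext rfl h2
  have hr : LinearMap.range f = c.Fil 1 := by
    refine le_antisymm ?_ fun X hX => ?_
    · rintro _ ⟨x, rfl⟩
      rw [hf]
      refine Submodule.add_mem _ (by simpa using c.N_pow_mem x.1 1) (Submodule.smul_mem _ _ ?_)
      exact c.Fil_mono (Nat.zero_le 1) (by simpa using c.N_pow_mem x.1 0)
    · obtain ⟨a, b, rfl⟩ := c.exists_of_mem_Fil_one hX
      exact ⟨(a, b), rfl⟩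
  have h1 := LinearMap.finrank_range_of_inj hi
  rw [hr, c.finrank_Fil hτ hν, Module.finrank_prod, Module.finrank_self] at h1
  omega

end Transport

/-! ### Charts at all decomposable vectors, and the Plücker image. -/

section GrassmannCone

variable {n p : ℕ}

/-- The chart of the cone of decomposable vectors that is centred at the product of the first `n`
basis vectors. -/
theorem nonempty_coneChart_wedgeBasis {N : ℕ} (hN : N + 1 = (n + p).choose n) :
    Nonempty (ConeChart (decomposables (n + p) n) (wedgeBasis (Fin.castAdd p))
      (Fin p → Fin n → ℂ) N p (grassmannNu n p)) := by
  obtain ⟨β, hβ⟩ := exists_adapted_basis (m := N) (by rw [card_powersetCard_fin, hN])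
    (wedgeONB (n + p) n) level
  exact ⟨{
    U := unip
    N := unipDeriv
    y0 := LinearMap.toContinuousLinearMap (minor (Fin.castAdd p))
    κ := LinearMap.toContinuousLinearMap cellCoord
    Fil := wedgeFil n p
    β := β
    U_add := unip_add
    U_zero := unip_zero
    contDiff_U := contDiff_unip
    hasFDerivAt_U := hasFDerivAt_unip
    U_mem := fun η _ hy => unip_mem_decomposables η hy
    y0_U := minor_unip
    κ_U := cellCoord_unip
    graph := fun _ hy h0 => eq_minor_smul_unip hy h0
    Fil_zero := wedgeFil_zero
    Fil_mono := wedgeFil_mono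
    N_mem := fun η _ _ hx => unipDeriv_mem_wedgeFil η hx
    Fil_succ := wedgeFil_succ
    Fil_eq := fun l _ => by
      rw [wedgeFil_eq_span_wedgeONB, hβ]
      have h1 := one_le_card_level_le (n := n) (p := p) l
      congr 2
      ext a
      -- `β` is numbered from zero, so the condition "less than the count" is "at most the count
      -- minus one"; the count is positive.
      simp only [Set.mem_ofPred_eq, grassmannNu]
      omega
    span_sq := span_unipDeriv_sq
    span_sq_ne := span_unipDeriv_sq_ne }⟩

theorem exists_linearEquiv_castAdd {v : Fin n → Fin (n + p) → ℂ} (hv : LinearIndependent ℂ v) :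
    ∃ g : (Fin (n + p) → ℂ) ≃ₗ[ℂ] Fin (n + p) → ℂ,
      ∀ i, g (Pi.single (Fin.castAdd p i) 1) = v i := by
  let b := Basis.sumExtend hv
  have hb : ∀ i, b (Sum.inl i) = v i := by
    intro i
    simp only [b, Basis.sumExtend, Basis.reindex_apply, Basis.extend_apply_self]
    rfl
  have : Finite (Basis.sumExtendIndex hv) :=
    (Module.Finite.finite_basis b).of_injective _ Sum.inr_injective
  have : Fintype (Basis.sumExtendIndex hv) := Fintype.ofFinite _
  have hcard : Fintype.card (Basis.sumExtendIndex hv) = p := by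
    have h1 := Module.finrank_eq_card_basis b
    rw [Module.finrank_fin_fun, Fintype.card_sum, Fintype.card_fin] at h1
    omega
  let σ : Fin (n + p) ≃ Fin n ⊕ Basis.sumExtendIndex hv :=
    finSumFinEquiv.symm.trans (Equiv.sumCongr (Equiv.refl _) (Fintype.equivFinOfCardEq hcard).symm)
  refine ⟨(Pi.basisFun ℂ (Fin (n + p))).equiv b σ, fun i => ?_⟩
  rw [← hb, ← Pi.basisFun_apply, Basis.equiv_apply]
  simp [σ]

theorem wedgeMap_wedgeBasis {v : Fin n → Fin (n + p) → ℂ}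
    {g : (Fin (n + p) → ℂ) →ₗ[ℂ] Fin (n + p) → ℂ}
    (hg : ∀ i, g (Pi.single (Fin.castAdd p i) 1) = v i) :
    wedgeMap n g (wedgeBasis (Fin.castAdd p)) = wedge (n + p) n v := by
  rw [wedgeBasis, wedgeMap_wedge]
  simp only [hg]

/-- The action of an automorphism of `ℂᵏ` on the exterior power, as an equivalence. -/
def wedgeMapEquiv {k : ℕ} (n : ℕ) (g : (Fin k → ℂ) ≃ₗ[ℂ] Fin k → ℂ) : Wedge k n ≃L[ℂ] Wedge k n :=
  ContinuousLinearEquiv.equivOfInverse (wedgeMap n (g : (Fin k → ℂ) →ₗ[ℂ] Fin k → ℂ))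
    (wedgeMap n (g.symm : (Fin k → ℂ) →ₗ[ℂ] Fin k → ℂ))
    (fun x => by
      have h1 : (g.symm : (Fin k → ℂ) →ₗ[ℂ] Fin k → ℂ) * (g : (Fin k → ℂ) →ₗ[ℂ] Fin k → ℂ) = 1 :=
        LinearMap.ext fun y => g.symm_apply_apply y
      rw [← mul_apply_eq_comp, ← wedgeMap_mul, h1, wedgeMap_one]
      rfl)
    (fun x => by
      have h1 : (g : (Fin k → ℂ) →ₗ[ℂ] Fin k → ℂ) * (g.symm : (Fin k → ℂ) →ₗ[ℂ] Fin k → ℂ) = 1 :=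
        LinearMap.ext fun y => g.apply_symm_apply y
      rw [← mul_apply_eq_comp, ← wedgeMap_mul, h1, wedgeMap_one]
      rfl)

/-- `GL(n+p)` permutes the decomposable vectors transitively. The automorphism need not be unitary,
because none of the data of a chart involve the metric. -/
theorem nonempty_coneChart {N : ℕ} (hN : N + 1 = (n + p).choose n) {y : Wedge (n + p) n}
    (hy : y ∈ decomposables (n + p) n) :
    Nonempty (ConeChart (decomposables (n + p) n) y (Fin p → Fin n → ℂ) N p (grassmannNu n p)) := by
  obtain ⟨v, hv, rfl⟩ := hy
  obtain ⟨g, hg⟩ := exists_linearEquiv_castAdd hv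
  obtain ⟨c⟩ := nonempty_coneChart_wedgeBasis hN
  have h1 : wedgeMapEquiv n g (wedgeBasis (Fin.castAdd p)) = wedge (n + p) n v :=
    wedgeMap_wedgeBasis hg
  rw [← h1]
  exact ⟨c.transport (wedgeMapEquiv n g) (fun _ h => wedgeMap_mem_decomposables g.ker h)
    fun _ h => wedgeMap_mem_decomposables g.symm.ker h⟩

theorem wedge_ne_zero {v : Fin n → Fin (n + p) → ℂ} (hv : LinearIndependent ℂ v) :
    wedge (n + p) n v ≠ 0 := by
  obtain ⟨g, hg⟩ := exists_linearEquiv_castAdd hv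
  have h1 : wedgeMapEquiv n g (wedgeBasis (Fin.castAdd p)) = wedge (n + p) n v :=
    wedgeMap_wedgeBasis hg
  rw [← h1]
  exact (map_ne_zero_iff _ (wedgeMapEquiv n g).injective).mpr wedgeBasis_castAdd_ne_zero

theorem pluckerLine_eq_span (L : Gr n (n + p)) {v : Fin n → Fin (n + p) → ℂ}
    (hv : LinearIndependent ℂ v) (hL : ∀ i, v i ∈ L.1) :
    pluckerLine L = Submodule.span ℂ {wedge (n + p) n v} := by
  have h1 : wedge (n + p) n v ∈ pluckerLine L := by
    refine ⟨exteriorPower.map n L.1.subtype (exteriorPower.ιMulti ℂ n fun i => ⟨v i, hL i⟩),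
      ⟨_, rfl⟩, ?_⟩
    rw [exteriorPower.map_apply_ιMulti]
    rfl
  refine (Submodule.eq_of_le_of_finrank_eq ?_ ?_).symm
  · rwa [Submodule.span_singleton_le_iff_mem]
  · rw [finrank_span_singleton (wedge_ne_zero hv), finrank_pluckerLine]

theorem hopf_eq_plucker_iff (y : Metric.sphere (0 : Wedge (n + p) n) 1) (L : Gr n (n + p)) :
    hopf y = plucker L ↔ pluckerLine L = Submodule.span ℂ {(y : Wedge (n + p) n)} := by
  rw [← Projectivization.submodule_injective.eq_iff, hopf, plucker, Projectivization.submodule_mk,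
    Projectivization.submodule_mk'', eq_comm]

/-- The line of the subspace spanned by independent `vᵢ` is spanned by their product. A unit vector
of this line differs from the product by a nonzero scalar, which can be absorbed into one factor as
`n ≥ 1`. -/
theorem circleBundle_range_plucker (hn : 1 ≤ n) :
    circleBundle (Set.range (plucker (n := n) (k := n + p))) = link (decomposables (n + p) n) := by
  ext y
  constructor
  · rintro ⟨y, ⟨L, hL⟩, rfl⟩
    rw [eq_comm, hopf_eq_plucker_iff] at hL
    refine ⟨?_, y.2⟩
    let b : Basis (Fin n) ℂ L.1 := Module.finBasisOfFinrankEq ℂ L.1 L.2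
    have hb : LinearIndependent ℂ fun i => (b i : Fin (n + p) → ℂ) :=
      b.linearIndependent.map' L.1.subtype L.1.ker_subtype
    rw [pluckerLine_eq_span L hb fun i => (b i).2] at hL
    have h1 : (y : Wedge (n + p) n) ∈ Submodule.span ℂ {(y : Wedge (n + p) n)} :=
      Submodule.mem_span_singleton_self _
    rw [← hL] at h1
    obtain ⟨a, ha⟩ := Submodule.mem_span_singleton.mp h1
    have ha0 : a ≠ 0 := by
      rintro rfl
      rw [zero_smul] at ha
      exact ne_zero_of_mem_unit_sphere y ha.symm
    rw [← ha]
    exact smul_mem_decomposables hn ⟨_, hb, rfl⟩ ha0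
  · rintro ⟨⟨v, hv, rfl⟩, hy⟩
    refine ⟨⟨_, hy⟩, ⟨⟨Submodule.span ℂ (Set.range v), ?_⟩, ?_⟩, rfl⟩
    · rw [finrank_span_eq_card hv, Fintype.card_fin]
    · rw [eq_comm, hopf_eq_plucker_iff]
      exact pluckerLine_eq_span _ hv fun i => Submodule.subset_span ⟨i, rfl⟩

/-- The circle bundles over the Grassmannians are Bochner rigid. -/
theorem isBochnerRigidSubmanifold_circleBundle {N : ℕ} (hp : 1 ≤ p) (hpn : p ≤ n)
    (hN : N + 1 = (n + p).choose n) : IsBochnerRigidSubmanifold N (n * p)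
      (circleBundle (Set.range (plucker (n := n) (k := n + p)))) := by
  have hmono : ∀ l < p, grassmannNu n p l < grassmannNu n p (l + 1) :=
    fun l hl => grassmannNu_lt hl (hl.trans_le hpn)
  have hT : finrank ℂ (Fin p → Fin n → ℂ) = n * p := by
    rw [Module.finrank_pi_fintype]
    simp [mul_comm]
  have h1 : grassmannNu n p 1 ≤ N := by
    rw [← grassmannNu_top hN, grassmannNu, grassmannNu]
    refine Nat.sub_le_sub_right (Finset.card_le_card fun I hI => ?_) 1
    simp only [Finset.mem_filter, Finset.mem_univ, true_and] at hI ⊢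
    omega
  obtain ⟨c⟩ := nonempty_coneChart_wedgeBasis hN
  rw [circleBundle_range_plucker (hp.trans hpn), ← hT]
  exact isBochnerRigidSubmanifold_link
    (fun v hv a ha => smul_mem_decomposables (hp.trans hpn) hv ha)
    (fun y hy => nonempty_coneChart hN hy.1) hp grassmannNu_zero (c.nu_one hp h1)
    (grassmannNu_top hN) hmono

end GrassmannCone

end BochnerCR

end

theorem mainTheorem6 (n p N : ℕ) (hpn : p ≤ n) (hp : p = 2 ∨ p = 3)
    (hN : N + 1 = (n + p).choose n) :
    BochnerCR.IsBochnerRigidSubmanifold N (n * p)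
      (BochnerCR.circleBundle (Set.range (BochnerCR.plucker (n := n) (k := n + p)))) :=
  BochnerCR.isBochnerRigidSubmanifold_circleBundle (by omega) hpn hN
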